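/- Let $M$ be a smooth (Hausdorff, second countable) $7$-manifold with a smooth free action of the circle $\mathbb S^1$, let $\xi(x)=\frac{d}{dt}\big|_{t=0}e^{it}\cdot x$ be the vector field generating the action, and let $\pi:M\to N=M/\mathbb S^1$ be the projection. Conventions. A $G_2$-structure on $M$ is a smooth $3$-form $\varphi$ such that for every $x$ some linear isomorphism $T_xM\cong\mathbb R^7$ carries $\varphi_x$ to $e^{123}+e^{145}+e^{167}+e^{246}-e^{257}-e^{347}-e^{356}$; its metric $g_\varphi$ and volume form $\mathrm{vol}_\varphi$ are determined by $\frac16(u\lrcorner\varphi)\wedge(v\lrcorner\varphi)\wedge\varphi=g_\varphi(u,v)\,\mathrm{vol}_\varphi$, and $*_\varphi$ is the Hodge star. It is $\mathbb S^1$-invariant if $\mathcal L_\xi\varphi=0$. An $SU(3)$-structure on a $6$-manifold $N$ is a pair of smooth forms, a real $2$-form $\omega$ and a complex $3$-form $\Omega=\Omega_++i\Omega_-$, such that $\omega\wedge\Omega_+=0$, $\frac16\omega^3=\frac14\Omega_+\wedge\Omega_-$, and at each point $\Omega$ is a nonzero form of type $(3,0)$ for a complex structure $J$ on the tangent space for which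 $\omega(\cdot,J\cdot)$ is positive definite. A connection $1$-form is a smooth $1$-form $\eta$ on $M$ that is invariant under the action and satisfies $\eta(\xi)=1$. Proposition. (0) $N$ is Hausdorff and second countable and carries a smooth $6$-manifold structure for which $\pi$ is a smooth submersion. (1) For every $\mathbb S^1$-invariant $G_2$-structure $\varphi$ on $M$, the function $h=\|\xi\|_\varphi^{-2}$ is positive, smooth and basic (it satisfies $dh(\xi)=0$ and is constant on orbits), and $\eta=h\,g_\varphi(\xi,\cdot)$ is an $\mathbb S^1$-invariant connection $1$-form, with $\eta(\xi)=1$. (2) Let $N$ carry any smooth $6$-manifold structure for which $\pi$ is a smooth submersion. Every $\mathbb S^1$-invariant $G_2$-structure $\varphi$ determines unique reduced data $(h,\eta,\omega,\Omega)$, consisting of a positive smooth function $h$ on $N$, a connection $1$-form $\eta$ on $M$ and an $SU(3)$-structure $(\omega,\Omega)$ on $N$, by $$\pi^*h=\|\xi\|_\varphi^{-2},\qquad \eta=(\pi^*h)\,g_\varphi(\xi,\cdot),\qquad \pi^*\omega=\iota_\xi\varphi,$$ $$\pi^*\Omega_+=(\pi^*h)^{-3/4}(\varphi-\eta\wedge\iota_\xi\varphi),\qquad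 \pi^*\Omega_-=-(\pi^*h)^{-1/4}\,\iota_\xi(*_\varphi\varphi).$$ The map $\varphi\mapsto(h,\eta,\omega,\Omega)$ is a bijection from the set of $\mathbb S^1$-invariant $G_2$-structures on $M$ onto the set of all such reduced data, and its inverse is $$(h,\eta,\omega,\Omega)\longmapsto \eta\wedge\pi^*\omega+(\pi^*h)^{3/4}\,\pi^*\Omega_+ .$$ -/

import Mathlib

open scoped Manifold ContDiff

noncomputable section

namespace CircleG2

/-! ### Multilinear algebra -/

section LinearAlgebra

variable {V : Type*} [AddCommGroup V] [Module ℝ V]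

/-- The wedge product of real alternating forms, as a bilinear map, normalised as the sum over
shuffles, so that `(α ∧ β)(v, w) = α v * β w - α w * β v` for `1`-forms. -/
def wedge {p q : ℕ} :
    (V [⋀^Fin p]→ₗ[ℝ] ℝ) →ₗ[ℝ] (V [⋀^Fin q]→ₗ[ℝ] ℝ) →ₗ[ℝ] (V [⋀^Fin (p + q)]→ₗ[ℝ] ℝ) :=
  LinearMap.mk₂ ℝ
    (fun α β ↦ ((LinearMap.mul' ℝ ℝ).compAlternatingMap (α.domCoprod β)).domDomCongr
      finSumFinEquiv)
    (fun α α' β ↦ by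
      have h := AlternatingMap.domCoprod'.map_add (α ⊗ₜ[ℝ] β) (α' ⊗ₜ[ℝ] β)
      rw [← TensorProduct.add_tmul] at h
      simp only [AlternatingMap.domCoprod'_apply] at h
      rw [h]; ext v; simp)
    (fun c α β ↦ by
      have h := AlternatingMap.domCoprod'.map_smul c (α ⊗ₜ[ℝ] β)
      rw [TensorProduct.smul_tmul'] at h
      simp only [AlternatingMap.domCoprod'_apply] at h
      rw [h]; ext v; simp)
    (fun α β β' ↦ by
      have h := AlternatingMap.domCoprod'.map_add (α ⊗ₜ[ℝ] β) (α ⊗ₜ[ℝ] β')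
      rw [← TensorProduct.tmul_add] at h
      simp only [AlternatingMap.domCoprod'_apply] at h
      rw [h]; ext v; simp)
    (fun c α β ↦ by
      have h := AlternatingMap.domCoprod'.map_smul c (α ⊗ₜ[ℝ] β)
      rw [← TensorProduct.tmul_smul] at h
      simp only [AlternatingMap.domCoprod'_apply] at h
      rw [h]; ext v; simp)

/-- The elementary `3`-form `eⁱ ∧ eʲ ∧ eᵏ` on `ℝ⁷`, indices counted from `0`. -/
def elem3 (i j k : Fin 7) : (Fin 7 → ℝ) [⋀^Fin 3]→ₗ[ℝ] ℝ :=
  (Matrix.detRowAlternating (n := Fin 3) (R := ℝ)).compLinearMap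
    (LinearMap.pi ![LinearMap.proj i, LinearMap.proj j, LinearMap.proj k])

/-- The model `3`-form on `ℝ⁷`,
`e¹²³ + e¹⁴⁵ + e¹⁶⁷ + e²⁴⁶ - e²⁵⁷ - e³⁴⁷ - e³⁵⁶` (here with indices counted from `0`). -/
def modelG2 : (Fin 7 → ℝ) [⋀^Fin 3]→ₗ[ℝ] ℝ :=
  elem3 0 1 2 + elem3 0 3 4 + elem3 0 5 6 + elem3 1 3 5 - elem3 1 4 6 - elem3 2 3 6 - elem3 2 4 5

/-- A `3`-form is positive if some linear isomorphism with `ℝ⁷` carries it to the model form. -/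
def IsPositive (φ : V [⋀^Fin 3]→ₗ[ℝ] ℝ) : Prop :=
  ∃ u : V ≃ₗ[ℝ] (Fin 7 → ℝ), φ = modelG2.compLinearMap u.toLinearMap

/-- The coefficient, in the basis `e`, of the `7`-form valued bilinear form
`B(v, w) = (1/6) (v ⌟ φ) ∧ (w ⌟ φ) ∧ φ`. -/
def bilinB (φ : V [⋀^Fin 3]→ₗ[ℝ] ℝ) (e : Module.Basis (Fin 7) ℝ V) : V →ₗ[ℝ] V →ₗ[ℝ] ℝ :=
  LinearMap.mk₂ ℝ
    (fun v w ↦ (1 / 6 : ℝ) * wedge (wedge (φ.curryLeft v) (φ.curryLeft w)) φ e)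
    (fun v v' w ↦ by simp [mul_add])
    (fun c v w ↦ by simp; ring)
    (fun v w w' ↦ by simp [mul_add])
    (fun c v w ↦ by simp; ring)

/-- The value on the basis `e` of the volume form of a positive `3`-form `φ`. Since
`B = g ⊗ vol` and `det (g (eᵢ, eⱼ)) = vol(e)²`, one has `det (B (eᵢ, eⱼ)) = vol(e)⁹`, so `vol(e)` is
the real ninth root of this determinant. -/
def volCoeff (φ : V [⋀^Fin 3]→ₗ[ℝ] ℝ) (e : Module.Basis (Fin 7) ℝ V) : ℝ :=
  let d : ℝ := (Matrix.of fun i j ↦ bilinB φ e (e i) (e j)).det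
  SignType.sign d * |d| ^ (1 / 9 : ℝ)

/-- The inner product `g_φ` of a positive `3`-form, determined by `B = g_φ ⊗ vol_φ`. It does not
depend on the basis `e`. -/
def metric (φ : V [⋀^Fin 3]→ₗ[ℝ] ℝ) (e : Module.Basis (Fin 7) ℝ V) : V →ₗ[ℝ] V →ₗ[ℝ] ℝ :=
  (volCoeff φ e)⁻¹ • bilinB φ e

/-- The volume form `vol_φ` of a positive `3`-form. It does not depend on the basis `e`. -/
def volForm (φ : V [⋀^Fin 3]→ₗ[ℝ] ℝ) (e : Module.Basis (Fin 7) ℝ V) : V [⋀^Fin 7]→ₗ[ℝ] ℝ :=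
  volCoeff φ e • e.det

/-- The Hodge star `*_φ β` of a `3`-form `β`, for the metric and orientation given by `φ`:
`(*β)(v₁, …, v₄) = (1/6) ∑ gⁱᵃ gʲᵇ gᵏᶜ β(e_a, e_b, e_c) vol(e_i, e_j, e_k, v₁, …, v₄)`,
which is the convention `α ∧ *β = ⟨α, β⟩ vol`. It does not depend on the basis `e`. -/
def hodgeStar (φ : V [⋀^Fin 3]→ₗ[ℝ] ℝ) (e : Module.Basis (Fin 7) ℝ V)
    (β : V [⋀^Fin 3]→ₗ[ℝ] ℝ) : V [⋀^Fin 4]→ₗ[ℝ] ℝ :=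
  let G : Matrix (Fin 7) (Fin 7) ℝ := (Matrix.of fun i j ↦ metric φ e (e i) (e j))⁻¹
  (1 / 6 : ℝ) • ∑ i, ∑ j, ∑ k, ∑ a, ∑ b, ∑ c,
    (G i a * G j b * G k c * β ![e a, e b, e c]) •
      (((volForm φ e).curryLeft (e i)).curryLeft (e j)).curryLeft (e k)

/-- The real part of a complex-valued form. -/
def rePart {k : ℕ} (Ω : V [⋀^Fin k]→ₗ[ℝ] ℂ) : V [⋀^Fin k]→ₗ[ℝ] ℝ :=
  Complex.reLm.compAlternatingMap Ω

/-- The imaginary part of a complex-valued form. -/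
def imPart {k : ℕ} (Ω : V [⋀^Fin k]→ₗ[ℝ] ℂ) : V [⋀^Fin k]→ₗ[ℝ] ℝ :=
  Complex.imLm.compAlternatingMap Ω

/-- A linear `SU(3)`-structure on a real vector space of dimension `6`: a real `2`-form `ω₀` and a
complex volume form `Ω₀` (a nonzero form of type `(3,0)` for a complex structure `J`) such that
`ω₀ ∧ Re Ω₀ = 0` and `ω₀³ / 6 = Re Ω₀ ∧ Im Ω₀ / 4`, and such that `ω₀(·, J ·)` is positive definite
(in particular `ω₀` is non-degenerate). -/
structure IsSU3 (ω₀ : V [⋀^Fin 2]→ₗ[ℝ] ℝ) (Ω₀ : V [⋀^Fin 3]→ₗ[ℝ] ℂ) : Prop where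
  finrank_eq : Module.finrank ℝ V = 6
  omega_wedge : wedge ω₀ (rePart Ω₀) = 0
  volume_eq : (1 / 6 : ℝ) • wedge (wedge ω₀ ω₀) ω₀ = (1 / 4 : ℝ) • wedge (rePart Ω₀) (imPart Ω₀)
  ne_zero : Ω₀ ≠ 0
  complex_structure : ∃ J : V →ₗ[ℝ] V, (∀ v, J (J v) = -v) ∧
    (∀ u v w, Ω₀ ![J u, v, w] = Complex.I * Ω₀ ![u, v, w]) ∧
    (∀ v, v ≠ 0 → 0 < ω₀ ![v, J v])

end LinearAlgebra

/-! ### Differential forms on manifolds -/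

section Forms

/-- (Not necessarily smooth) `k`-forms on an `n`-manifold with values in `F`. -/
abbrev DForm (n : ℕ) (M : Type*) [TopologicalSpace M] [ChartedSpace (EuclideanSpace ℝ (Fin n)) M]
    (k : ℕ) (F : Type*) [AddCommGroup F] [Module ℝ F] :=
  ∀ x : M, (TangentSpace (𝓡 n) x) [⋀^Fin k]→ₗ[ℝ] F

/-- A form is smooth if its coefficient functions in the charts of the manifold are smooth. -/
def IsSmoothForm {n : ℕ} {M : Type*} [TopologicalSpace M]
    [ChartedSpace (EuclideanSpace ℝ (Fin n)) M] {k : ℕ} {F : Type*} [NormedAddCommGroup F]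
    [NormedSpace ℝ F] (α : DForm n M k F) : Prop :=
  ∀ (x₀ : M) (v : Fin k → EuclideanSpace ℝ (Fin n)),
    ContDiffOn ℝ ∞
      (fun y ↦ α ((extChartAt (𝓡 n) x₀).symm y) fun i ↦
        mfderiv 𝓘(ℝ, EuclideanSpace ℝ (Fin n)) (𝓡 n) (extChartAt (𝓡 n) x₀).symm y (v i))
      (extChartAt (𝓡 n) x₀).target

/-- The pullback `f^* α` of a form along a differentiable map. -/
def pullback {m n : ℕ} {M N : Type*} [TopologicalSpace M]
    [ChartedSpace (EuclideanSpace ℝ (Fin m)) M] [TopologicalSpace N]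
    [ChartedSpace (EuclideanSpace ℝ (Fin n)) N] {k : ℕ} {F : Type*} [AddCommGroup F] [Module ℝ F]
    (f : M → N) (α : DForm n N k F) : DForm m M k F :=
  fun x ↦ (α (f x)).compLinearMap (mfderiv (𝓡 m) (𝓡 n) f x).toLinearMap

variable {M : Type*} [TopologicalSpace M] [ChartedSpace (EuclideanSpace ℝ (Fin 7)) M]

/-- A `G₂`-structure on a `7`-manifold: a smooth `3`-form which is positive at every point. -/
structure IsG2Structure (φ : DForm 7 M 3 ℝ) : Prop where
  smooth : IsSmoothForm φ
  positive : ∀ x, IsPositive (φ x)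

/-- The standard basis of a tangent space (given by the preferred chart at the point); it serves
only to write down the basis-independent objects `g_φ` and `*_φ`. -/
def tangentBasis (x : M) : Module.Basis (Fin 7) ℝ (TangentSpace (𝓡 7) x) :=
  (EuclideanSpace.basisFun (Fin 7) ℝ).toBasis

/-- The Riemannian metric `g_φ` of a `G₂`-structure. -/
def gMetric (φ : DForm 7 M 3 ℝ) (x : M) :
    TangentSpace (𝓡 7) x →ₗ[ℝ] TangentSpace (𝓡 7) x →ₗ[ℝ] ℝ :=
  metric (φ x) (tangentBasis x)

/-- The `4`-form `*_φ φ` of a `G₂`-structure. -/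
def starPhi (φ : DForm 7 M 3 ℝ) : DForm 7 M 4 ℝ :=
  fun x ↦ hodgeStar (φ x) (tangentBasis x) (φ x)

/-- An `SU(3)`-structure on a `6`-manifold: smooth forms `ωN`, `ΩN` that define a linear
`SU(3)`-structure on each tangent space. -/
structure IsSU3Structure {N : Type*} [TopologicalSpace N]
    [ChartedSpace (EuclideanSpace ℝ (Fin 6)) N] (ωN : DForm 6 N 2 ℝ) (ΩN : DForm 6 N 3 ℂ) :
    Prop where
  smooth_omega : IsSmoothForm ωN
  smooth_Omega : IsSmoothForm ΩN
  isSU3 : ∀ y, IsSU3 (ωN y) (ΩN y)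

end Forms

/-! ### Circle actions -/

section Action

variable (M : Type*) [TopologicalSpace M] [ChartedSpace (EuclideanSpace ℝ (Fin 7)) M]
  [MulAction Circle M]

/-- The quotient `N = M / S¹`, with the quotient topology. -/
abbrev OrbitSpace : Type _ := MulAction.orbitRel.Quotient Circle M

variable {M}

/-- The projection `π : M → M / S¹`. -/
def proj (x : M) : OrbitSpace M := Quotient.mk'' x

/-- The vector field `ξ` generating the action, `ξ(x) = d/dt|₀ exp(it) • x`. -/
def fundField (x : M) : TangentSpace (𝓡 7) x :=
  mfderiv 𝓘(ℝ, ℝ) (𝓡 7) (fun t : ℝ ↦ Circle.exp t • x) 0 (1 : ℝ)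

/-- The value `(L_ξ α)_x (v₁, …, v_k)` of the Lie derivative along `ξ`, whose flow is
`x ↦ exp(it) • x`. -/
def lieDeriv {k : ℕ} (α : DForm 7 M k ℝ) (x : M) (v : Fin k → TangentSpace (𝓡 7) x) : ℝ :=
  deriv (fun t : ℝ ↦ pullback (fun y : M ↦ Circle.exp t • y) α x v) 0

/-- A connection `1`-form for the circle action: smooth, invariant under the action, and equal to
`1` on the generating vector field. -/
structure IsConnectionForm (η : DForm 7 M 1 ℝ) : Prop where
  smooth : IsSmoothForm η
  invariant : ∀ z : Circle, pullback (fun y : M ↦ z • y) η = η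
  apply_field : ∀ x, η x ![fundField x] = 1

/-- An `S¹`-invariant `G₂`-structure: `L_ξ φ = 0`. -/
structure IsInvariantG2 (φ : DForm 7 M 3 ℝ) : Prop where
  isG2 : IsG2Structure φ
  lieDeriv_eq_zero : ∀ x v, lieDeriv φ x v = 0

/-- The function `h = ‖ξ‖_φ ^ (-2)`. -/
def hFun (φ : DForm 7 M 3 ℝ) (x : M) : ℝ :=
  (gMetric φ x (fundField x) (fundField x))⁻¹

/-- The `1`-form `η = h g_φ(ξ, ·)`. -/
def etaForm (φ : DForm 7 M 3 ℝ) : DForm 7 M 1 ℝ :=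
  fun x ↦ AlternatingMap.ofSubsingleton ℝ (TangentSpace (𝓡 7) x) ℝ (0 : Fin 1)
    (hFun φ x • gMetric φ x (fundField x))

variable (M) in
/-- Reduced data `(h, η, ωN, ΩN)`: a positive smooth function `h` on `N = M / S¹`, a connection form
`η` on `M`, and an `SU(3)`-structure `(ωN, ΩN)` on `N`. -/
structure ReducedData [ChartedSpace (EuclideanSpace ℝ (Fin 6)) (OrbitSpace M)] where
  h : OrbitSpace M → ℝ
  η : DForm 7 M 1 ℝ
  ωN : DForm 6 (OrbitSpace M) 2 ℝ
  ΩN : DForm 6 (OrbitSpace M) 3 ℂ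
  h_smooth : ContMDiff (𝓡 6) 𝓘(ℝ, ℝ) ∞ h
  h_pos : ∀ y, 0 < h y
  η_connection : IsConnectionForm η
  isSU3 : IsSU3Structure ωN ΩN

/-- `D` is the reduction of `φ`:
`π^* h = ‖ξ‖_φ ^ (-2)`, `η = h g_φ(ξ, ·)`, `π^* ωN = ξ ⌟ φ`,
`π^* Re ΩN = h ^ (-3/4) (φ - η ∧ (ξ ⌟ φ))` and `π^* Im ΩN = - h ^ (-1/4) (ξ ⌟ *_φ φ)`. -/
structure IsReductionOf [ChartedSpace (EuclideanSpace ℝ (Fin 6)) (OrbitSpace M)]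
    (D : ReducedData M) (φ : DForm 7 M 3 ℝ) : Prop where
  h_eq : ∀ x, D.h (proj x) = hFun φ x
  η_eq : D.η = etaForm φ
  ω_eq : ∀ x, pullback (m := 7) proj D.ωN x = (φ x).curryLeft (fundField x)
  re_eq : ∀ x, rePart (pullback (m := 7) proj D.ΩN x) =
    (hFun φ x ^ (-3 / 4 : ℝ)) •
      (φ x - wedge (etaForm φ x) ((φ x).curryLeft (fundField x)))
  im_eq : ∀ x, imPart (pullback (m := 7) proj D.ΩN x) =
    -(hFun φ x ^ (-1 / 4 : ℝ)) • (starPhi φ x).curryLeft (fundField x)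

/-- The `3`-form `η ∧ π^* ωN + h ^ (3/4) π^* Re ΩN` on `M` built from reduced data. -/
def reconstruct [ChartedSpace (EuclideanSpace ℝ (Fin 6)) (OrbitSpace M)] (D : ReducedData M) :
    DForm 7 M 3 ℝ :=
  fun x ↦ wedge (D.η x) (pullback (m := 7) proj D.ωN x) +
    (D.h (proj x) ^ (3 / 4 : ℝ)) • rePart (pullback (m := 7) proj D.ΩN x)

end Action

end CircleG2

end

/-!
The theorem is pointwise linear algebra, transported to manifolds by two principles: smoothness of
forms can be tested on plots, and horizontal invariant forms descend along a submersion.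

*Linear algebra.* Write `ℝ⁷ = ℝ × ℂ³`. The model form is `φ₀ = e⁰ ∧ ω₀ + Re Ω₀`, where `ω₀` and
`Ω₀` are the Kähler form and the complex volume form of `ℂ³` (`modelG2_eq`). The bilinear form
which defines the metric of `φ₀` is the dot product (`bilinB_modelG2`), so that the metric of a
positive form is the dot product in any adapted frame (`metric_model_comp`), and `e₀ ⌟ *φ₀ = -Im
Ω₀` (`modelStar_apply`). The reduction formulas therefore hold as soon as the vector `ξ` points
along the first axis of an adapted frame. Such a frame exists because the automorphism group of
`φ₀` acts transitively on the unit vectors (`exists_modelG2_automorphism`): if `a` is a unit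
vector and `×` is the cross product of `φ₀`, then `a × ·` is a complex structure on the orthogonal
complement of `a`, and unit vectors `f₁ ⊥ a` and `f₂ ⊥ a, f₁, a × f₁` give a complex frame `f₁,
f₂, f₁ × f₂` in which `φ₀` has its standard form. If `u` is a frame with `u ξ = r e₀`, the map `q
= √r • (toC3 ∘ u)` to `ℂ³` has kernel `ℝ ξ` and pulls `ω₀` and `Ω₀` back to the reduced tensors;
the powers of `h = r⁻²` in the statement are those that compensate the factor `√r`
(`IsPositive.exists_reduction`).

Conversely, every linear `SU(3)`-structure is isomorphic to `(ω₀, Ω₀)` (`IsSU3.exists_std_frame`).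
The condition `ω ∧ Re Ω = 0` says that `ω` has type `(1, 1)`, hence a unitary frame for the metric
`ω(·, J ·)` puts `ω` in standard form; then `Ω = c dz₁ ∧ dz₂ ∧ dz₃`, and the volume condition
gives `|c| = 1`, so that `c` is absorbed by a rotation of the third coordinate. With such a frame
and a form `η` with `η(ξ) = 1`, the maps `s ^ (-1/2) η` and `s ^ (1/4) q` form an adapted frame of
`η ∧ q^* ω₀ + s ^ (3/4) q^* Re Ω₀`, whose reduction is read off from the same formulas
(`isPositive_reconstruct`).

*Forms on `M`.* A form with `L_ξ α = 0` is invariant under the circle, since `t ↦ exp(it)^* α` has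
derivative zero at all times (`invariant_of_lieDeriv_eq_zero`). The metric and the Hodge star of a
positive form depend smoothly on it, being built from determinants, inverse matrices and a ninth
root of a number which is not zero. Hence `h` and `η` are smooth and invariant.

*Descent.* A submersion has smooth local sections, so a form on its base is smooth if its pullback
is (`isSmoothForm_of_pullback`). The kernel of `dπ` is spanned by `ξ`, the pointwise reduction
shows that the reduced forms factor through `dπ`, and their invariance makes the form on `M / S¹`
well defined (`exists_descent`). Surjectivity of `dπ` gives uniqueness.

*The orbit space.* In a chart of `M`, a linear complement of `ξ(x)` is a slice `s` for which `(t,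
w) ↦ exp(it) • s w` is a local diffeomorphism. Group elements far from `1` form a compact set and
do not fix `x`, so that a small slice meets each orbit at most once (`exists_flowBox`). The maps
`w ↦ π (s w)` are then homeomorphisms onto open sets, their inverses are smooth on `M`, and all
slices together form an atlas for which `π` is a submersion.
-/

noncomputable section

namespace CircleG2

/-! ### Signed sums over permutations -/

section PermSum

variable {V : Type*}

/-- The signed sum over all permutations of the arguments of a function of `n` vectors. -/
def permSum {n : ℕ} (F : (Fin n → V) → ℝ) (v : Fin n → V) : ℝ :=
  ∑ σ : Equiv.Perm (Fin n), (Equiv.Perm.sign σ : ℝ) * F (v ∘ σ)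

/-- Expansion of a signed sum over permutations along the position of the first vector. -/
theorem permSum_cons {n : ℕ} (F : (Fin (n + 1) → V) → ℝ) (v : V) (w : Fin n → V) :
    permSum F (Matrix.vecCons v w) =
      ∑ i : Fin (n + 1), (-1 : ℝ) ^ (i : ℕ) *
        permSum (fun u ↦ F (Fin.insertNth (α := fun _ ↦ V) i v u)) w := by
  have hb : Function.Bijective (fun x : Fin (n + 1) × Equiv.Perm (Fin n) ↦
      Equiv.Perm.decomposeFin.symm (0, x.2) * x.1.cycleRange) := by
    rw [Fintype.bijective_iff_injective_and_card]
    refine ⟨fun ⟨i, τ⟩ ⟨j, τ'⟩ h ↦ ?_, by simp [Fintype.card_perm, Nat.factorial_succ]⟩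
    simp only at h
    have hij : i = j := by
      have h1 := congrArg (fun σ : Equiv.Perm (Fin (n + 1)) ↦ σ⁻¹ 0) h
      have aux (i : Fin (n + 1)) (τ : Equiv.Perm (Fin n)) :
          (Equiv.Perm.decomposeFin.symm (0, τ) * i.cycleRange)⁻¹ 0 = i := by
        rw [Equiv.Perm.inv_eq_iff_eq]; simp
      simpa only [aux] using h1
    subst hij
    have h2 := Equiv.Perm.decomposeFin.symm.injective (mul_right_cancel h)
    simpa using h2
  rw [permSum, ← hb.sum_comp, Fintype.sum_prod_type]
  refine Finset.sum_congr rfl fun i _ ↦ ?_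
  rw [permSum, Finset.mul_sum]
  refine Finset.sum_congr rfl fun τ _ ↦ ?_
  have hv : Matrix.vecCons v w ∘ (Equiv.Perm.decomposeFin.symm (0, τ) * i.cycleRange :
      Equiv.Perm (Fin (n + 1))) = Fin.insertNth (α := fun _ ↦ V) i v (w ∘ τ) := by
    funext k
    refine Fin.succAboveCases i ?_ (fun j ↦ ?_) k
    · simp
    · simp [Fin.cycleRange_succAbove]
  rw [hv, Equiv.Perm.sign_mul, Equiv.Perm.decomposeFin.symm_sign, Fin.sign_cycleRange]
  push_cast
  simp
  ring

theorem permSum_const_mul {n : ℕ} (c : ℝ) (F : (Fin n → V) → ℝ) (v : Fin n → V) :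
    permSum (fun w ↦ c * F w) v = c * permSum F v := by
  simp only [permSum, Finset.mul_sum]
  exact Finset.sum_congr rfl fun σ _ ↦ by ring

theorem insertNth_apply_eq_dite {n : ℕ} (i : Fin (n + 1)) (v : V) (w : Fin n → V)
    (j : Fin (n + 1)) : Fin.insertNth (α := fun _ ↦ V) i v w j =
      if h : j.val < i.val then w ⟨j, by omega⟩
      else if h' : j.val = i.val then v else w ⟨j - 1, by omega⟩ := by
  rcases lt_trichotomy j i with h | h | h
  · rw [Fin.insertNth_apply_below h, dif_pos (Fin.lt_def.1 h), eq_rec_constant]; rfl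
  · subst h; simp
  · rw [Fin.insertNth_apply_above h, dif_neg (by simpa using h.le),
      dif_neg (by rw [Fin.val_inj]; exact h.ne'), eq_rec_constant]; rfl

end PermSum

/-! ### The wedge product -/

section Wedge

variable {V W : Type*} [AddCommGroup V] [Module ℝ V] [AddCommGroup W] [Module ℝ W]

/-- The wedge product as a sum over all permutations: each shuffle occurs `p! q!` times. -/
theorem wedge_apply_eq_permSum {p q : ℕ} (α : V [⋀^Fin p]→ₗ[ℝ] ℝ) (β : V [⋀^Fin q]→ₗ[ℝ] ℝ)
    (v : Fin (p + q) → V) :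
    (p.factorial * q.factorial : ℝ) * wedge α β v =
      permSum (fun w ↦ α (fun i ↦ w (Fin.castAdd q i)) * β (fun j ↦ w (Fin.natAdd p j))) v := by
  have h := congrArg (fun f ↦ LinearMap.mul' ℝ ℝ (f (v ∘ finSumFinEquiv)))
    (MultilinearMap.domCoprod_alternization_eq α β)
  simp only [Fintype.card_fin, AlternatingMap.smul_apply, map_nsmul] at h
  rw [nsmul_eq_mul, Nat.cast_mul] at h
  have hw : wedge α β v = LinearMap.mul' ℝ ℝ (α.domCoprod β (v ∘ finSumFinEquiv)) := rfl
  rw [hw, ← h, MultilinearMap.alternatization_apply, map_sum, permSum,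
    ← Equiv.sum_comp finSumFinEquiv.permCongr]
  refine Finset.sum_congr rfl fun σ _ ↦ ?_
  rw [Equiv.Perm.sign_permCongr]
  simp only [MultilinearMap.domDomCongr_apply, MultilinearMap.domCoprod_apply, Units.smul_def,
    zsmul_eq_mul, Function.comp_def, AlternatingMap.coe_multilinearMap, Equiv.permCongr_apply,
    finSumFinEquiv_symm_apply_castAdd, finSumFinEquiv_symm_apply_natAdd]
  rw [← zsmul_eq_mul, map_zsmul, zsmul_eq_mul, LinearMap.mul'_apply]

theorem wedge_compLinearMap {p q : ℕ} (α : V [⋀^Fin p]→ₗ[ℝ] ℝ) (β : V [⋀^Fin q]→ₗ[ℝ] ℝ)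
    (f : W →ₗ[ℝ] V) :
    wedge (α.compLinearMap f) (β.compLinearMap f) = (wedge α β).compLinearMap f := by
  ext v
  have h : (p.factorial * q.factorial : ℝ) ≠ 0 := by positivity
  apply mul_left_cancel₀ h
  rw [AlternatingMap.compLinearMap_apply, wedge_apply_eq_permSum, wedge_apply_eq_permSum]
  rfl

/-- The wedge product of `α` and `β` as a function of `n = p + q` vectors. Keeping the equation
`p + q = n` as a hypothesis avoids casts in recursions on the degrees. -/
def wedgeFun {p q n : ℕ} (α : V [⋀^Fin p]→ₗ[ℝ] ℝ) (β : V [⋀^Fin q]→ₗ[ℝ] ℝ) (h : p + q = n)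
    (v : Fin n → V) : ℝ :=
  wedge α β (v ∘ Fin.cast h)

theorem wedge_eq_wedgeFun {p q : ℕ} (α : V [⋀^Fin p]→ₗ[ℝ] ℝ) (β : V [⋀^Fin q]→ₗ[ℝ] ℝ)
    (v : Fin (p + q) → V) : wedge α β v = wedgeFun α β rfl v := rfl

theorem wedgeFun_eq {p q n : ℕ} (α : V [⋀^Fin p]→ₗ[ℝ] ℝ) (β : V [⋀^Fin q]→ₗ[ℝ] ℝ) (h : p + q = n)
    (v : Fin n → V) : (p.factorial * q.factorial : ℝ) * wedgeFun α β h v =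
      permSum (fun w ↦ α (fun i ↦ w ⟨i, by omega⟩) * β (fun j ↦ w ⟨p + j, by omega⟩)) v := by
  subst h
  exact wedge_apply_eq_permSum α β v

/-- Interior multiplication is an antiderivation of the wedge product. -/
theorem wedgeFun_cons {p q n : ℕ} (α : V [⋀^Fin (p + 1)]→ₗ[ℝ] ℝ) (β : V [⋀^Fin (q + 1)]→ₗ[ℝ] ℝ)
    (h : p + 1 + (q + 1) = n + 1) (v : V) (w : Fin n → V) :
    wedgeFun α β h (Matrix.vecCons v w) =
      wedgeFun (α.curryLeft v) β (by omega : p + (q + 1) = n) w +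
        (-1) ^ (p + 1) * wedgeFun α (β.curryLeft v) (by omega : p + 1 + q = n) w := by
  obtain rfl : n = p + 1 + q := by omega
  have hne : ((p + 1).factorial * (q + 1).factorial : ℝ) ≠ 0 := by positivity
  apply mul_left_cancel₀ hne
  have h1 := wedgeFun_eq (α.curryLeft v) β (by omega : p + (q + 1) = p + 1 + q) w
  have h2 := wedgeFun_eq α (β.curryLeft v) (by omega : p + 1 + q = p + 1 + q) w
  have e : ((p + 1).factorial * (q + 1).factorial : ℝ) *
      (wedgeFun (α.curryLeft v) β (by omega : p + (q + 1) = p + 1 + q) w +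
        (-1) ^ (p + 1) * wedgeFun α (β.curryLeft v) (by omega : p + 1 + q = p + 1 + q) w) =
      (p + 1) * ((p.factorial * (q + 1).factorial : ℝ) *
        wedgeFun (α.curryLeft v) β (by omega : p + (q + 1) = p + 1 + q) w) +
      (q + 1) * ((-1) ^ (p + 1) * (((p + 1).factorial * q.factorial : ℝ) *
        wedgeFun α (β.curryLeft v) (by omega : p + 1 + q = p + 1 + q) w)) := by
    push_cast [Nat.factorial_succ]; ring
  rw [e, h1, h2, wedgeFun_eq, permSum_cons]
  refine (Fin.sum_univ_add (a := p + 1) (b := q + 1) _).trans ?_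
  congr 1
  -- the first vector is an argument of `α` or of `β`; each block has equal contributions
  · have (i : Fin (p + 1)) : (-1 : ℝ) ^ ((Fin.castAdd (q + 1) i : Fin (p + 1 + (q + 1))) : ℕ) *
        permSum (fun u : Fin (p + 1 + q) → V ↦
          α (fun j : Fin (p + 1) ↦ Fin.insertNth (n := p + 1 + q) (α := fun _ ↦ V) ⟨i, by omega⟩ v u
            ⟨j, by omega⟩) *
          β (fun j : Fin (q + 1) ↦ Fin.insertNth (n := p + 1 + q) (α := fun _ ↦ V) ⟨i, by omega⟩ v u
            ⟨p + 1 + j, by omega⟩)) w =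
        permSum (fun w ↦ α.curryLeft v (fun i ↦ w ⟨i, by omega⟩) *
          β (fun j ↦ w ⟨p + j, by omega⟩)) w := by
      rw [← permSum_const_mul]
      congr 1
      funext u
      have ea : (fun j : Fin (p + 1) ↦
          Fin.insertNth (n := p + 1 + q) (α := fun _ ↦ V) ⟨i, by omega⟩ v u
            ⟨j, by omega⟩) = Fin.insertNth (α := fun _ ↦ V) i v fun j ↦ u ⟨j.val, by omega⟩ := by
        funext j
        simp only [insertNth_apply_eq_dite]
      have eb : (fun j : Fin (q + 1) ↦
          Fin.insertNth (n := p + 1 + q) (α := fun _ ↦ V) ⟨i, by omega⟩ v u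
            ⟨p + 1 + j, by omega⟩) = fun j ↦ u ⟨p + j.val, by omega⟩ := by
        funext j
        simp only [insertNth_apply_eq_dite]
        rw [dif_neg (by omega), dif_neg (by omega)]
        congr 2; omega
      rw [ea, eb, AlternatingMap.map_insertNth, AlternatingMap.curryLeft_apply_apply]
      simp only [Fin.val_castAdd, zsmul_eq_mul, Int.cast_pow, Int.cast_neg, Int.cast_one]
      rw [← mul_assoc, ← mul_assoc, ← mul_pow]; simp
    refine (Finset.sum_congr rfl fun i _ ↦ this i).trans ?_
    simp
  · have (i : Fin (q + 1)) : (-1 : ℝ) ^ ((Fin.natAdd (p + 1) i : Fin (p + 1 + (q + 1))) : ℕ) *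
        permSum (fun u : Fin (p + 1 + q) → V ↦
          α (fun j : Fin (p + 1) ↦
            Fin.insertNth (n := p + 1 + q) (α := fun _ ↦ V) ⟨p + 1 + i, by omega⟩ v u
            ⟨j, by omega⟩) *
          β (fun j : Fin (q + 1) ↦
            Fin.insertNth (n := p + 1 + q) (α := fun _ ↦ V) ⟨p + 1 + i, by omega⟩ v u
            ⟨p + 1 + j, by omega⟩)) w =
        (-1) ^ (p + 1) * permSum (fun w ↦ α (fun i ↦ w ⟨i, by omega⟩) *
          β.curryLeft v (fun j ↦ w ⟨p + 1 + j, by omega⟩)) w := by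
      rw [← permSum_const_mul, ← permSum_const_mul]
      congr 1
      funext u
      have ea : (fun j : Fin (p + 1) ↦
          Fin.insertNth (n := p + 1 + q) (α := fun _ ↦ V) ⟨p + 1 + i, by omega⟩ v u
            ⟨j, by omega⟩) = fun j ↦ u ⟨j.val, by omega⟩ := by
        funext j
        simp only [insertNth_apply_eq_dite]
        rw [dif_pos (by omega)]
      have eb : (fun j : Fin (q + 1) ↦
          Fin.insertNth (n := p + 1 + q) (α := fun _ ↦ V) ⟨p + 1 + i, by omega⟩ v u
            ⟨p + 1 + j, by omega⟩) =
          Fin.insertNth (α := fun _ ↦ V) i v fun j ↦ u ⟨p + 1 + j, by omega⟩ := by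
        funext j
        simp only [insertNth_apply_eq_dite, add_lt_add_iff_left, add_right_inj]
        split_ifs <;> first | rfl | (congr 2; omega)
      rw [ea, eb, AlternatingMap.map_insertNth, AlternatingMap.curryLeft_apply_apply]
      simp only [Fin.val_natAdd, zsmul_eq_mul, Int.cast_pow, Int.cast_neg, Int.cast_one]
      have hs : (-1 : ℝ) ^ (i : ℕ) * (-1) ^ (i : ℕ) = 1 := by rw [← mul_pow]; simp
      rw [pow_add]
      linear_combination ((-1 : ℝ) ^ (p + 1) * α (fun j ↦ u ⟨j.val, by omega⟩) *
        β (Matrix.vecCons v fun j ↦ u ⟨p + 1 + j, by omega⟩)) * hs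
    refine (Finset.sum_congr rfl fun i _ ↦ this i).trans ?_
    simp

/-- Wedge with a `0`-form; with `wedgeFun_cons` it expands a wedge product completely. -/
theorem wedgeFun_zero_left {q n : ℕ} (α : V [⋀^Fin 0]→ₗ[ℝ] ℝ) (β : V [⋀^Fin q]→ₗ[ℝ] ℝ)
    (h : 0 + q = n) (v : Fin n → V) :
    wedgeFun α β h v = α ![] * β (v ∘ Fin.cast (by omega)) := by
  obtain rfl : n = q := by omega
  have hne : ((0).factorial * n.factorial : ℝ) ≠ 0 := by positivity
  apply mul_left_cancel₀ hne
  rw [wedgeFun_eq, permSum]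
  have (σ : Equiv.Perm (Fin n)) : (Equiv.Perm.sign σ : ℝ) *
      (α (fun i : Fin 0 ↦ (v ∘ σ) ⟨i, by omega⟩) * β (fun j ↦ (v ∘ σ) ⟨0 + j, by omega⟩)) =
        α ![] * β (v ∘ Fin.cast (by omega)) := by
    have h1 : (fun i : Fin 0 ↦ (v ∘ σ) ⟨i, by omega⟩) = ![] := Subsingleton.elim _ _
    have h2 : (fun j : Fin n ↦ (v ∘ σ) ⟨0 + j, by omega⟩) = v ∘ σ := by
      funext j; congr 1; ext; simp
    rw [h1, h2, AlternatingMap.map_perm, Units.smul_def, zsmul_eq_mul]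
    have hs : (Equiv.Perm.sign σ : ℝ) * (Equiv.Perm.sign σ : ℝ) = 1 := by
      rw [← Int.cast_mul, ← Units.val_mul]; simp
    have h3 : v ∘ Fin.cast (by omega : n = n) = v := rfl
    rw [h3]
    linear_combination (α ![] * β v) * hs
  simp only [this]
  simp [Fintype.card_perm]

theorem wedgeFun_zero_right {p n : ℕ} (α : V [⋀^Fin p]→ₗ[ℝ] ℝ) (β : V [⋀^Fin 0]→ₗ[ℝ] ℝ)
    (h : p + 0 = n) (v : Fin n → V) :
    wedgeFun α β h v = α (v ∘ Fin.cast (by omega)) * β ![] := by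
  obtain rfl : n = p := by omega
  have hne : (n.factorial * (0).factorial : ℝ) ≠ 0 := by positivity
  apply mul_left_cancel₀ hne
  rw [wedgeFun_eq, permSum]
  have (σ : Equiv.Perm (Fin n)) : (Equiv.Perm.sign σ : ℝ) *
      (α (fun i ↦ (v ∘ σ) ⟨i, by omega⟩) * β (fun j : Fin 0 ↦ (v ∘ σ) ⟨n + j, by omega⟩)) =
        α (v ∘ Fin.cast (by omega)) * β ![] := by
    have h1 : (fun i : Fin 0 ↦ (v ∘ σ) ⟨n + i, by omega⟩) = ![] := Subsingleton.elim _ _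
    have h2 : (fun j : Fin n ↦ (v ∘ σ) ⟨j, by omega⟩) = v ∘ σ := rfl
    rw [h1, h2, AlternatingMap.map_perm, Units.smul_def, zsmul_eq_mul]
    have hs : (Equiv.Perm.sign σ : ℝ) * (Equiv.Perm.sign σ : ℝ) = 1 := by
      rw [← Int.cast_mul, ← Units.val_mul]; simp
    have h3 : v ∘ Fin.cast (by omega : n = n) = v := rfl
    rw [h3]
    linear_combination (α v * β ![]) * hs
  simp only [this]
  simp [Fintype.card_perm]

theorem wedge_one_two (α : V [⋀^Fin 1]→ₗ[ℝ] ℝ) (β : V [⋀^Fin 2]→ₗ[ℝ] ℝ) (a b c : V) :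
    wedge α β ![a, b, c] = α ![a] * β ![b, c] - α ![b] * β ![a, c] + α ![c] * β ![a, b] := by
  refine (wedge_eq_wedgeFun α β ![a, b, c]).trans ?_
  simp [wedgeFun_cons, wedgeFun_zero_left, wedgeFun_zero_right]
  ring

end Wedge

/-! ### The model form on `ℝ × ℂ³` -/

section Model

/-- The projection `ℝ⁷ = ℝ × ℂ³ → ℂ³`. -/
def toC3 : (Fin 7 → ℝ) →ₗ[ℝ] (Fin 3 → ℂ) where
  toFun x := ![⟨x 1, x 2⟩, ⟨x 3, x 4⟩, ⟨x 5, x 6⟩]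
  map_add' x y := by ext k; fin_cases k <;> simp [Complex.ext_iff]
  map_smul' c x := by ext k; fin_cases k <;> simp [Complex.ext_iff]

/-- The standard Kähler form `∑ dxₖ ∧ dyₖ` of `ℂ³`. -/
def stdOmega : (Fin 3 → ℂ) [⋀^Fin 2]→ₗ[ℝ] ℝ :=
  ∑ k, (Matrix.detRowAlternating (n := Fin 2) (R := ℝ)).compLinearMap
    (LinearMap.pi ![Complex.reLm ∘ₗ LinearMap.proj k, Complex.imLm ∘ₗ LinearMap.proj k])

/-- The standard complex volume form `dz₁ ∧ dz₂ ∧ dz₃` of `ℂ³`. -/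
def stdVol : (Fin 3 → ℂ) [⋀^Fin 3]→ₗ[ℝ] ℂ :=
  { (Matrix.detRowAlternating (n := Fin 3) (R := ℂ)).toMultilinearMap.restrictScalars ℝ with
    map_eq_zero_of_eq' := fun v _ _ h hij ↦
      (Matrix.detRowAlternating (n := Fin 3) (R := ℂ)).map_eq_zero_of_eq v h hij }

theorem elem3_apply (i j k : Fin 7) (a b c : Fin 7 → ℝ) :
    elem3 i j k ![a, b, c] = a i * b j * c k - a i * c j * b k - b i * a j * c k +
      b i * c j * a k + c i * a j * b k - c i * b j * a k := by
  have : elem3 i j k ![a, b, c] =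
      Matrix.det (Matrix.of ![![a i, a j, a k], ![b i, b j, b k], ![c i, c j, c k]]) := by
    change Matrix.det (n := Fin 3) (R := ℝ) _ = _
    congr 1
    ext m n
    fin_cases m <;> fin_cases n <;> rfl
  rw [this, Matrix.det_fin_three]
  simp
  ring

theorem stdOmega_apply (z w : Fin 3 → ℂ) :
    stdOmega ![z, w] = ∑ k, ((z k).re * (w k).im - (z k).im * (w k).re) := by
  have h (k : Fin 3) : (Matrix.detRowAlternating (n := Fin 2) (R := ℝ)).compLinearMap
      (LinearMap.pi ![Complex.reLm ∘ₗ LinearMap.proj k, Complex.imLm ∘ₗ LinearMap.proj k])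
      ![z, w] = (z k).re * (w k).im - (z k).im * (w k).re :=
    (Matrix.det_fin_two _).trans (by simp)
  simp only [stdOmega, Fin.sum_univ_three, AlternatingMap.add_apply, h]

theorem stdVol_apply (u : Fin 3 → Fin 3 → ℂ) : stdVol u = Matrix.det (Matrix.of u) := rfl

theorem modelG2_apply (a b c : Fin 7 → ℝ) :
    modelG2 ![a, b, c] = a 0 * stdOmega ![toC3 b, toC3 c] - b 0 * stdOmega ![toC3 a, toC3 c] +
      c 0 * stdOmega ![toC3 a, toC3 b] + (stdVol ![toC3 a, toC3 b, toC3 c]).re := by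
  simp [modelG2, elem3_apply, Matrix.det_fin_three, stdOmega_apply, stdVol_apply, toC3,
    Fin.sum_univ_three]
  ring

/-- The model form is `e⁰ ∧ ω₀ + Re Ω₀` on `ℝ × ℂ³`. -/
theorem modelG2_eq : modelG2 = wedge (AlternatingMap.ofSubsingleton ℝ (Fin 7 → ℝ) ℝ (0 : Fin 1)
      (LinearMap.proj 0)) (stdOmega.compLinearMap toC3) +
    (rePart stdVol).compLinearMap toC3 := by
  ext v
  obtain ⟨a, b, c, rfl⟩ : ∃ a b c, v = ![a, b, c] :=
    ⟨v 0, v 1, v 2, by ext i; fin_cases i <;> rfl⟩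
  have h2 (x y : Fin 7 → ℝ) : (⇑toC3 ∘ ![x, y]) = ![toC3 x, toC3 y] := by
    ext i; fin_cases i <;> rfl
  have h3 : (⇑toC3 ∘ ![a, b, c]) = ![toC3 a, toC3 b, toC3 c] := by
    ext i; fin_cases i <;> rfl
  rw [modelG2_apply, AlternatingMap.add_apply, wedge_one_two]
  simp [AlternatingMap.compLinearMap_apply, rePart]
  rw [← h3, ← h2, ← h2, ← h2]; rfl

theorem wedge_two_two {V : Type*} [AddCommGroup V] [Module ℝ V] (α β : V [⋀^Fin 2]→ₗ[ℝ] ℝ)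
    (a b c d : V) :
    wedge α β ![a, b, c, d] = α ![a, b] * β ![c, d] - α ![a, c] * β ![b, d] +
      α ![a, d] * β ![b, c] + α ![b, c] * β ![a, d] - α ![b, d] * β ![a, c] +
      α ![c, d] * β ![a, b] := by
  refine (wedge_eq_wedgeFun α β ![a, b, c, d]).trans ?_
  simp [wedgeFun_cons, wedgeFun_zero_left, wedgeFun_zero_right]
  ring

theorem modelG2_eq_elem3_sum (a b c : Fin 7 → ℝ) : modelG2 ![a, b, c] =
    elem3 0 1 2 ![a, b, c] + elem3 0 3 4 ![a, b, c] + elem3 0 5 6 ![a, b, c] +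
    elem3 1 3 5 ![a, b, c] - elem3 1 4 6 ![a, b, c] - elem3 2 3 6 ![a, b, c] -
    elem3 2 4 5 ![a, b, c] := rfl

/-- The shuffles of a wedge product of degrees `4` and `3`. -/
theorem wedgeFun_four_three {V : Type*} [AddCommGroup V] [Module ℝ V] (α : V [⋀^Fin 4]→ₗ[ℝ] ℝ)
    (β : V [⋀^Fin 3]→ₗ[ℝ] ℝ) (a b c d e f g : V) :
    wedgeFun α β (rfl : 4 + 3 = 7) ![a, b, c, d, e, f, g] =
      α ![a, b, c, d] * β ![e, f, g] - α ![a, b, c, e] * β ![d, f, g] +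
      α ![a, b, c, f] * β ![d, e, g] - α ![a, b, c, g] * β ![d, e, f] +
      α ![a, b, d, e] * β ![c, f, g] - α ![a, b, d, f] * β ![c, e, g] +
      α ![a, b, d, g] * β ![c, e, f] + α ![a, b, e, f] * β ![c, d, g] -
      α ![a, b, e, g] * β ![c, d, f] + α ![a, b, f, g] * β ![c, d, e] -
      α ![a, c, d, e] * β ![b, f, g] + α ![a, c, d, f] * β ![b, e, g] -
      α ![a, c, d, g] * β ![b, e, f] - α ![a, c, e, f] * β ![b, d, g] +
      α ![a, c, e, g] * β ![b, d, f] - α ![a, c, f, g] * β ![b, d, e] +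
      α ![a, d, e, f] * β ![b, c, g] - α ![a, d, e, g] * β ![b, c, f] +
      α ![a, d, f, g] * β ![b, c, e] - α ![a, e, f, g] * β ![b, c, d] +
      α ![b, c, d, e] * β ![a, f, g] - α ![b, c, d, f] * β ![a, e, g] +
      α ![b, c, d, g] * β ![a, e, f] + α ![b, c, e, f] * β ![a, d, g] -
      α ![b, c, e, g] * β ![a, d, f] + α ![b, c, f, g] * β ![a, d, e] -
      α ![b, d, e, f] * β ![a, c, g] + α ![b, d, e, g] * β ![a, c, f] -
      α ![b, d, f, g] * β ![a, c, e] + α ![b, e, f, g] * β ![a, c, d] +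
      α ![c, d, e, f] * β ![a, b, g] - α ![c, d, e, g] * β ![a, b, f] +
      α ![c, d, f, g] * β ![a, b, e] - α ![c, e, f, g] * β ![a, b, d] +
      α ![d, e, f, g] * β ![a, b, c] := by
  simp only [wedgeFun_cons, wedgeFun_zero_left, wedgeFun_zero_right]
  simp
  ring

theorem basisFun_seven : ⇑(Pi.basisFun ℝ (Fin 7)) = ![Pi.single 0 1, Pi.single 1 1, Pi.single 2 1,
      Pi.single 3 1, Pi.single 4 1, Pi.single 5 1, Pi.single 6 1] := by
  ext i j; fin_cases i <;> simp

theorem wedge_wedge_eq_wedgeFun {V : Type*} [AddCommGroup V] [Module ℝ V]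
    (α α' : V [⋀^Fin 2]→ₗ[ℝ] ℝ) (β : V [⋀^Fin 3]→ₗ[ℝ] ℝ) (v : Fin 7 → V) :
    wedge (wedge α α') β v = wedgeFun (p := 4) (wedge α α') β (rfl : 4 + 3 = 7) v := by
  exact wedge_eq_wedgeFun (wedge α α') β v

theorem bilinB_eq_wedgeFun {V : Type*} [AddCommGroup V] [Module ℝ V] (φ : V [⋀^Fin 3]→ₗ[ℝ] ℝ)
    (e : Module.Basis (Fin 7) ℝ V) (v w : V) :
    bilinB φ e v w = (1 / 6 : ℝ) * wedgeFun (p := 4) (wedge (φ.curryLeft v) (φ.curryLeft w)) φ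
      (rfl : 4 + 3 = 7) e := by
  rw [bilinB, LinearMap.mk₂_apply, wedge_wedge_eq_wedgeFun]

/-- The metric of the model form is the dot product, and its volume form is the standard one. -/
theorem bilinB_modelG2 (v w : Fin 7 → ℝ) :
    bilinB modelG2 (Pi.basisFun ℝ (Fin 7)) v w = v ⬝ᵥ w := by
  rw [bilinB_eq_wedgeFun, basisFun_seven, wedgeFun_four_three]
  simp only [modelG2_eq_elem3_sum, wedge_two_two, elem3_apply, AlternatingMap.curryLeft_apply_apply]
  simp [dotProduct, Fin.sum_univ_succ]
  ring

end Model

/-! ### The metric and the volume form of a positive form -/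

section Metric

variable {V : Type*} [AddCommGroup V] [Module ℝ V]

/-- The determinant of the basis `e` in the coordinates `u`. -/
abbrev frameDet (u : V ≃ₗ[ℝ] (Fin 7 → ℝ)) (e : Module.Basis (Fin 7) ℝ V) : ℝ :=
  (Pi.basisFun ℝ (Fin 7)).det (⇑u.toLinearMap ∘ ⇑e)

theorem frameDet_eq (u : V ≃ₗ[ℝ] (Fin 7 → ℝ)) (e : Module.Basis (Fin 7) ℝ V) :
    frameDet u e = (Matrix.of (⇑u.toLinearMap ∘ ⇑e)).det :=
  Pi.basisFun_det_apply _

theorem frameDet_ne_zero (u : V ≃ₗ[ℝ] (Fin 7 → ℝ)) (e : Module.Basis (Fin 7) ℝ V) :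
    frameDet u e ≠ 0 := by
  have h := (Pi.basisFun ℝ (Fin 7)).isUnit_det (e.map u)
  rw [Module.Basis.coe_map] at h
  exact h.ne_zero

/-- In an adapted frame the bilinear form of a positive form is the dot product; the `7`-form in
which it takes values contributes the determinant of the frame. -/
theorem bilinB_model_comp (u : V ≃ₗ[ℝ] (Fin 7 → ℝ)) (e : Module.Basis (Fin 7) ℝ V) (v w : V) :
    bilinB (modelG2.compLinearMap u.toLinearMap) e v w = frameDet u e * (u v ⬝ᵥ u w) := by
  rw [← bilinB_modelG2 (u v) (u w)]
  simp only [bilinB, LinearMap.mk₂_apply]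
  rw [AlternatingMap.curryLeft_compLinearMap, AlternatingMap.curryLeft_compLinearMap,
    wedge_compLinearMap, wedge_compLinearMap, AlternatingMap.compLinearMap_apply]
  generalize hΨ : wedge (wedge (modelG2.curryLeft (u.toLinearMap v))
    (modelG2.curryLeft (u.toLinearMap w))) modelG2 = Ψ
  have h' : Ψ (⇑u.toLinearMap ∘ ⇑e) = Ψ (Pi.basisFun ℝ (Fin 7)) * frameDet u e :=
    congrArg (fun f ↦ f (⇑u.toLinearMap ∘ ⇑e))
      (AlternatingMap.eq_smul_basis_det (Pi.basisFun ℝ (Fin 7)) Ψ)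
  refine (congrArg ((1 / 6 : ℝ) * ·) h').trans ?_
  simp only [← hΨ]
  rw [mul_comm (frameDet u e), mul_assoc]

/-- The exponent is `9 = 7 + 2`: the factor `frameDet u e` occurs in all seven rows, and the Gram
determinant contributes its square. -/
theorem det_bilinB_model_comp (u : V ≃ₗ[ℝ] (Fin 7 → ℝ)) (e : Module.Basis (Fin 7) ℝ V) :
    (Matrix.of fun i j ↦ bilinB (modelG2.compLinearMap u.toLinearMap) e (e i) (e j)).det =
      frameDet u e ^ 9 := by
  have : (Matrix.of fun i j ↦ bilinB (modelG2.compLinearMap u.toLinearMap) e (e i) (e j)) =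
      frameDet u e • (Matrix.of (⇑u.toLinearMap ∘ ⇑e) *
        (Matrix.of (⇑u.toLinearMap ∘ ⇑e)).transpose) := by
    ext i j
    simp only [Matrix.of_apply, bilinB_model_comp, Matrix.smul_apply, smul_eq_mul]
    rfl
  rw [this, Matrix.det_smul, Matrix.det_mul, Matrix.det_transpose, Fintype.card_fin, ← frameDet_eq]
  ring

theorem volCoeff_model_comp (u : V ≃ₗ[ℝ] (Fin 7 → ℝ)) (e : Module.Basis (Fin 7) ℝ V) :
    volCoeff (modelG2.compLinearMap u.toLinearMap) e = frameDet u e := by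
  simp only [volCoeff, det_bilinB_model_comp]
  set D := frameDet u e
  have h1 : |D ^ 9| ^ (1 / 9 : ℝ) = |D| := by
    rw [abs_pow, ← Real.rpow_natCast, ← Real.rpow_mul (abs_nonneg D)]; norm_num
  have h2 : SignType.sign (D ^ 9) = SignType.sign D := by
    rcases lt_trichotomy D 0 with h | h | h
    · rw [sign_neg h, sign_neg (Odd.pow_neg (by decide) h)]
    · simp [h]
    · rw [sign_pos h, sign_pos (by positivity)]
  rw [h1, h2, sign_mul_abs]

/-- The metric of a positive form is the dot product in an adapted frame. -/
theorem metric_model_comp (u : V ≃ₗ[ℝ] (Fin 7 → ℝ)) (e : Module.Basis (Fin 7) ℝ V) (v w : V) :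
    metric (modelG2.compLinearMap u.toLinearMap) e v w = u v ⬝ᵥ u w := by
  simp only [metric, LinearMap.smul_apply, volCoeff_model_comp, bilinB_model_comp, smul_eq_mul]
  rw [inv_mul_cancel_left₀ (frameDet_ne_zero u e)]

theorem volForm_model_comp (u : V ≃ₗ[ℝ] (Fin 7 → ℝ)) (e : Module.Basis (Fin 7) ℝ V) :
    volForm (modelG2.compLinearMap u.toLinearMap) e =
      (Pi.basisFun ℝ (Fin 7)).det.compLinearMap u.toLinearMap := by
  rw [volForm, volCoeff_model_comp]
  have h := AlternatingMap.eq_smul_basis_det e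
    ((Pi.basisFun ℝ (Fin 7)).det.compLinearMap u.toLinearMap)
  rw [AlternatingMap.compLinearMap_apply] at h
  exact h.symm

end Metric

/-! ### The Hodge star of a positive form -/

section Contraction

variable {V : Type*} [AddCommGroup V] [Module ℝ V]

/-- Contracting a bilinear map with an inner product does not depend on the basis used. -/
theorem sum_inv_gram_eq {F : Type*} [AddCommGroup F] [Module ℝ F] (u : V ≃ₗ[ℝ] (Fin 7 → ℝ))
    (e : Module.Basis (Fin 7) ℝ V) (B : V →ₗ[ℝ] V →ₗ[ℝ] F) :
    ∑ i, ∑ a, ((Matrix.of fun i j ↦ u (e i) ⬝ᵥ u (e j))⁻¹ i a) • B (e a) (e i) =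
      ∑ i, B (u.symm (Pi.single i 1)) (u.symm (Pi.single i 1)) := by
  set P := Matrix.of (⇑u.toLinearMap ∘ ⇑e) with hP
  have hdet : IsUnit P.det := by
    rw [hP, ← frameDet_eq]; exact (frameDet_ne_zero u e).isUnit
  have hG : (Matrix.of fun i j ↦ u (e i) ⬝ᵥ u (e j)) = P * P.transpose := rfl
  have he (i : Fin 7) : e i = ∑ k, P i k • u.symm (Pi.single k 1) := by
    apply u.injective
    ext j
    simp [hP, Finset.sum_apply, Pi.single_apply]
  have key (k l : Fin 7) : ∑ i, ∑ a, (P * P.transpose)⁻¹ i a * (P a k * P i l) =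
      if k = l then 1 else 0 := by
    have : P.transpose * (P * P.transpose)⁻¹ * P = 1 := by
      rw [Matrix.mul_inv_rev, ← Matrix.mul_assoc, Matrix.mul_nonsing_inv _ (by simpa using hdet),
        Matrix.one_mul, Matrix.nonsing_inv_mul _ hdet]
    have h2 := congrFun (congrFun this l) k
    rw [Matrix.one_apply] at h2
    simp only [eq_comm (a := k)]
    rw [← h2, Matrix.mul_apply]
    simp only [Matrix.mul_apply, Matrix.transpose_apply, Finset.sum_mul]
    rw [Finset.sum_comm]
    refine Finset.sum_congr rfl fun a _ ↦ Finset.sum_congr rfl fun i _ ↦ by ring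
  rw [hG]
  calc _ = ∑ k, ∑ l, (∑ i, ∑ a, (P * P.transpose)⁻¹ i a * (P a k * P i l)) •
        B (u.symm (Pi.single k 1)) (u.symm (Pi.single l 1)) := by
        have (i a : Fin 7) : ((P * P.transpose)⁻¹ i a) • B (e a) (e i) =
            ∑ k, ∑ l, ((P * P.transpose)⁻¹ i a * (P a k * P i l)) •
              B (u.symm (Pi.single k 1)) (u.symm (Pi.single l 1)) := by
          rw [he a, he i]
          simp only [map_sum, map_smul, LinearMap.sum_apply, LinearMap.smul_apply,
            Finset.smul_sum, smul_smul]
          rw [Finset.sum_comm]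
          simp only [mul_comm (P i _)]
        simp only [this, Finset.sum_smul]
        rw [Finset.sum_congr rfl fun i _ ↦ Finset.sum_comm]
        rw [Finset.sum_comm]
        refine Finset.sum_congr rfl fun k _ ↦ ?_
        rw [Finset.sum_congr rfl fun i _ ↦ Finset.sum_comm]
        rw [Finset.sum_comm]
    _ = _ := by
        simp [key, ite_smul]

end Contraction

section HodgeStar

theorem AlternatingMap.sum_apply' {ι κ V F : Type*} [AddCommGroup V] [Module ℝ V] [AddCommGroup F]
    [Module ℝ F] (s : Finset κ) (f : κ → V [⋀^ι]→ₗ[ℝ] F) (v : ι → V) :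
    (∑ k ∈ s, f k) v = ∑ k ∈ s, f k v :=
  map_sum ({ toFun := fun g ↦ g v, map_zero' := rfl, map_add' := fun _ _ ↦ rfl } :
    (V [⋀^ι]→ₗ[ℝ] F) →+ F) f s

variable {V : Type*} [AddCommGroup V] [Module ℝ V]

/-- Contraction with the inverse Gram matrix of `e` is contraction over the orthonormal frame `u⁻¹`.
-/
theorem sum_inv_gram_smul_eq {F : Type*} [AddCommGroup F] [Module ℝ F] (u : V ≃ₗ[ℝ] (Fin 7 → ℝ))
    (e : Module.Basis (Fin 7) ℝ V) (L : V →ₗ[ℝ] ℝ) (N : V →ₗ[ℝ] F) :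
    ∑ i, ∑ a, ((Matrix.of fun i j ↦ u (e i) ⬝ᵥ u (e j))⁻¹ i a) • (L (e a) • N (e i)) =
      ∑ i, L (u.symm (Pi.single i 1)) • N (u.symm (Pi.single i 1)) :=
  sum_inv_gram_eq u e (LinearMap.mk₂ ℝ (fun x y ↦ L x • N y)
    (fun x x' y ↦ by rw [map_add, add_smul]) (fun c x y ↦ by rw [map_smul, smul_assoc])
    (fun x y y' ↦ by rw [map_add, smul_add]) (fun c x y ↦ by rw [map_smul, smul_comm]))

/-- If `G` contracts products of linear maps in the family `e` to those in the family `f`, then the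
threefold contraction of a `3`-form with a `7`-form may be computed in the family `f`. -/
theorem sum_contract_three (G : Fin 7 → Fin 7 → ℝ) (e f : Fin 7 → V)
    (S : ∀ (L : V →ₗ[ℝ] ℝ) (N : V →ₗ[ℝ] (V [⋀^Fin 4]→ₗ[ℝ] ℝ)),
      ∑ i, ∑ a, G i a • (L (e a) • N (e i)) = ∑ i, L (f i) • N (f i))
    (β : V [⋀^Fin 3]→ₗ[ℝ] ℝ) (vol : V [⋀^Fin 7]→ₗ[ℝ] ℝ) :
    ∑ i, ∑ j, ∑ k, ∑ a, ∑ b, ∑ c, (G i a * G j b * G k c * β ![e a, e b, e c]) •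
      ((vol.curryLeft (e i)).curryLeft (e j)).curryLeft (e k) =
    ∑ i, ∑ j, ∑ k, β ![f i, f j, f k] •
      ((vol.curryLeft (f i)).curryLeft (f j)).curryLeft (f k) := by
  have L1 (y z : V) : ∃ L : V →ₗ[ℝ] ℝ, ∀ x, L x = β ![x, y, z] :=
    ⟨{ toFun := fun x ↦ β ![x, y, z]
       map_add' := fun x x' ↦ congrArg (fun γ ↦ γ ![y, z]) (β.curryLeft.map_add x x')
       map_smul' := fun c x ↦ congrArg (fun γ ↦ γ ![y, z]) (β.curryLeft.map_smul c x) },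
      fun _ ↦ rfl⟩
  have L2 (x z : V) : ∃ L : V →ₗ[ℝ] ℝ, ∀ y, L y = β ![x, y, z] :=
    ⟨{ toFun := fun y ↦ β ![x, y, z]
       map_add' := fun y y' ↦ congrArg (fun γ ↦ γ ![z]) ((β.curryLeft x).curryLeft.map_add y y')
       map_smul' := fun c y ↦ congrArg (fun γ ↦ γ ![z])
         ((β.curryLeft x).curryLeft.map_smul c y) }, fun _ ↦ rfl⟩
  have L3 (x y : V) : ∃ L : V →ₗ[ℝ] ℝ, ∀ z, L z = β ![x, y, z] :=
    ⟨{ toFun := fun z ↦ β ![x, y, z]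
       map_add' := fun z z' ↦ congrArg (fun γ ↦ γ ![])
         (((β.curryLeft x).curryLeft y).curryLeft.map_add z z')
       map_smul' := fun c z ↦ congrArg (fun γ ↦ γ ![])
         (((β.curryLeft x).curryLeft y).curryLeft.map_smul c z) }, fun _ ↦ rfl⟩
  have N1 (y z : V) : ∃ N : V →ₗ[ℝ] (V [⋀^Fin 4]→ₗ[ℝ] ℝ),
      ∀ x, N x = ((vol.curryLeft x).curryLeft y).curryLeft z :=
    ⟨{ toFun := fun x ↦ ((vol.curryLeft x).curryLeft y).curryLeft z
       map_add' := fun x x' ↦ by simp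
       map_smul' := fun c x ↦ by simp }, fun _ ↦ rfl⟩
  have N2 (x z : V) : ∃ N : V →ₗ[ℝ] (V [⋀^Fin 4]→ₗ[ℝ] ℝ),
      ∀ y, N y = ((vol.curryLeft x).curryLeft y).curryLeft z :=
    ⟨{ toFun := fun y ↦ ((vol.curryLeft x).curryLeft y).curryLeft z
       map_add' := fun x x' ↦ by simp
       map_smul' := fun c x ↦ by simp }, fun _ ↦ rfl⟩
  choose L1 hL1 using L1
  choose L2 hL2 using L2
  choose L3 hL3 using L3
  choose N1 hN1 using N1
  choose N2 hN2 using N2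
  -- the contraction over `(k, c)`, then over `(j, b)`, then over `(i, a)`
  have s3 (x y x' y' : V) : ∑ k, ∑ c, G k c •
      (β ![x, y, e c] • ((vol.curryLeft x').curryLeft y').curryLeft (e k)) =
      ∑ k, β ![x, y, f k] • ((vol.curryLeft x').curryLeft y').curryLeft (f k) := by
    simpa only [hL3] using S (L3 x y) ((vol.curryLeft x').curryLeft y').curryLeft
  have s2 (x z x' z' : V) : ∑ j, ∑ b, G j b •
      (β ![x, e b, z] • ((vol.curryLeft x').curryLeft (e j)).curryLeft z') =
      ∑ j, β ![x, f j, z] • ((vol.curryLeft x').curryLeft (f j)).curryLeft z' := by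
    simpa only [hL2, hN2] using S (L2 x z) (N2 x' z')
  have s1 (y z y' z' : V) : ∑ i, ∑ a, G i a •
      (β ![e a, y, z] • ((vol.curryLeft (e i)).curryLeft y').curryLeft z') =
      ∑ i, β ![f i, y, z] • ((vol.curryLeft (f i)).curryLeft y').curryLeft z' := by
    simpa only [hL1, hN1] using S (L1 y z) (N1 y' z')
  calc _ = ∑ i, ∑ a, ∑ j, ∑ b, G i a • G j b • ∑ k, ∑ c, G k c • (β ![e a, e b, e c] •
          ((vol.curryLeft (e i)).curryLeft (e j)).curryLeft (e k)) := by
        refine Finset.sum_congr rfl fun i _ ↦ ?_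
        rw [Finset.sum_congr rfl fun j _ ↦ Finset.sum_comm, Finset.sum_comm]
        refine Finset.sum_congr rfl fun a _ ↦ Finset.sum_congr rfl fun j _ ↦ ?_
        rw [Finset.sum_comm]
        simp only [Finset.smul_sum, smul_smul, mul_assoc]
    _ = ∑ i, ∑ a, G i a • ∑ k, ∑ j, ∑ b, G j b • (β ![e a, e b, f k] •
          ((vol.curryLeft (e i)).curryLeft (e j)).curryLeft (f k)) := by
        simp only [s3]
        refine Finset.sum_congr rfl fun i _ ↦ Finset.sum_congr rfl fun a _ ↦ ?_
        simp only [← Finset.smul_sum]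
        congr 1
        simp only [Finset.smul_sum]
        rw [Finset.sum_comm]
        rw [Finset.sum_congr rfl fun b _ ↦ Finset.sum_comm, Finset.sum_comm]
        exact Finset.sum_congr rfl fun k _ ↦ Finset.sum_comm
    _ = ∑ j, ∑ k, ∑ i, ∑ a, G i a • (β ![e a, f j, f k] •
          ((vol.curryLeft (e i)).curryLeft (f j)).curryLeft (f k)) := by
        simp only [s2, Finset.smul_sum]
        rw [Finset.sum_congr rfl fun i _ ↦ Finset.sum_comm, Finset.sum_comm]
        rw [Finset.sum_congr rfl fun k _ ↦ Finset.sum_congr rfl fun i _ ↦ Finset.sum_comm]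
        rw [Finset.sum_congr rfl fun k _ ↦ Finset.sum_comm, Finset.sum_comm]
    _ = _ := by
        simp only [s1]
        rw [Finset.sum_congr rfl fun j _ ↦ Finset.sum_comm, Finset.sum_comm]

/-- The Hodge star of a positive form, written in an adapted orthonormal basis. -/
theorem hodgeStar_model_comp (u : V ≃ₗ[ℝ] (Fin 7 → ℝ)) (e : Module.Basis (Fin 7) ℝ V)
    (β : V [⋀^Fin 3]→ₗ[ℝ] ℝ) :
    hodgeStar (modelG2.compLinearMap u.toLinearMap) e β =
      (1 / 6 : ℝ) • ∑ i, ∑ j, ∑ k,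
        β ![u.symm (Pi.single i 1), u.symm (Pi.single j 1), u.symm (Pi.single k 1)] •
        (((((Pi.basisFun ℝ (Fin 7)).det.compLinearMap u.toLinearMap).curryLeft
          (u.symm (Pi.single i 1))).curryLeft
          (u.symm (Pi.single j 1))).curryLeft (u.symm (Pi.single k 1))) := by
  simp only [hodgeStar, metric_model_comp, volForm_model_comp]
  exact congrArg _ (sum_contract_three _ e (fun i ↦ u.symm (Pi.single i 1))
    (sum_inv_gram_smul_eq u e) β _)

/-- The model `4`-form: the Hodge dual of the model `3`-form. -/
def modelStar : (Fin 7 → ℝ) [⋀^Fin 4]→ₗ[ℝ] ℝ :=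
  (1 / 6 : ℝ) • ∑ i, ∑ j, ∑ k,
    modelG2 ![Pi.single i 1, Pi.single j 1, Pi.single k 1] •
      ((((Pi.basisFun ℝ (Fin 7)).det.curryLeft (Pi.single i 1)).curryLeft
        (Pi.single j 1)).curryLeft (Pi.single k 1))

/-- The Hodge dual `*_φ φ` of a positive form is carried to the model `4`-form by an adapted frame.
-/
theorem hodgeStar_self_model_comp (u : V ≃ₗ[ℝ] (Fin 7 → ℝ)) (e : Module.Basis (Fin 7) ℝ V) :
    hodgeStar (modelG2.compLinearMap u.toLinearMap) e (modelG2.compLinearMap u.toLinearMap) =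
      modelStar.compLinearMap u.toLinearMap := by
  rw [hodgeStar_model_comp]
  have h3 (a b c : Fin 7 → ℝ) :
      (⇑u.toLinearMap ∘ ![u.symm a, u.symm b, u.symm c]) = ![a, b, c] := by
    funext i; fin_cases i <;> simp
  simp only [AlternatingMap.compLinearMap_apply, AlternatingMap.curryLeft_compLinearMap,
    LinearEquiv.coe_coe, LinearEquiv.apply_symm_apply, modelStar]
  ext v
  simp only [AlternatingMap.compLinearMap_apply, AlternatingMap.smul_apply,
    AlternatingMap.sum_apply']
  simp only [← h3]
  rfl

/-- Contraction with an elementary form, on three arguments of an alternating map. -/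
theorem sum_elem3_smul {F : Type*} [AddCommGroup F] [Module ℝ F] (p q r : Fin 7)
    (X : Fin 7 → Fin 7 → Fin 7 → F) (h12 : ∀ i j k, X j i k = -X i j k)
    (h23 : ∀ i j k, X i k j = -X i j k) :
    ∑ i, ∑ j, ∑ k, elem3 p q r ![Pi.single i 1, Pi.single j 1, Pi.single k 1] •
      X i j k = (6 : ℝ) • X p q r := by
  simp only [elem3_apply, Pi.single_apply]
  simp [add_smul, sub_smul, Finset.sum_add_distrib, Finset.sum_sub_distrib, ite_smul]
  rw [h12 q r p, h23 q p r, h12 p r q, h12 p q r, h23 p q r]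
  module

/-- Laplace expansion of a determinant whose first row is a basis vector. -/
theorem det_of_row_zero_eq_single {n : ℕ} (A : Matrix (Fin (n + 1)) (Fin (n + 1)) ℝ)
    (p : Fin (n + 1)) (h : A 0 = Pi.single p 1) :
    A.det = (-1) ^ (p : ℕ) * (A.submatrix Fin.succ p.succAbove).det := by
  rw [Matrix.det_succ_row_zero, Finset.sum_eq_single p]
  · simp [h]
  · intro j _ hj
    simp [h, hj]
  · simp

/-- Contracting the model `4`-form with `e₀` gives minus the imaginary part of the complex volume
form. -/
theorem modelStar_apply (a b c : Fin 7 → ℝ) :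
    modelStar ![Pi.single 0 1, a, b, c] = -(stdVol ![toC3 a, toC3 b, toC3 c]).im := by
  obtain ⟨X, hXdef⟩ : ∃ X : Fin 7 → Fin 7 → Fin 7 → ℝ, ∀ i j k, X i j k =
    (Pi.basisFun ℝ (Fin 7)).det
      ![Pi.single i 1, Pi.single j 1, Pi.single k 1, Pi.single 0 1, a, b, c] := ⟨_, fun _ _ _ ↦ rfl⟩
  have h12 (i j k : Fin 7) : X j i k = -X i j k := by
    rw [hXdef, hXdef, ← AlternatingMap.map_swap _ _ (show (0 : Fin 7) ≠ 1 by decide)]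
    congr 1; funext l; fin_cases l <;> rfl
  have h23 (i j k : Fin 7) : X i k j = -X i j k := by
    rw [hXdef, hXdef, ← AlternatingMap.map_swap _ _ (show (1 : Fin 7) ≠ 2 by decide)]
    congr 1; funext l; fin_cases l <;> rfl
  have h6 (p q r : Fin 7) := sum_elem3_smul p q r X h12 h23
  simp only [smul_eq_mul] at h6
  -- each elementary form of the model contributes one value of the determinant
  have hs : modelStar ![Pi.single 0 1, a, b, c] =
      X 0 1 2 + X 0 3 4 + X 0 5 6 + X 1 3 5 - X 1 4 6 - X 2 3 6 - X 2 4 5 := by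
    have : modelStar ![Pi.single 0 1, a, b, c] = (1 / 6 : ℝ) * ∑ i, ∑ j, ∑ k,
      modelG2 ![Pi.single i 1, Pi.single j 1, Pi.single k 1] • X i j k := by
      simp only [modelStar, AlternatingMap.smul_apply, AlternatingMap.sum_apply', hXdef,
        smul_eq_mul, AlternatingMap.curryLeft_apply_apply]
    rw [this]
    simp only [modelG2_eq_elem3_sum, smul_eq_mul, add_mul, sub_mul,
      Finset.sum_add_distrib, Finset.sum_sub_distrib, h6]
    ring
  rw [hs]
  -- `e₀` occurs twice in the terms of `e⁰ ∧ ω₀`; only those of `Re Ω₀` remain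
  have z0 (q r : Fin 7) : X 0 q r = 0 := by
    rw [hXdef]
    exact AlternatingMap.map_eq_zero_of_eq _ _ (i := 0) (j := 3) rfl (by decide)
  simp only [Pi.basisFun_det_apply] at hXdef
  have e0 : X 1 3 5 = elem3 2 4 6 ![a, b, c] := by
    rw [hXdef, det_of_row_zero_eq_single _ 1 rfl,
      det_of_row_zero_eq_single _ 2 (by ext j; fin_cases j <;> rfl),
      det_of_row_zero_eq_single _ 3 (by ext j; fin_cases j <;> rfl),
      det_of_row_zero_eq_single _ 0 (by ext j; fin_cases j <;> rfl),
      Matrix.det_fin_three, elem3_apply]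
    change (-1) ^ 1 * ((-1) ^ 2 * ((-1) ^ 3 * ((-1) ^ 0 *
      (a 2 * b 4 * c 6 - a 2 * b 6 * c 4 - a 4 * b 2 * c 6 +
      a 4 * b 6 * c 2 + a 6 * b 2 * c 4 - a 6 * b 4 * c 2)))) = _
    ring
  have e1 : X 1 4 6 = elem3 2 3 5 ![a, b, c] := by
    rw [hXdef, det_of_row_zero_eq_single _ 1 rfl,
      det_of_row_zero_eq_single _ 3 (by ext j; fin_cases j <;> rfl),
      det_of_row_zero_eq_single _ 4 (by ext j; fin_cases j <;> rfl),
      det_of_row_zero_eq_single _ 0 (by ext j; fin_cases j <;> rfl),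
      Matrix.det_fin_three, elem3_apply]
    change (-1) ^ 1 * ((-1) ^ 3 * ((-1) ^ 4 * ((-1) ^ 0 *
      (a 2 * b 3 * c 5 - a 2 * b 5 * c 3 - a 3 * b 2 * c 5 +
      a 3 * b 5 * c 2 + a 5 * b 2 * c 3 - a 5 * b 3 * c 2)))) = _
    ring
  have e2 : X 2 3 6 = elem3 1 4 5 ![a, b, c] := by
    rw [hXdef, det_of_row_zero_eq_single _ 2 rfl,
      det_of_row_zero_eq_single _ 2 (by ext j; fin_cases j <;> rfl),
      det_of_row_zero_eq_single _ 4 (by ext j; fin_cases j <;> rfl),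
      det_of_row_zero_eq_single _ 0 (by ext j; fin_cases j <;> rfl),
      Matrix.det_fin_three, elem3_apply]
    change (-1) ^ 2 * ((-1) ^ 2 * ((-1) ^ 4 * ((-1) ^ 0 *
      (a 1 * b 4 * c 5 - a 1 * b 5 * c 4 - a 4 * b 1 * c 5 +
      a 4 * b 5 * c 1 + a 5 * b 1 * c 4 - a 5 * b 4 * c 1)))) = _
    ring
  have e3 : X 2 4 5 = elem3 1 3 6 ![a, b, c] := by
    rw [hXdef, det_of_row_zero_eq_single _ 2 rfl,
      det_of_row_zero_eq_single _ 3 (by ext j; fin_cases j <;> rfl),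
      det_of_row_zero_eq_single _ 3 (by ext j; fin_cases j <;> rfl),
      det_of_row_zero_eq_single _ 0 (by ext j; fin_cases j <;> rfl),
      Matrix.det_fin_three, elem3_apply]
    change (-1) ^ 2 * ((-1) ^ 3 * ((-1) ^ 3 * ((-1) ^ 0 *
      (a 1 * b 3 * c 6 - a 1 * b 6 * c 3 - a 3 * b 1 * c 6 +
      a 3 * b 6 * c 1 + a 6 * b 1 * c 3 - a 6 * b 3 * c 1)))) = _
    ring
  rw [z0, z0, z0, e0, e1, e2, e3]
  simp [elem3_apply, Matrix.det_fin_three, stdVol_apply, toC3]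
  ring

end HodgeStar

/-! ### Wedge products in low degrees -/

section WedgeFormulas

variable {V : Type*} [AddCommGroup V] [Module ℝ V]

theorem wedgeFun_two_three (α : V [⋀^Fin 2]→ₗ[ℝ] ℝ) (β : V [⋀^Fin 3]→ₗ[ℝ] ℝ)
    (a b c d e : V) :
    wedgeFun α β (rfl : 2 + 3 = 5) ![a, b, c, d, e] =
      α ![a, b] * β ![c, d, e] - α ![a, c] * β ![b, d, e] + α ![a, d] * β ![b, c, e] -
      α ![a, e] * β ![b, c, d] + α ![b, c] * β ![a, d, e] - α ![b, d] * β ![a, c, e] +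
      α ![b, e] * β ![a, c, d] + α ![c, d] * β ![a, b, e] - α ![c, e] * β ![a, b, d] +
      α ![d, e] * β ![a, b, c] := by
  simp only [wedgeFun_cons, wedgeFun_zero_left, wedgeFun_zero_right]
  simp
  ring

theorem wedgeFun_three_three (α : V [⋀^Fin 3]→ₗ[ℝ] ℝ) (β : V [⋀^Fin 3]→ₗ[ℝ] ℝ)
    (a b c d e f : V) :
    wedgeFun α β (rfl : 3 + 3 = 6) ![a, b, c, d, e, f] =
      α ![a, b, c] * β ![d, e, f] - α ![a, b, d] * β ![c, e, f] + α ![a, b, e] * β ![c, d, f] -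
      α ![a, b, f] * β ![c, d, e] + α ![a, c, d] * β ![b, e, f] - α ![a, c, e] * β ![b, d, f] +
      α ![a, c, f] * β ![b, d, e] + α ![a, d, e] * β ![b, c, f] - α ![a, d, f] * β ![b, c, e] +
      α ![a, e, f] * β ![b, c, d] - α ![b, c, d] * β ![a, e, f] + α ![b, c, e] * β ![a, d, f] -
      α ![b, c, f] * β ![a, d, e] - α ![b, d, e] * β ![a, c, f] + α ![b, d, f] * β ![a, c, e] -
      α ![b, e, f] * β ![a, c, d] + α ![c, d, e] * β ![a, b, f] - α ![c, d, f] * β ![a, b, e] +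
      α ![c, e, f] * β ![a, b, d] - α ![d, e, f] * β ![a, b, c] := by
  simp only [wedgeFun_cons, wedgeFun_zero_left, wedgeFun_zero_right]
  simp
  ring

theorem wedgeFun_four_two (α : V [⋀^Fin 4]→ₗ[ℝ] ℝ) (β : V [⋀^Fin 2]→ₗ[ℝ] ℝ)
    (a b c d e f : V) :
    wedgeFun α β (rfl : 4 + 2 = 6) ![a, b, c, d, e, f] =
      α ![a, b, c, d] * β ![e, f] - α ![a, b, c, e] * β ![d, f] + α ![a, b, c, f] * β ![d, e] +
      α ![a, b, d, e] * β ![c, f] - α ![a, b, d, f] * β ![c, e] + α ![a, b, e, f] * β ![c, d] -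
      α ![a, c, d, e] * β ![b, f] + α ![a, c, d, f] * β ![b, e] - α ![a, c, e, f] * β ![b, d] +
      α ![a, d, e, f] * β ![b, c] + α ![b, c, d, e] * β ![a, f] - α ![b, c, d, f] * β ![a, e] +
      α ![b, c, e, f] * β ![a, d] - α ![b, d, e, f] * β ![a, c] + α ![c, d, e, f] * β ![a, b] := by
  simp only [wedgeFun_cons, wedgeFun_zero_left, wedgeFun_zero_right]
  simp
  ring

theorem wedge_two_three_eq_wedgeFun (α : V [⋀^Fin 2]→ₗ[ℝ] ℝ) (β : V [⋀^Fin 3]→ₗ[ℝ] ℝ)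
    (v : Fin 5 → V) : wedge α β v = wedgeFun α β (rfl : 2 + 3 = 5) v := by
  exact wedge_eq_wedgeFun α β v

theorem wedge_three_three_eq_wedgeFun (α : V [⋀^Fin 3]→ₗ[ℝ] ℝ) (β : V [⋀^Fin 3]→ₗ[ℝ] ℝ)
    (v : Fin 6 → V) : wedge α β v = wedgeFun α β (rfl : 3 + 3 = 6) v := by
  exact wedge_eq_wedgeFun α β v

theorem wedge_two_two_two_eq_wedgeFun (α α' β : V [⋀^Fin 2]→ₗ[ℝ] ℝ) (v : Fin 6 → V) :
    wedge (wedge α α') β v = wedgeFun (p := 4) (wedge α α') β (rfl : 4 + 2 = 6) v := by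
  exact wedge_eq_wedgeFun (wedge α α') β v

end WedgeFormulas

/-! ### The standard `SU(3)`-structure of `ℂ³` -/

section StandardForms

theorem stdOmega_eq (z w : Fin 3 → ℂ) : stdOmega ![z, w] =
    (z 0).re * (w 0).im - (z 0).im * (w 0).re + ((z 1).re * (w 1).im - (z 1).im * (w 1).re) +
      ((z 2).re * (w 2).im - (z 2).im * (w 2).re) := by
  rw [stdOmega_apply, Fin.sum_univ_three]

theorem stdVol_eq (u v w : Fin 3 → ℂ) : stdVol ![u, v, w] =
    u 0 * v 1 * w 2 - u 0 * v 2 * w 1 - u 1 * v 0 * w 2 + u 1 * v 2 * w 0 + u 2 * v 0 * w 1 -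
      u 2 * v 1 * w 0 := by
  rw [stdVol_apply, Matrix.det_fin_three]
  simp

theorem wedge_stdOmega_re_stdVol : wedge stdOmega (rePart stdVol) = 0 := by
  ext v
  rw [wedge_two_three_eq_wedgeFun]
  obtain ⟨a, b, c, d, e, rfl⟩ : ∃ a b c d e, v = ![a, b, c, d, e] :=
    ⟨v 0, v 1, v 2, v 3, v 4, by funext i; fin_cases i <;> rfl⟩
  have hre (x y z : Fin 3 → ℂ) : rePart stdVol ![x, y, z] = (stdVol ![x, y, z]).re := rfl
  rw [wedgeFun_two_three]
  simp only [hre, stdOmega_eq, stdVol_eq, Complex.sub_re, Complex.add_re, Complex.mul_re,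
    Complex.mul_im]
  simp only [AlternatingMap.zero_apply]
  ring

/-- The real basis `e₁, i e₁, e₂, i e₂, e₃, i e₃` of `ℂ³`. -/
def realBasis : Module.Basis (Fin 6) ℝ (Fin 3 → ℂ) :=
  Module.Basis.ofEquivFun
    { toFun := fun z ↦ ![(z 0).re, (z 0).im, (z 1).re, (z 1).im, (z 2).re, (z 2).im]
      map_add' := fun z w ↦ by ext k; fin_cases k <;> simp
      map_smul' := fun c z ↦ by ext k; fin_cases k <;> simp
      invFun := fun x ↦ ![⟨x 0, x 1⟩, ⟨x 2, x 3⟩, ⟨x 4, x 5⟩]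
      left_inv := fun z ↦ by ext k; fin_cases k <;> simp
      right_inv := fun x ↦ by ext k; fin_cases k <;> simp }

theorem coe_realBasis : ⇑realBasis = ![Pi.single 0 1, Pi.single 0 Complex.I, Pi.single 1 1,
    Pi.single 1 Complex.I, Pi.single 2 1, Pi.single 2 Complex.I] := by
  funext k
  ext l
  fin_cases k <;> fin_cases l <;> simp [realBasis, Complex.ext_iff]

theorem stdOmega_cube_realBasis :
    wedge (wedge stdOmega stdOmega) stdOmega realBasis = 6 := by
  rw [wedge_two_two_two_eq_wedgeFun, coe_realBasis, wedgeFun_four_two]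
  simp only [wedge_two_two, stdOmega_eq]
  simp
  norm_num

/-- The volume of `Re (cΩ₀) ∧ Im (cΩ₀)` depends on `c` through `|c| ^ 2` only. -/
theorem re_wedge_im_stdVol_realBasis (c : ℂ) :
    wedge (rePart (c • stdVol)) (imPart (c • stdVol)) realBasis = 4 * Complex.normSq c := by
  have hre (x y z : Fin 3 → ℂ) : rePart (c • stdVol) ![x, y, z] = (c * stdVol ![x, y, z]).re := rfl
  have him (x y z : Fin 3 → ℂ) : imPart (c • stdVol) ![x, y, z] = (c * stdVol ![x, y, z]).im := rfl
  rw [wedge_three_three_eq_wedgeFun, coe_realBasis, wedgeFun_three_three]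
  simp only [hre, him, stdVol_eq]
  simp [Complex.normSq_apply]
  ring

end StandardForms

section StandardStructure

theorem alternatingMap_eq_of_basis {V : Type*} [AddCommGroup V] [Module ℝ V]
    (b : Module.Basis (Fin 6) ℝ V) {α β : V [⋀^Fin 6]→ₗ[ℝ] ℝ} (h : α b = β b) : α = β := by
  rw [AlternatingMap.eq_smul_basis_det b α, h, ← AlternatingMap.eq_smul_basis_det b β]

/-- Multiplication by `i` on `ℂ³` as a real linear map. -/
def mulI : (Fin 3 → ℂ) →ₗ[ℝ] (Fin 3 → ℂ) where
  toFun z := Complex.I • z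
  map_add' := smul_add _
  map_smul' _ _ := smul_comm _ _ _

theorem mulI_apply (z : Fin 3 → ℂ) : mulI z = Complex.I • z := rfl

theorem stdVol_mulI (u v w : Fin 3 → ℂ) :
    stdVol ![mulI u, v, w] = Complex.I * stdVol ![u, v, w] := by
  simp only [stdVol_eq, mulI_apply, Pi.smul_apply, smul_eq_mul]
  ring

theorem stdOmega_volume : (1 / 6 : ℝ) • wedge (wedge stdOmega stdOmega) stdOmega =
    (1 / 4 : ℝ) • wedge (rePart stdVol) (imPart stdVol) := by
  have h := re_wedge_im_stdVol_realBasis 1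
  have hs : (1 : ℂ) • stdVol = stdVol := by ext; simp
  have hn : 4 * Complex.normSq 1 = 4 := by simp
  rw [hs, hn] at h
  have h' : (wedge (wedge stdOmega stdOmega) stdOmega : (Fin 3 → ℂ) [⋀^Fin 6]→ₗ[ℝ] ℝ)
      realBasis = 6 := by
    exact stdOmega_cube_realBasis
  generalize wedge (wedge stdOmega stdOmega) stdOmega = A at h' ⊢
  generalize wedge (rePart stdVol) (imPart stdVol) = B at h ⊢
  refine alternatingMap_eq_of_basis realBasis ?_
  rw [AlternatingMap.smul_apply, AlternatingMap.smul_apply, h, h']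
  norm_num

variable {W : Type*} [AddCommGroup W] [Module ℝ W]

theorem comp_vec_two {A B : Type*} (f : A → B) (a b : A) : f ∘ ![a, b] = ![f a, f b] := by
  funext i; fin_cases i <;> rfl

theorem comp_vec_three {A B : Type*} (f : A → B) (a b c : A) :
    f ∘ ![a, b, c] = ![f a, f b, f c] := by
  funext i; fin_cases i <;> rfl

theorem compLinearMap_apply_two {V F : Type*} [AddCommGroup V] [Module ℝ V] [AddCommGroup F]
    [Module ℝ F] (α : V [⋀^Fin 2]→ₗ[ℝ] F) (f : W →ₗ[ℝ] V) (a b : W) :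
    α.compLinearMap f ![a, b] = α ![f a, f b] :=
  congrArg α (comp_vec_two f a b)

theorem compLinearMap_apply_three {V F : Type*} [AddCommGroup V] [Module ℝ V] [AddCommGroup F]
    [Module ℝ F] (α : V [⋀^Fin 3]→ₗ[ℝ] F) (f : W →ₗ[ℝ] V) (a b c : W) :
    α.compLinearMap f ![a, b, c] = α ![f a, f b, f c] :=
  congrArg α (comp_vec_three f a b c)

theorem rePart_compLinearMap {V : Type*} [AddCommGroup V] [Module ℝ V] {k : ℕ}
    (Ω : V [⋀^Fin k]→ₗ[ℝ] ℂ) (f : W →ₗ[ℝ] V) :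
    rePart (Ω.compLinearMap f) = (rePart Ω).compLinearMap f := rfl

theorem imPart_compLinearMap {V : Type*} [AddCommGroup V] [Module ℝ V] {k : ℕ}
    (Ω : V [⋀^Fin k]→ₗ[ℝ] ℂ) (f : W →ₗ[ℝ] V) :
    imPart (Ω.compLinearMap f) = (imPart Ω).compLinearMap f := rfl

theorem finrank_C3 : Module.finrank ℝ (Fin 3 → ℂ) = 6 := by
  rw [Module.finrank_eq_card_basis realBasis, Fintype.card_fin]

/-- The standard structure of `ℂ³` is an `SU(3)`-structure, and so are its isomorphic copies. -/
theorem isSU3_std_comp (v : W ≃ₗ[ℝ] (Fin 3 → ℂ)) :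
    IsSU3 (stdOmega.compLinearMap v.toLinearMap) (stdVol.compLinearMap v.toLinearMap) where
  finrank_eq := by rw [LinearEquiv.finrank_eq v, finrank_C3]
  omega_wedge := by
    rw [rePart_compLinearMap, wedge_compLinearMap, wedge_stdOmega_re_stdVol]
    rfl
  volume_eq := by
    rw [rePart_compLinearMap, imPart_compLinearMap, wedge_compLinearMap, wedge_compLinearMap,
      wedge_compLinearMap]
    have h := stdOmega_volume
    generalize wedge (wedge stdOmega stdOmega) stdOmega = A at h ⊢
    generalize wedge (rePart stdVol) (imPart stdVol) = B at h ⊢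
    ext w
    exact congrArg (fun γ ↦ γ (⇑v.toLinearMap ∘ w)) h
  ne_zero h := by
    have h1 : stdVol.compLinearMap v.toLinearMap ![v.symm (Pi.single 0 1), v.symm (Pi.single 1 1),
        v.symm (Pi.single 2 1)] = 0 := by rw [h]; rfl
    rw [compLinearMap_apply_three, stdVol_eq] at h1
    simp at h1
  complex_structure := by
    refine ⟨v.symm.toLinearMap ∘ₗ mulI ∘ₗ v.toLinearMap, fun w ↦ ?_, fun a b c ↦ ?_,
      fun w hw ↦ ?_⟩
    · simp [mulI_apply, smul_smul]
    · rw [compLinearMap_apply_three, compLinearMap_apply_three, ← stdVol_mulI]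
      simp
    · rw [compLinearMap_apply_two]
      have hv : v w ≠ 0 := by simpa using hw
      obtain ⟨k, hk⟩ := Function.ne_iff.1 hv
      simp only [LinearEquiv.coe_coe, LinearMap.comp_apply, LinearEquiv.apply_symm_apply,
        stdOmega_apply, mulI_apply, Pi.smul_apply, smul_eq_mul]
      refine Finset.sum_pos' (fun j _ ↦ ?_) ⟨k, Finset.mem_univ _, ?_⟩
      · simp; nlinarith [mul_self_nonneg (v w j).re, mul_self_nonneg (v w j).im]
      · have := Complex.normSq_pos.2 hk
        rw [Complex.normSq_apply] at this
        simp; linarith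

/-- A complex-valued, real multilinear alternating `3`-form on `ℂ³` which is complex linear in its
first argument is a multiple of the complex determinant. -/
theorem eq_smul_stdVol (Ω : (Fin 3 → ℂ) [⋀^Fin 3]→ₗ[ℝ] ℂ)
    (h : ∀ u v w, Ω ![mulI u, v, w] = Complex.I * Ω ![u, v, w]) :
    Ω = Ω ![Pi.single 0 1, Pi.single 1 1, Pi.single 2 1] • stdVol := by
  have s01 (u v w : Fin 3 → ℂ) : Ω ![v, u, w] = -Ω ![u, v, w] := by
    rw [← Ω.map_swap ![u, v, w] (show (0 : Fin 3) ≠ 1 by decide)]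
    congr 1; funext k; fin_cases k <;> rfl
  have s02 (u v w : Fin 3 → ℂ) : Ω ![w, v, u] = -Ω ![u, v, w] := by
    rw [← Ω.map_swap ![u, v, w] (show (0 : Fin 3) ≠ 2 by decide)]
    congr 1; funext k; fin_cases k <;> rfl
  have hc (c : ℂ) (u v w : Fin 3 → ℂ) : Ω ![c • u, v, w] = c * Ω ![u, v, w] := by
    have e : c • u = c.re • u + c.im • mulI u := by
      ext k
      simp only [mulI_apply, Pi.smul_apply, Pi.add_apply, smul_eq_mul, Complex.real_smul]
      conv_lhs => rw [← Complex.re_add_im c]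
      ring
    have e2 : Ω ![c • u, v, w] = c.re • Ω ![u, v, w] + c.im • Ω ![mulI u, v, w] := by
      rw [e]
      have := congrArg (fun γ ↦ γ ![v, w]) (Ω.curryLeft.map_add (c.re • u) (c.im • mulI u))
      rw [map_smul, map_smul] at this
      exact this
    rw [e2, h, Complex.real_smul, Complex.real_smul]
    conv_rhs => rw [← Complex.re_add_im c]
    ring
  have u0 (m : Fin 3 → Fin 3 → ℂ) (x : Fin 3 → ℂ) :
      Function.update m 0 x = ![x, m 1, m 2] := by
    funext k; fin_cases k <;> rfl
  have u1 (m : Fin 3 → Fin 3 → ℂ) (x : Fin 3 → ℂ) :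
      Function.update m 1 x = ![m 0, x, m 2] := by
    funext k; fin_cases k <;> rfl
  have u2 (m : Fin 3 → Fin 3 → ℂ) (x : Fin 3 → ℂ) :
      Function.update m 2 x = ![m 0, m 1, x] := by
    funext k; fin_cases k <;> rfl
  have hu (m : Fin 3 → Fin 3 → ℂ) (i : Fin 3) (c : ℂ) (x : Fin 3 → ℂ) :
      Ω (Function.update m i (c • x)) = c * Ω (Function.update m i x) := by
    match i with
    | 0 => rw [u0, u0, hc]
    | 1 => rw [u1, u1, s01, hc, s01 x]; ring
    | 2 => rw [u2, u2, s02, hc, s02 x]; ring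
  -- by antisymmetry `Ω` is complex multilinear, and the determinant spans such forms
  let Ω' : (Fin 3 → ℂ) [⋀^Fin 3]→ₗ[ℂ] ℂ :=
    { toFun := Ω
      map_update_add' := fun m i x y ↦ by
        convert! Ω.map_update_add m i x y
      map_update_smul' := fun m i c x ↦ by
        convert! hu m i c x
      map_eq_zero_of_eq' := fun v i j hv hij ↦ Ω.map_eq_zero_of_eq v hv hij }
  have key := AlternatingMap.eq_smul_basis_det (Pi.basisFun ℂ (Fin 3)) Ω'
  ext m
  have h1 := congrArg (fun γ ↦ γ m) key
  have h2 : (⇑(Pi.basisFun ℂ (Fin 3)) : Fin 3 → Fin 3 → ℂ) =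
      ![Pi.single 0 1, Pi.single 1 1, Pi.single 2 1] := by
    funext k; fin_cases k <;> simp
  rw [h2] at h1
  simp only [AlternatingMap.smul_apply, Pi.basisFun_det_apply] at h1
  exact h1

end StandardStructure

/-! ### Unitary frames -/

section Frames

variable {W : Type*} [AddCommGroup W] [Module ℝ W]

/-- A `2`-form as a bilinear map. -/
def toBilin (ω₀ : W [⋀^Fin 2]→ₗ[ℝ] ℝ) : W →ₗ[ℝ] W →ₗ[ℝ] ℝ :=
  LinearMap.mk₂ ℝ (fun x y ↦ ω₀ ![x, y])
    (fun x x' y ↦ congrArg (fun γ ↦ γ ![y]) (ω₀.curryLeft.map_add x x'))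
    (fun c x y ↦ congrArg (fun γ ↦ γ ![y]) (ω₀.curryLeft.map_smul c x))
    (fun x y y' ↦ congrArg (fun γ ↦ γ ![]) ((ω₀.curryLeft x).curryLeft.map_add y y'))
    (fun c x y ↦ congrArg (fun γ ↦ γ ![]) ((ω₀.curryLeft x).curryLeft.map_smul c y))

theorem toBilin_apply (ω₀ : W [⋀^Fin 2]→ₗ[ℝ] ℝ) (x y : W) : toBilin ω₀ x y = ω₀ ![x, y] := rfl

theorem toBilin_swap (ω₀ : W [⋀^Fin 2]→ₗ[ℝ] ℝ) (x y : W) : toBilin ω₀ x y = -toBilin ω₀ y x := by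
  rw [toBilin_apply, toBilin_apply, ← ω₀.map_swap ![y, x] (show (0 : Fin 2) ≠ 1 by decide)]
  congr 1; funext k; fin_cases k <;> rfl

theorem toBilin_self (ω₀ : W [⋀^Fin 2]→ₗ[ℝ] ℝ) (x : W) : toBilin ω₀ x x = 0 := by
  have := toBilin_swap ω₀ x x
  linarith

/-- The step of the Gram–Schmidt process: there is a unit vector orthogonal to fewer vectors than
the dimension. -/
theorem exists_unit_orthogonal (g : W →ₗ[ℝ] W →ₗ[ℝ] ℝ) (hpos : ∀ v, v ≠ 0 → 0 < g v v) {k : ℕ}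
    (s : Fin k → W) (hk : k < Module.finrank ℝ W) : ∃ x, g x x = 1 ∧ ∀ i, g (s i) x = 0 := by
  have : Module.Finite ℝ W := Module.finite_of_finrank_pos (by omega)
  have hker := LinearMap.ker_ne_bot_of_finrank_lt (f := LinearMap.pi fun i ↦ g (s i)) (by simpa)
  obtain ⟨x, hx, hx0⟩ := (Submodule.ne_bot_iff _).1 hker
  have hx' (i : Fin k) : g (s i) x = 0 := congrFun (LinearMap.mem_ker.1 hx) i
  have hp := hpos x hx0
  refine ⟨(Real.sqrt (g x x))⁻¹ • x, ?_, fun i ↦ by simp [hx']⟩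
  simp only [map_smul, LinearMap.smul_apply, smul_eq_mul]
  have := Real.mul_self_sqrt hp.le
  have h0 := (Real.sqrt_pos.2 hp).ne'
  field_simp
  rw [sq, this]

/-- The real linear map `ℂ³ → W` sending `e_k` to `f_k` and `i e_k` to `J f_k`. -/
def frameMap (J : W →ₗ[ℝ] W) (f : Fin 3 → W) : (Fin 3 → ℂ) →ₗ[ℝ] W :=
  ∑ k, ((Complex.reLm ∘ₗ LinearMap.proj k).smulRight (f k) +
    (Complex.imLm ∘ₗ LinearMap.proj k).smulRight (J (f k)))

theorem frameMap_apply (J : W →ₗ[ℝ] W) (f : Fin 3 → W) (z : Fin 3 → ℂ) :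
    frameMap J f z = ∑ k, ((z k).re • f k + (z k).im • J (f k)) := by
  simp [frameMap]

theorem frameMap_mulI (J : W →ₗ[ℝ] W) (f : Fin 3 → W) (hJ : ∀ k, J (J (f k)) = -f k)
    (z : Fin 3 → ℂ) : frameMap J f (mulI z) = J (frameMap J f z) := by
  rw [frameMap_apply, frameMap_apply, map_sum]
  refine Finset.sum_congr rfl fun k _ ↦ ?_
  simp [mulI_apply, hJ, add_comm]

theorem frameMap_single (J : W →ₗ[ℝ] W) (f : Fin 3 → W) (k : Fin 3) :
    frameMap J f (Pi.single k 1) = f k := by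
  rw [frameMap_apply, Finset.sum_eq_single k]
  · simp
  · intro l _ hl
    simp [hl]
  · simp

/-- In a linear `SU(3)`-structure, the `(2,0) + (0,2)`-part of `ω₀` vanishes. This is what the
equation `ω₀ ∧ Re Ω = 0` expresses. -/
theorem IsSU3.omega_type {ω₀ : W [⋀^Fin 2]→ₗ[ℝ] ℝ} {Ω : W [⋀^Fin 3]→ₗ[ℝ] ℂ}
    (h : wedge ω₀ (rePart Ω) = 0) (J : W →ₗ[ℝ] W)
    (hJ : ∀ u v w, Ω ![J u, v, w] = Complex.I * Ω ![u, v, w]) (x y z : W)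
    (hne : Ω ![x, y, z] ≠ 0) :
    ω₀ ![J x, J y] = ω₀ ![x, y] ∧ ω₀ ![J x, y] = -ω₀ ![x, J y] := by
  have s01 (u v w : W) : Ω ![v, u, w] = -Ω ![u, v, w] := by
    rw [← Ω.map_swap ![u, v, w] (show (0 : Fin 3) ≠ 1 by decide)]
    congr 1; funext k; fin_cases k <;> rfl
  have s02 (u v w : W) : Ω ![w, v, u] = -Ω ![u, v, w] := by
    rw [← Ω.map_swap ![u, v, w] (show (0 : Fin 3) ≠ 2 by decide)]
    congr 1; funext k; fin_cases k <;> rfl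
  have h1 (u v w : W) : Ω ![u, J v, w] = Complex.I * Ω ![u, v, w] := by
    rw [s01, hJ, s01]; ring
  have h2 (u v w : W) : Ω ![u, v, J w] = Complex.I * Ω ![u, v, w] := by
    rw [s02, hJ, s02]; ring
  have z01 (u w : W) : Ω ![u, u, w] = 0 :=
    Ω.map_eq_zero_of_eq _ (i := 0) (j := 1) rfl (by decide)
  have z12 (u w : W) : Ω ![w, u, u] = 0 :=
    Ω.map_eq_zero_of_eq _ (i := 1) (j := 2) rfl (by decide)
  -- `ω₀ ∧ Re Ω` on `x, J x, y, J y, w`: all terms in which `Ω` has two proportional arguments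
  -- vanish
  have key (w : W) : (ω₀ ![x, y] - ω₀ ![J x, J y]) * (Ω ![x, y, w]).re -
      (ω₀ ![x, J y] + ω₀ ![J x, y]) * (Ω ![x, y, w]).im = 0 := by
    have h5 : wedgeFun ω₀ (rePart Ω) (rfl : 2 + 3 = 5) ![x, J x, y, J y, w] = 0 := by
      rw [← wedge_two_three_eq_wedgeFun, h]; rfl
    rw [wedgeFun_two_three] at h5
    have hre (u v w : W) : rePart Ω ![u, v, w] = (Ω ![u, v, w]).re := rfl
    simp only [hre, hJ, h1, h2, z01, z12, mul_zero, Complex.zero_re, Complex.mul_re, Complex.I_re,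
      Complex.I_im, Complex.mul_im, zero_mul, one_mul] at h5
    linarith
  -- two equations, whose determinant is `|Ω(x, y, z)|²`
  have k1 := key z
  have k2 := key (J z)
  rw [h2] at k2
  simp only [Complex.mul_re, Complex.I_re, Complex.I_im, Complex.mul_im, zero_mul, one_mul] at k2
  have hn : (Ω ![x, y, z]).re * (Ω ![x, y, z]).re + (Ω ![x, y, z]).im * (Ω ![x, y, z]).im ≠ 0 := by
    rw [← Complex.normSq_apply]; simpa using hne
  constructor
  · apply mul_right_cancel₀ hn
    linear_combination -(Ω ![x, y, z]).re * k1 + (Ω ![x, y, z]).im * k2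
  · apply mul_right_cancel₀ hn
    linear_combination -(Ω ![x, y, z]).im * k1 - (Ω ![x, y, z]).re * k2

end Frames

/-! ### Classification of linear `SU(3)`-structures -/

section StandardFrames

variable {W : Type*} [AddCommGroup W] [Module ℝ W]

/-- The coordinates of `frameMap J f z` are recovered by pairing with an orthonormal frame. -/
theorem pairing_frameMap (g : W →ₗ[ℝ] W →ₗ[ℝ] ℝ) (J : W →ₗ[ℝ] W) (f : Fin 3 → W)
    (hJ : ∀ k l, g (J (f k)) (J (f l)) = g (f k) (f l))
    (h1 : ∀ k l, g (f k) (f l) = if k = l then 1 else 0) (h2 : ∀ k l, g (J (f k)) (f l) = 0)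
    (h3 : ∀ k l, g (f k) (J (f l)) = 0) (z : Fin 3 → ℂ) (k : Fin 3) :
    g (f k) (frameMap J f z) = (z k).re ∧ g (J (f k)) (frameMap J f z) = (z k).im := by
  simp [frameMap_apply, hJ, h1, h2, h3]

theorem frameMap_injective (g : W →ₗ[ℝ] W →ₗ[ℝ] ℝ) (J : W →ₗ[ℝ] W) (f : Fin 3 → W)
    (hJ : ∀ k l, g (J (f k)) (J (f l)) = g (f k) (f l))
    (h1 : ∀ k l, g (f k) (f l) = if k = l then 1 else 0) (h2 : ∀ k l, g (J (f k)) (f l) = 0)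
    (h3 : ∀ k l, g (f k) (J (f l)) = 0) : Function.Injective (frameMap J f) := by
  refine (injective_iff_map_eq_zero _).2 fun z hz ↦ ?_
  ext k
  have h := pairing_frameMap g J f hJ h1 h2 h3 z k
  rw [hz, map_zero, map_zero] at h
  exact Complex.ext h.1.symm h.2.symm

/-- The symmetric part of `ω(·, J ·)`. -/
def hermMetric (ω₀ : W [⋀^Fin 2]→ₗ[ℝ] ℝ) (J : W →ₗ[ℝ] W) : W →ₗ[ℝ] W →ₗ[ℝ] ℝ :=
  (1 / 2 : ℝ) • ((toBilin ω₀).compl₂ J - (toBilin ω₀).comp J)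

theorem hermMetric_apply (ω₀ : W [⋀^Fin 2]→ₗ[ℝ] ℝ) (J : W →ₗ[ℝ] W) (x y : W) :
    hermMetric ω₀ J x y = 1 / 2 * (toBilin ω₀ x (J y) + toBilin ω₀ y (J x)) := by
  rw [toBilin_swap ω₀ y]
  simp only [hermMetric, LinearMap.smul_apply, LinearMap.sub_apply, LinearMap.compl₂_apply,
    LinearMap.comp_apply, smul_eq_mul]
  ring

/-- Two distinct coordinate vectors of `ℂ³` belong to a complex basis of coordinate vectors. -/
theorem exists_third (k l : Fin 3) (h : k ≠ l) : ∃ m : Fin 3,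
    stdVol ![Pi.single k 1, Pi.single l 1, Pi.single m 1] ≠ 0 := by
  revert h
  fin_cases k <;> fin_cases l <;> intro h
  · exact absurd rfl h
  · exact ⟨2, by simp [stdVol_eq]⟩
  · exact ⟨1, by simp [stdVol_eq]⟩
  · exact ⟨2, by simp [stdVol_eq]⟩
  · exact absurd rfl h
  · exact ⟨0, by simp [stdVol_eq]⟩
  · exact ⟨1, by simp [stdVol_eq]⟩
  · exact ⟨0, by simp [stdVol_eq]⟩
  · exact absurd rfl h

/-- Multiplication of the third coordinate of `ℂ³` by a nonzero number. -/
def scaleThird (c : ℂ) (hc : c ≠ 0) : (Fin 3 → ℂ) ≃ₗ[ℝ] (Fin 3 → ℂ) where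
  toFun z := ![z 0, z 1, c * z 2]
  map_add' z w := by ext k; fin_cases k <;> simp [mul_add]
  map_smul' r z := by ext k; fin_cases k <;> simp [mul_left_comm]
  invFun z := ![z 0, z 1, c⁻¹ * z 2]
  left_inv z := by ext k; fin_cases k <;> simp [hc]
  right_inv z := by ext k; fin_cases k <;> simp [hc]

theorem stdVol_scaleThird (c : ℂ) (hc : c ≠ 0) (u v w : Fin 3 → ℂ) :
    stdVol ![scaleThird c hc u, scaleThird c hc v, scaleThird c hc w] =
      c * stdVol ![u, v, w] := by
  simp [stdVol_eq, scaleThird]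
  ring

theorem stdOmega_scaleThird (c : ℂ) (hc : c ≠ 0) (h : Complex.normSq c = 1) (z w : Fin 3 → ℂ) :
    stdOmega ![scaleThird c hc z, scaleThird c hc w] = stdOmega ![z, w] := by
  rw [Complex.normSq_apply] at h
  simp [stdOmega_eq, scaleThird]
  linear_combination ((z 2).re * (w 2).im - (z 2).im * (w 2).re) * h

/-- Bilinear expansion in a frame on which the `2`-form takes the standard values. -/
theorem toBilin_frameMap (ω₀ : W [⋀^Fin 2]→ₗ[ℝ] ℝ) (J : W →ₗ[ℝ] W) (f : Fin 3 → W)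
    (h1 : ∀ k l, toBilin ω₀ (f k) (f l) = 0)
    (h2 : ∀ k l, toBilin ω₀ (f k) (J (f l)) = if k = l then 1 else 0)
    (h3 : ∀ k l, toBilin ω₀ (J (f k)) (J (f l)) = 0) (z w : Fin 3 → ℂ) :
    toBilin ω₀ (frameMap J f z) (frameMap J f w) = stdOmega ![z, w] := by
  have h4 (k l) : toBilin ω₀ (J (f k)) (f l) = if k = l then -1 else 0 := by
    rw [toBilin_swap, h2]
    by_cases h : k = l
    · simp [h]
    · simp [h, Ne.symm h]
  simp only [frameMap_apply, map_sum, map_add, map_smul, LinearMap.sum_apply, LinearMap.add_apply,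
    LinearMap.smul_apply, smul_eq_mul, h1, h2, h3, h4, stdOmega_apply]
  simp only [Fin.sum_univ_three]
  simp
  ring

/-- Every linear `SU(3)`-structure is isomorphic to the standard one of `ℂ³`. -/
theorem IsSU3.exists_std_frame {ω₀ : W [⋀^Fin 2]→ₗ[ℝ] ℝ} {Ω₀ : W [⋀^Fin 3]→ₗ[ℝ] ℂ}
    (h : IsSU3 ω₀ Ω₀) : ∃ v : W ≃ₗ[ℝ] (Fin 3 → ℂ),
      ω₀ = stdOmega.compLinearMap v.toLinearMap ∧ Ω₀ = stdVol.compLinearMap v.toLinearMap := by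
  have hfin := h.finrank_eq
  have : Module.Finite ℝ W := Module.finite_of_finrank_pos (by omega)
  obtain ⟨J, hJJ, hJ, hpos⟩ := h.complex_structure
  set g := hermMetric ω₀ J with hg
  have gpos (v) (hv : v ≠ 0) : 0 < g v v := by
    rw [hg, hermMetric_apply, toBilin_apply]
    have := hpos v hv
    linarith
  have gsymm (x y) : g x y = g y x := by
    rw [hg, hermMetric_apply, hermMetric_apply]; ring
  have gJ (x y) : g (J x) (J y) = g x y := by
    rw [hg, hermMetric_apply, hermMetric_apply, hJJ, hJJ, map_neg, map_neg,
      toBilin_swap ω₀ (J x), toBilin_swap ω₀ (J y)]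
    ring
  have gJ' (x y) : g (J x) y = -g x (J y) := by
    rw [← gJ, hJJ]; simp
  -- `J` is an isometry of `g` with `J² = -1`, hence skew
  have gJx (x) : g (J x) x = 0 := by
    have := gJ' x x
    rw [gsymm x] at this
    linarith
  -- a unitary frame, by the Gram–Schmidt process
  obtain ⟨f1, n1, -⟩ := exists_unit_orthogonal g gpos (k := 0) ![] (by omega)
  obtain ⟨f2, n2, o2⟩ := exists_unit_orthogonal g gpos ![f1, J f1] (by omega)
  obtain ⟨f3, n3, o3⟩ := exists_unit_orthogonal g gpos ![f1, J f1, f2, J f2] (by omega)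
  have o21 : g f1 f2 = 0 := o2 0
  have o21' : g (J f1) f2 = 0 := o2 1
  have o31 : g f1 f3 = 0 := o3 0
  have o31' : g (J f1) f3 = 0 := o3 1
  have o32 : g f2 f3 = 0 := o3 2
  have o32' : g (J f2) f3 = 0 := o3 3
  let f : Fin 3 → W := ![f1, f2, f3]
  have h1 (k l) : g (f k) (f l) = if k = l then 1 else 0 := by
    fin_cases k <;> fin_cases l <;>
      simp [f, n1, n2, n3, o21, o31, o32, gsymm f2 f1, gsymm f3 f1, gsymm f3 f2]
  have h2 (k l) : g (J (f k)) (f l) = 0 := by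
    fin_cases k <;> fin_cases l <;>
      simp [f, gJx, o21', o31', o32', gJ' f2 f1, gJ' f3 f1, gJ' f3 f2, gsymm f2 (J f1),
        gsymm f3 (J f1), gsymm f3 (J f2)]
  have h3 (k l) : g (f k) (J (f l)) = 0 := by rw [gsymm, h2]
  have hinj := frameMap_injective g J f (fun _ _ ↦ gJ _ _) h1 h2 h3
  let L : (Fin 3 → ℂ) ≃ₗ[ℝ] W :=
    LinearEquiv.ofInjectiveOfFinrankEq (frameMap J f) hinj (by rw [finrank_C3, hfin])
  have hL (z) : L z = frameMap J f z := rfl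
  have hLI (z) : L (mulI z) = J (L z) := frameMap_mulI J f (fun k ↦ hJJ _) z
  have hLs (k) : L (Pi.single k 1) = f k := frameMap_single J f k
  -- in this frame `Ω₀` is `c dz₁ ∧ dz₂ ∧ dz₃`
  have hΩ : ∃ c : ℂ, Ω₀.compLinearMap L.toLinearMap = c • stdVol := by
    refine ⟨_, eq_smul_stdVol _ fun u v w ↦ ?_⟩
    rw [compLinearMap_apply_three, compLinearMap_apply_three]
    simp only [LinearEquiv.coe_coe, hLI, hJ]
  obtain ⟨c, hc⟩ := hΩ
  have hΩc (u v w) : Ω₀ ![L u, L v, L w] = c * stdVol ![u, v, w] := by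
    have := congrArg (fun γ ↦ γ ![u, v, w]) hc
    simp only [compLinearMap_apply_three] at this
    exact this
  have hback : Ω₀ = (c • stdVol).compLinearMap L.symm.toLinearMap := by
    rw [← hc]; ext w; simp
  have hc0 : c ≠ 0 := by
    rintro rfl
    apply h.ne_zero
    rw [hback]; ext w; simp
  -- `ω₀` has type `(1, 1)`, so that its values on the frame are determined by `g`
  have htype (k l : Fin 3) (hkl : k ≠ l) : ω₀ ![J (f k), J (f l)] = ω₀ ![f k, f l] ∧
      ω₀ ![J (f k), f l] = -ω₀ ![f k, J (f l)] := by
    obtain ⟨m, hm⟩ := exists_third k l hkl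
    refine IsSU3.omega_type h.omega_wedge J hJ (f k) (f l) (f m) ?_
    rw [← hLs, ← hLs, ← hLs, hΩc]
    exact mul_ne_zero hc0 hm
  have hb1 (k l) : toBilin ω₀ (f k) (f l) = 0 := by
    by_cases hkl : k = l
    · rw [hkl, toBilin_self]
    · have h4 := h3 k l
      have h5 := (htype k l hkl).1
      rw [hg, hermMetric_apply, hJJ, map_neg, toBilin_swap ω₀ (J (f l))] at h4
      rw [← toBilin_apply, ← toBilin_apply] at h5
      linarith
  have hb2 (k l) : toBilin ω₀ (f k) (J (f l)) = if k = l then 1 else 0 := by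
    rw [← h1, hg, hermMetric_apply]
    by_cases hkl : k = l
    · rw [hkl]; ring
    · have h5 := (htype k l hkl).2
      rw [← toBilin_apply, ← toBilin_apply, toBilin_swap] at h5
      linarith
  have hb3 (k l) : toBilin ω₀ (J (f k)) (J (f l)) = 0 := by
    by_cases hkl : k = l
    · rw [hkl, toBilin_self]
    · have h5 := (htype k l hkl).1
      rw [← toBilin_apply, ← toBilin_apply, hb1] at h5
      exact h5
  have hω (z w) : ω₀ ![L z, L w] = stdOmega ![z, w] := toBilin_frameMap ω₀ J f hb1 hb2 hb3 z w
  have hωL : ω₀.compLinearMap L.toLinearMap = stdOmega := by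
    ext v
    obtain ⟨a, b, rfl⟩ : ∃ a b, v = ![a, b] := ⟨v 0, v 1, by funext i; fin_cases i <;> rfl⟩
    rw [compLinearMap_apply_two]
    exact hω a b
  -- compare the volumes of the real basis of `ℂ³`
  have hnorm : Complex.normSq c = 1 := by
    have hv := h.volume_eq
    have e1 : wedge (wedge stdOmega stdOmega) stdOmega =
        (wedge (wedge ω₀ ω₀) ω₀).compLinearMap L.toLinearMap := by
      rw [← wedge_compLinearMap, ← wedge_compLinearMap, hωL]
    have e2 : wedge (rePart (c • stdVol)) (imPart (c • stdVol)) =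
        (wedge (rePart Ω₀) (imPart Ω₀)).compLinearMap L.toLinearMap := by
      rw [← wedge_compLinearMap, ← hc]; rfl
    have v1 := stdOmega_cube_realBasis
    have v2 := re_wedge_im_stdVol_realBasis c
    rw [e1] at v1
    rw [e2] at v2
    generalize wedge (wedge ω₀ ω₀) ω₀ = A at v1 hv
    generalize wedge (rePart Ω₀) (imPart Ω₀) = B at v2 hv
    have h6 := congrArg (fun γ ↦ γ (⇑L.toLinearMap ∘ ⇑realBasis)) hv
    rw [AlternatingMap.compLinearMap_apply] at v1 v2
    simp only [AlternatingMap.smul_apply, smul_eq_mul] at h6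
    have v1' : A (⇑L.toLinearMap ∘ ⇑realBasis) = 6 := v1
    have v2' : B (⇑L.toLinearMap ∘ ⇑realBasis) = 4 * Complex.normSq c := v2
    have h6' : (1 / 6 : ℝ) * A (⇑L.toLinearMap ∘ ⇑realBasis) =
      (1 / 4 : ℝ) * B (⇑L.toLinearMap ∘ ⇑realBasis) := h6
    rw [v1', v2'] at h6'
    linarith
  -- the phase `c` is absorbed by the third coordinate
  refine ⟨L.symm.trans (scaleThird c hc0), ?_, ?_⟩
  · ext v
    obtain ⟨a, b, rfl⟩ : ∃ a b, v = ![a, b] := ⟨v 0, v 1, by funext i; fin_cases i <;> rfl⟩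
    rw [compLinearMap_apply_two]
    simp only [LinearEquiv.coe_coe, LinearEquiv.trans_apply, stdOmega_scaleThird c hc0 hnorm,
      ← hω, LinearEquiv.apply_symm_apply]
  · ext v
    obtain ⟨a, b, d, rfl⟩ : ∃ a b d, v = ![a, b, d] :=
      ⟨v 0, v 1, v 2, by funext i; fin_cases i <;> rfl⟩
    rw [compLinearMap_apply_three]
    simp only [LinearEquiv.coe_coe, LinearEquiv.trans_apply, stdVol_scaleThird,
      ← hΩc, LinearEquiv.apply_symm_apply]

end StandardFrames

/-! ### The cross product of `ℝ⁷` -/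

section CrossProduct

/-- The standard inner product of `ℝ⁷` as a bilinear map. -/
def dotBilin : (Fin 7 → ℝ) →ₗ[ℝ] (Fin 7 → ℝ) →ₗ[ℝ] ℝ :=
  LinearMap.mk₂ ℝ (fun v w ↦ v ⬝ᵥ w) add_dotProduct smul_dotProduct dotProduct_add
    (fun c v w ↦ dotProduct_smul c v w)

theorem dotBilin_apply (v w : Fin 7 → ℝ) : dotBilin v w = v ⬝ᵥ w := rfl

/-- The seven-dimensional cross product, `⟨a × b, c⟩ = φ(a, b, c)` for the model form `φ`. -/
def cross : (Fin 7 → ℝ) →ₗ[ℝ] (Fin 7 → ℝ) →ₗ[ℝ] (Fin 7 → ℝ) :=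
  LinearMap.mk₂ ℝ (fun a b ↦
    ![a 1 * b 2 - a 2 * b 1 + a 3 * b 4 - a 4 * b 3 + a 5 * b 6 - a 6 * b 5,
      a 2 * b 0 - a 0 * b 2 + a 3 * b 5 - a 5 * b 3 - a 4 * b 6 + a 6 * b 4,
      a 0 * b 1 - a 1 * b 0 - a 3 * b 6 + a 6 * b 3 - a 4 * b 5 + a 5 * b 4,
      a 4 * b 0 - a 0 * b 4 + a 5 * b 1 - a 1 * b 5 - a 6 * b 2 + a 2 * b 6,
      a 0 * b 3 - a 3 * b 0 - a 6 * b 1 + a 1 * b 6 - a 5 * b 2 + a 2 * b 5,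
      a 6 * b 0 - a 0 * b 6 + a 1 * b 3 - a 3 * b 1 - a 2 * b 4 + a 4 * b 2,
      a 0 * b 5 - a 5 * b 0 - a 1 * b 4 + a 4 * b 1 - a 2 * b 3 + a 3 * b 2])
    (fun a a' b ↦ by ext k; fin_cases k <;> simp <;> ring)
    (fun c a b ↦ by ext k; fin_cases k <;> simp <;> ring)
    (fun a b b' ↦ by ext k; fin_cases k <;> simp <;> ring)
    (fun c a b ↦ by ext k; fin_cases k <;> simp <;> ring)

theorem dotBilin_cross (a b c : Fin 7 → ℝ) : dotBilin (cross a b) c = modelG2 ![a, b, c] := by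
  rw [modelG2_eq_elem3_sum, dotBilin_apply]
  simp only [elem3_apply, dotProduct, Fin.sum_univ_seven, cross, LinearMap.mk₂_apply]
  simp
  ring

theorem cross_swap (a b : Fin 7 → ℝ) : cross a b = -cross b a := by
  ext k; fin_cases k <;> simp [cross] <;> ring

theorem dotBilin_comm (a b : Fin 7 → ℝ) : dotBilin a b = dotBilin b a := dotProduct_comm a b

theorem dotBilin_cross_cyclic (a b c : Fin 7 → ℝ) :
    dotBilin (cross a b) c = dotBilin (cross b c) a := by
  simp [dotBilin_apply, dotProduct, Fin.sum_univ_seven, cross]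
  ring

/-- The composition identity `a × (a × c) = -|a|² c + ⟨a, c⟩ a`. -/
theorem cross_cross_self (a c : Fin 7 → ℝ) :
    cross a (cross a c) = -dotBilin a a • c + dotBilin a c • a := by
  ext k
  fin_cases k <;> simp [dotBilin_apply, dotProduct, Fin.sum_univ_seven, cross] <;> ring

/-- The polarisation of `cross_cross_self`. -/
theorem cross_cross_add (a b c : Fin 7 → ℝ) : cross a (cross b c) + cross b (cross a c) =
    -(2 * dotBilin a b) • c + dotBilin a c • b + dotBilin b c • a := by
  have h := cross_cross_self (a + b) c
  have ha := cross_cross_self a c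
  have hb := cross_cross_self b c
  simp only [map_add, LinearMap.add_apply] at h
  rw [ha, hb] at h
  have hab := dotBilin_comm b a
  rw [hab] at h
  have : cross a (cross b c) + cross b (cross a c) =
    (-dotBilin a a • c + dotBilin a c • a + cross b (cross a c) +
      (cross a (cross b c) + (-dotBilin b b • c + dotBilin b c • b))) -
      (-dotBilin a a • c + dotBilin a c • a) - (-dotBilin b b • c + dotBilin b c • b) := by abel
  rw [this]
  have h' : (-dotBilin a a • c + dotBilin a c • a + cross b (cross a c) +
      (cross a (cross b c) + (-dotBilin b b • c + dotBilin b c • b))) =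
      -(dotBilin a a + dotBilin a b + (dotBilin a b + dotBilin b b)) • c +
        (dotBilin a c + dotBilin b c) • (a + b) := by
    rw [← h]
  rw [h']
  module

theorem cross_self (a : Fin 7 → ℝ) : cross a a = 0 := by
  ext k; fin_cases k <;> simp [cross] <;> ring

theorem cross_cross_of_orthogonal {x y : Fin 7 → ℝ} (hx : dotBilin x x = 1)
    (hy : dotBilin x y = 0) : cross x (cross x y) = -y := by
  rw [cross_cross_self, hx, hy]; simp

theorem dotBilin_self_cross (x y : Fin 7 → ℝ) : dotBilin x (cross x y) = 0 := by
  rw [dotBilin_comm, ← dotBilin_cross_cyclic, cross_self]; simp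

theorem dotBilin_self_cross' (x y : Fin 7 → ℝ) : dotBilin y (cross x y) = 0 := by
  rw [dotBilin_comm, dotBilin_cross_cyclic, cross_self]; simp

theorem dotBilin_cross_cross (x y z : Fin 7 → ℝ) : dotBilin (cross y x) (cross y z) =
    dotBilin y y * dotBilin x z - dotBilin y z * dotBilin y x := by
  rw [dotBilin_cross_cyclic, dotBilin_cross_cyclic, cross_swap, cross_cross_self, dotBilin_comm x z]
  simp
  ring

end CrossProduct

/-! ### Transitivity on unit vectors -/

section Transitivity

/-- On the orthogonal complement of `a`, the operator `a × ·` may be moved between the arguments of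
the model form, so that `φ(a × ·, ·, ·)` is alternating there. -/
theorem dotBilin_cross_cross_left {a x y z : Fin 7 → ℝ} (hx : dotBilin a x = 0)
    (hy : dotBilin a y = 0) (hz : dotBilin a z = 0) :
    dotBilin (cross (cross a x) y) z = dotBilin (cross x (cross a y)) z := by
  have h := congrArg (fun w ↦ dotBilin w z) (cross_cross_add x a y)
  have h' := congrArg (fun w ↦ dotBilin w z) (cross_cross_add y a x)
  simp only [map_add, map_smul, LinearMap.add_apply, LinearMap.smul_apply, hx, hy, hz,
    dotBilin_comm x a, dotBilin_comm y a, smul_eq_mul] at h h'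
  rw [cross_swap (cross a x) y, map_neg, LinearMap.neg_apply]
  rw [cross_swap y x, map_neg, map_neg, LinearMap.neg_apply] at h'
  linarith

variable {a f1 f2 : Fin 7 → ℝ}

/-- The complex structure `a × ·` and the frame `f₁, f₂, f₁ × f₂` of the orthogonal complement of
the unit vector `a` identify the model form on that complement with `Re (dz₁ ∧ dz₂ ∧ dz₃)`. -/
theorem modelG2_frameMap (ha : dotBilin a a = 1) (h1 : dotBilin f1 f1 = 1)
    (h2 : dotBilin f2 f2 = 1) (h01 : dotBilin a f1 = 0) (h02 : dotBilin a f2 = 0)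
    (h12 : dotBilin f1 f2 = 0) (hJ12 : dotBilin (cross a f1) f2 = 0) :
    ∃ L : (Fin 3 → ℂ) →ₗ[ℝ] (Fin 7 → ℝ), (∀ z, dotBilin a (L z) = 0) ∧
      (∀ z w, modelG2 ![a, L z, L w] = stdOmega ![z, w]) ∧
      (∀ z w v, modelG2 ![L z, L w, L v] = (stdVol ![z, w, v]).re) ∧ Function.Injective L := by
  set f : Fin 3 → (Fin 7 → ℝ) := ![f1, f2, cross f1 f2] with hf
  set J := cross a with hJ
  have o0 (k) : dotBilin a (f k) = 0 := by
    fin_cases k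
    · exact h01
    · exact h02
    · change dotBilin a (cross f1 f2) = 0
      rw [dotBilin_comm, ← dotBilin_cross_cyclic]; exact hJ12
  have n3 : dotBilin (cross f1 f2) (cross f1 f2) = 1 := by
    rw [dotBilin_cross_cross, h1, h2, h12]; ring
  have skew (x y) : dotBilin (J x) y = -dotBilin (J y) x := by
    rw [hJ, dotBilin_cross_cyclic, dotBilin_cross_cyclic, cross_swap, map_neg, LinearMap.neg_apply]
  have iso (x y) (hy : dotBilin a y = 0) : dotBilin (J x) (J y) = dotBilin x y := by
    rw [hJ, dotBilin_cross_cross, ha, hy]; ring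
  have gJx (x) : dotBilin (J x) x = 0 := by linarith [skew x x]
  have hJJ (x) (hx : dotBilin a x = 0) : J (J x) = -x := cross_cross_of_orthogonal ha hx
  have hJ13 : dotBilin (J f1) (cross f1 f2) = 0 := by
    rw [hJ, cross_swap, map_neg, LinearMap.neg_apply, dotBilin_cross_cross, h12, h02]; ring
  have hJ23 : dotBilin (J f2) (cross f1 f2) = 0 := by
    rw [hJ, cross_swap, cross_swap f1, map_neg, map_neg, LinearMap.neg_apply, dotBilin_cross_cross,
      dotBilin_comm f2 f1, h12, h01]
    ring
  have o13 := dotBilin_self_cross f1 f2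
  have o23 := dotBilin_self_cross' f1 f2
  have g1 (k l) : dotBilin (f k) (f l) = if k = l then 1 else 0 := by
    fin_cases k <;> fin_cases l <;>
      simp [hf, h1, h2, n3, h12, o13, o23, dotBilin_comm f2 f1, dotBilin_comm (cross f1 f2)]
  have g2 (k l) : dotBilin (J (f k)) (f l) = 0 := by
    fin_cases k <;> fin_cases l <;>
      simp [hf, gJx, hJ12, hJ13, hJ23, skew f2 f1, skew (cross f1 f2)]
  have g3 (k l) : dotBilin (f k) (J (f l)) = 0 := by rw [dotBilin_comm, g2]
  have gJ (k l) : dotBilin (J (f k)) (J (f l)) = dotBilin (f k) (f l) := iso _ _ (o0 l)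
  set L := frameMap J f with hL
  have hLa (z) : dotBilin a (L z) = 0 := by
    have hperp (x) : dotBilin a (J x) = 0 := dotBilin_self_cross a x
    simp [hL, frameMap_apply, o0, hperp]
  have hLI (z) : L (mulI z) = J (L z) := frameMap_mulI J f (fun k ↦ hJJ _ (o0 k)) z
  have hdot (z w) : dotBilin (L z) (L w) = ∑ k, ((z k).re * (w k).re + (z k).im * (w k).im) := by
    conv_lhs => rw [hL, frameMap_apply]
    simp only [map_sum, map_add, map_smul, LinearMap.sum_apply, LinearMap.add_apply,
      LinearMap.smul_apply, smul_eq_mul]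
    refine Finset.sum_congr rfl fun k _ ↦ ?_
    rw [(pairing_frameMap dotBilin J f gJ g1 g2 g3 w k).1,
      (pairing_frameMap dotBilin J f gJ g1 g2 g3 w k).2]
  refine ⟨L, hLa, fun z w ↦ ?_, ?_, frameMap_injective dotBilin J f gJ g1 g2 g3⟩
  · rw [← dotBilin_cross, ← hJ, ← hLI, hdot, stdOmega_apply]
    refine Finset.sum_congr rfl fun k _ ↦ ?_
    simp [mulI_apply]
    ring
  -- The complex form `φ(x, y, z) - i φ(a × x, y, z)` is complex linear in `x` and alternating.
  let ψ : MultilinearMap ℝ (fun _ : Fin 3 ↦ (Fin 3 → ℂ)) ℂ :=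
    Complex.ofRealCLM.toLinearMap.compMultilinearMap (modelG2.compLinearMap L).toMultilinearMap -
      Complex.I • Complex.ofRealCLM.toLinearMap.compMultilinearMap
        (modelG2.toMultilinearMap.compLinearMap ![J ∘ₗ L, L, L])
  have hψ (z w v) : ψ ![z, w, v] =
      (dotBilin (cross (L z) (L w)) (L v) : ℂ) -
        Complex.I * (dotBilin (cross (J (L z)) (L w)) (L v) : ℂ) := by
    rw [dotBilin_cross, dotBilin_cross]
    have e1 : (modelG2.compLinearMap L) ![z, w, v] = modelG2 ![L z, L w, L v] :=
      compLinearMap_apply_three _ _ _ _ _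
    have e2 : (modelG2.toMultilinearMap.compLinearMap ![J ∘ₗ L, L, L]) ![z, w, v] =
        modelG2 ![J (L z), L w, L v] := by
      rw [MultilinearMap.compLinearMap_apply]
      change modelG2 _ = _
      congr 1; funext k; fin_cases k <;> rfl
    change ((modelG2.compLinearMap L) ![z, w, v] : ℂ) - Complex.I *
      ((modelG2.toMultilinearMap.compLinearMap ![J ∘ₗ L, L, L]) ![z, w, v] : ℂ) = _
    rw [e1, e2]
  have hvec (v : Fin 3 → Fin 3 → ℂ) : v = ![v 0, v 1, v 2] := by
    funext k; fin_cases k <;> rfl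
  have hrot (z w v) : dotBilin (cross (J (L z)) (L w)) (L v) =
      -dotBilin (cross (J (L w)) (L z)) (L v) := by
    rw [dotBilin_cross_cross_left (hLa z) (hLa w) (hLa v), cross_swap, map_neg,
      LinearMap.neg_apply]
  have z01 (z v) : ψ ![z, z, v] = 0 := by
    have h0 : dotBilin (cross (J (L z)) (L z)) (L v) = 0 := by linarith [hrot z z v]
    rw [hψ, h0, cross_self]; simp
  have z12 (z v) : ψ ![v, z, z] = 0 := by
    rw [hψ, dotBilin_comm, dotBilin_self_cross', dotBilin_comm, dotBilin_self_cross']; simp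
  have z02 (z v) : ψ ![z, v, z] = 0 := by
    have h0 : dotBilin (cross (J (L z)) (L v)) (L z) = 0 := by
      rw [hrot, dotBilin_comm, dotBilin_self_cross', neg_zero]
    rw [hψ, h0, dotBilin_comm, dotBilin_self_cross]; simp
  let Ψ : (Fin 3 → ℂ) [⋀^Fin 3]→ₗ[ℝ] ℂ :=
    { ψ with
      map_eq_zero_of_eq' := fun v i j hv hij ↦ by
        change ψ v = 0
        rw [hvec v]
        fin_cases i <;> fin_cases j
        · exact absurd rfl hij
        · have hv' : v 0 = v 1 := hv
          rw [hv', z01]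
        · have hv' : v 0 = v 2 := hv
          rw [hv', z02]
        · have hv' : v 1 = v 0 := hv
          rw [hv', z01]
        · exact absurd rfl hij
        · have hv' : v 1 = v 2 := hv
          rw [hv', z12]
        · have hv' : v 2 = v 0 := hv
          rw [hv', z02]
        · have hv' : v 2 = v 1 := hv
          rw [hv', z12]
        · exact absurd rfl hij }
  have hΨψ (v) : Ψ v = ψ v := rfl
  have hΨ := eq_smul_stdVol Ψ fun u v w ↦ by
    rw [hΨψ, hΨψ, hψ, hψ, hLI, hJJ _ (hLa u), map_neg, LinearMap.neg_apply, map_neg,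
      LinearMap.neg_apply]
    push_cast
    linear_combination (dotBilin (cross (J (L u)) (L v)) (L w) : ℂ) * Complex.I_sq
  have hLs (k) : L (Pi.single k 1) = f k := frameMap_single J f k
  -- the constant is `|f₁ × f₂|² - i ⟨f₁ × (a × f₂), f₁ × f₂⟩ = 1`
  have hc : Ψ ![Pi.single 0 1, Pi.single 1 1, Pi.single 2 1] = 1 := by
    rw [hΨψ, hψ, dotBilin_cross_cross_left (hLa _) (hLa _) (hLa _), hLs, hLs, hLs]
    have e1 : dotBilin (cross (f 0) (f 1)) (f 2) = 1 := n3
    have e2 : dotBilin (cross (f 0) (J (f 1))) (f 2) = 0 := by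
      change dotBilin (cross f1 (J f2)) (cross f1 f2) = 0
      rw [dotBilin_cross_cross, dotBilin_comm _ f2, (dotBilin_comm f2 (J f2)).trans (gJx f2), h12]
      ring
    rw [e1, e2]; simp
  rw [hc, one_smul] at hΨ
  intro z w v
  rw [← hΨ, hΨψ, hψ, dotBilin_cross]
  simp

/-- The automorphism group of the model `3`-form acts transitively on unit vectors. -/
theorem exists_modelG2_automorphism (ha : a ⬝ᵥ a = 1) : ∃ u : (Fin 7 → ℝ) ≃ₗ[ℝ] (Fin 7 → ℝ),
    modelG2 = modelG2.compLinearMap u.toLinearMap ∧ u a = Pi.single 0 1 := by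
  rw [← dotBilin_apply] at ha
  have hpos (v : Fin 7 → ℝ) (hv : v ≠ 0) : 0 < dotBilin v v := by
    rw [dotBilin_apply]
    simpa using Matrix.dotProduct_star_self_pos_iff.2 hv
  have hfin : Module.finrank ℝ (Fin 7 → ℝ) = 7 := by simp
  obtain ⟨f1, n1, o1⟩ := exists_unit_orthogonal dotBilin hpos ![a] (by omega)
  obtain ⟨f2, n2, o2⟩ := exists_unit_orthogonal dotBilin hpos ![a, f1, cross a f1] (by omega)
  obtain ⟨L, hLa, hL2, hL3, hinj⟩ := modelG2_frameMap ha n1 n2 (o1 0) (o2 0) (o2 1) (o2 2)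
  let G : (Fin 7 → ℝ) →ₗ[ℝ] (Fin 7 → ℝ) := (LinearMap.proj 0).smulRight a + L ∘ₗ toC3
  have hG (x) : G x = x 0 • a + L (toC3 x) := rfl
  have hGinj : Function.Injective G := by
    refine (injective_iff_map_eq_zero _).2 fun x hx ↦ ?_
    have h0 : x 0 = 0 := by
      have := congrArg (dotBilin a) hx
      simpa [hG, ha, hLa] using this
    have h1 : toC3 x = 0 := by
      apply hinj
      rw [map_zero, ← hx, hG, h0]; simp
    have e (k : Fin 3) := congrFun h1 k
    have e0 := e 0
    have e1 := e 1
    have e2 := e 2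
    simp [toC3, Complex.ext_iff] at e0 e1 e2
    ext k
    fin_cases k
    · exact h0
    · exact e0.1
    · exact e0.2
    · exact e1.1
    · exact e1.2
    · exact e2.1
    · exact e2.2
  -- both sides are `e⁰ ∧ ω₀ + Re Ω₀`, on the left in the decomposition `ℝ a ⊕ L(ℂ³)`
  have hmodel (x y z) : modelG2 ![G x, G y, G z] = modelG2 ![x, y, z] := by
    rw [modelG2_apply x y z, ← hL3, ← hL2, ← hL2, ← hL2]
    simp only [← dotBilin_cross, hG, map_add, map_smul, LinearMap.add_apply, LinearMap.smul_apply,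
      cross_self, smul_eq_mul]
    generalize L (toC3 x) = X
    generalize L (toC3 y) = Y
    generalize L (toC3 z) = Z
    have k1 (z) : dotBilin (cross a z) a = 0 := by rw [dotBilin_comm, dotBilin_self_cross]
    have k2 : dotBilin (cross X Y) a = dotBilin (cross a X) Y := by
      rw [dotBilin_cross_cyclic, dotBilin_cross_cyclic]
    rw [cross_swap X a]
    simp only [map_neg, LinearMap.neg_apply, map_zero, LinearMap.zero_apply, k1, k2]
    ring
  let u := (LinearEquiv.ofInjectiveEndo G hGinj).symm
  have hu (x) : G (u x) = x := (LinearEquiv.ofInjectiveEndo G hGinj).apply_symm_apply x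
  refine ⟨u, ?_, ?_⟩
  · ext v
    obtain ⟨x, y, z, rfl⟩ : ∃ a b d, v = ![a, b, d] :=
      ⟨v 0, v 1, v 2, by funext i; fin_cases i <;> rfl⟩
    have h := hmodel (u x) (u y) (u z)
    rw [hu, hu, hu] at h
    rw [compLinearMap_apply_three]
    exact h
  · apply hGinj
    rw [hu, hG]
    have : toC3 (Pi.single 0 1) = 0 := by
      ext k; fin_cases k <;> simp [toC3, Complex.ext_iff]
    rw [this]; simp

/-- A positive `3`-form has an adapted frame in which a given nonzero vector points along the first
axis. -/
theorem IsPositive.exists_frame {V : Type*} [AddCommGroup V] [Module ℝ V]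
    {φ : V [⋀^Fin 3]→ₗ[ℝ] ℝ} (hφ : IsPositive φ) {ξ : V} (hξ : ξ ≠ 0) :
    ∃ (u : V ≃ₗ[ℝ] (Fin 7 → ℝ)) (r : ℝ), 0 < r ∧ φ = modelG2.compLinearMap u.toLinearMap ∧
      u ξ = r • Pi.single 0 1 := by
  obtain ⟨u₀, rfl⟩ := hφ
  have hne : u₀ ξ ≠ 0 := by simpa using hξ
  have hp : 0 < u₀ ξ ⬝ᵥ u₀ ξ := by simpa using Matrix.dotProduct_star_self_pos_iff.2 hne
  set r := Real.sqrt (u₀ ξ ⬝ᵥ u₀ ξ) with hr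
  have hr0 : 0 < r := Real.sqrt_pos.2 hp
  have hrr : r * r = u₀ ξ ⬝ᵥ u₀ ξ := Real.mul_self_sqrt hp.le
  obtain ⟨u, hu, hua⟩ := exists_modelG2_automorphism (a := r⁻¹ • u₀ ξ) (by
    rw [smul_dotProduct, dotProduct_smul, ← hrr, smul_eq_mul, smul_eq_mul]
    field_simp)
  refine ⟨u₀.trans u, r, hr0, ?_, ?_⟩
  · conv_lhs => rw [hu]
    rfl
  · rw [← hua, map_smul, smul_smul, mul_inv_cancel₀ hr0.ne', one_smul]
    rfl

end Transitivity

/-! ### Reduction of a positive form along a vector -/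

section PointwiseReduction

variable {V : Type*} [AddCommGroup V] [Module ℝ V]

theorem toC3_single_zero : toC3 (Pi.single 0 1) = 0 := by
  ext k; fin_cases k <;> simp [toC3, Complex.ext_iff]

theorem stdOmega_comp_smul {W : Type*} [AddCommGroup W] [Module ℝ W] (s : ℝ)
    (f : W →ₗ[ℝ] (Fin 3 → ℂ)) : stdOmega.compLinearMap (s • f) =
      s ^ 2 • stdOmega.compLinearMap f := by
  ext v
  obtain ⟨a, b, rfl⟩ : ∃ a b, v = ![a, b] := ⟨v 0, v 1, by funext i; fin_cases i <;> rfl⟩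
  rw [AlternatingMap.smul_apply, compLinearMap_apply_two, compLinearMap_apply_two]
  simp [stdOmega_eq]
  ring

theorem stdVol_comp_smul {W : Type*} [AddCommGroup W] [Module ℝ W] (s : ℝ)
    (f : W →ₗ[ℝ] (Fin 3 → ℂ)) : stdVol.compLinearMap (s • f) =
      s ^ 3 • stdVol.compLinearMap f := by
  ext v
  obtain ⟨a, b, c, rfl⟩ : ∃ a b d, v = ![a, b, d] :=
    ⟨v 0, v 1, v 2, by funext i; fin_cases i <;> rfl⟩
  rw [AlternatingMap.smul_apply, compLinearMap_apply_three, compLinearMap_apply_three]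
  simp [stdVol_eq]
  ring

theorem rePart_smul {k : ℕ} (s : ℝ) (Ω₀ : V [⋀^Fin k]→ₗ[ℝ] ℂ) :
    rePart (s • Ω₀) = s • rePart Ω₀ := by
  ext v; simp [rePart]

theorem imPart_smul {k : ℕ} (s : ℝ) (Ω₀ : V [⋀^Fin k]→ₗ[ℝ] ℂ) :
    imPart (s • Ω₀) = s • imPart Ω₀ := by
  ext v; simp [imPart]

variable {φ : V [⋀^Fin 3]→ₗ[ℝ] ℝ} {u : V ≃ₗ[ℝ] (Fin 7 → ℝ)} {ξ : V} {r : ℝ}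

/-- The linear form `g_φ(ξ, ·)` in a frame in which `ξ` points along the first axis. -/
theorem metric_of_frame (hφ : φ = modelG2.compLinearMap u.toLinearMap)
    (hξ : u ξ = r • Pi.single 0 1) (e : Module.Basis (Fin 7) ℝ V) :
    metric φ e ξ = r • (LinearMap.proj 0 ∘ₗ u.toLinearMap) := by
  ext v
  rw [hφ, metric_model_comp, hξ]
  simp

/-- The `2`-form `ξ ⌟ φ` is a multiple of the Kähler form. -/
theorem curryLeft_of_frame (hφ : φ = modelG2.compLinearMap u.toLinearMap)
    (hξ : u ξ = r • Pi.single 0 1) :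
    φ.curryLeft ξ = r • stdOmega.compLinearMap (toC3 ∘ₗ u.toLinearMap) := by
  ext v
  obtain ⟨b, c, rfl⟩ : ∃ a b, v = ![a, b] := ⟨v 0, v 1, by funext i; fin_cases i <;> rfl⟩
  have h1 : φ.curryLeft ξ ![b, c] = φ ![ξ, b, c] := rfl
  have e1 : stdOmega ![0, toC3 (u c)] = 0 := by simp [stdOmega_eq]
  have e2 : stdOmega ![0, toC3 (u b)] = 0 := by simp [stdOmega_eq]
  have e3 : stdVol ![0, toC3 (u b), toC3 (u c)] = 0 := by simp [stdVol_eq]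
  rw [h1, hφ, compLinearMap_apply_three, modelG2_apply, AlternatingMap.smul_apply,
    compLinearMap_apply_two]
  simp only [LinearEquiv.coe_coe, hξ, map_smul, toC3_single_zero, smul_zero, e1, e2, e3,
    LinearMap.comp_apply]
  simp

/-- The horizontal part `φ - η ∧ (ξ ⌟ φ)` of `φ` is the real part of the complex volume form. -/
theorem sub_wedge_of_frame (hφ : φ = modelG2.compLinearMap u.toLinearMap)
    (hξ : u ξ = r • Pi.single 0 1) (hr : 0 < r) (e : Module.Basis (Fin 7) ℝ V) :
    φ - wedge (AlternatingMap.ofSubsingleton ℝ V ℝ (0 : Fin 1) ((metric φ e ξ ξ)⁻¹ • metric φ e ξ))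
      (φ.curryLeft ξ) = (rePart stdVol).compLinearMap (toC3 ∘ₗ u.toLinearMap) := by
  have h1 : metric φ e ξ ξ = r * r := by
    rw [metric_of_frame hφ hξ]; simp [hξ]
  have h2 : AlternatingMap.ofSubsingleton ℝ V ℝ (0 : Fin 1) ((metric φ e ξ ξ)⁻¹ • metric φ e ξ) =
      r⁻¹ • (AlternatingMap.ofSubsingleton ℝ (Fin 7 → ℝ) ℝ (0 : Fin 1)
        (LinearMap.proj 0)).compLinearMap u.toLinearMap := by
    rw [h1, metric_of_frame hφ hξ, smul_smul]
    have : (r * r)⁻¹ * r = r⁻¹ := by field_simp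
    rw [this]
    ext v
    simp
  rw [h2, curryLeft_of_frame hφ hξ, map_smul, map_smul, LinearMap.smul_apply, smul_smul,
    mul_inv_cancel₀ hr.ne', one_smul]
  have h3 : stdOmega.compLinearMap (toC3 ∘ₗ u.toLinearMap) =
    (stdOmega.compLinearMap toC3).compLinearMap u.toLinearMap := rfl
  rw [h3, wedge_compLinearMap, hφ, modelG2_eq]
  generalize wedge (AlternatingMap.ofSubsingleton ℝ (Fin 7 → ℝ) ℝ (0 : Fin 1) (LinearMap.proj 0))
    (stdOmega.compLinearMap toC3) = A
  ext v
  exact add_sub_cancel_left _ _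

/-- The `3`-form `ξ ⌟ *φ` is a negative multiple of the imaginary part of the complex volume form.
-/
theorem star_of_frame (hφ : φ = modelG2.compLinearMap u.toLinearMap)
    (hξ : u ξ = r • Pi.single 0 1) (e : Module.Basis (Fin 7) ℝ V) :
    (hodgeStar φ e φ).curryLeft ξ =
      -r • (imPart stdVol).compLinearMap (toC3 ∘ₗ u.toLinearMap) := by
  rw [hφ, hodgeStar_self_model_comp]
  ext v
  obtain ⟨a, b, c, rfl⟩ : ∃ a b d, v = ![a, b, d] :=
    ⟨v 0, v 1, v 2, by funext i; fin_cases i <;> rfl⟩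
  have h1 : (modelStar.compLinearMap u.toLinearMap).curryLeft ξ ![a, b, c] =
      modelStar.curryLeft (u ξ) ![u a, u b, u c] := by
    change modelStar _ = modelStar _
    congr 1
    funext i; fin_cases i <;> rfl
  have h2 : modelStar.curryLeft (Pi.single 0 1) ![u a, u b, u c] =
      -(stdVol ![toC3 (u a), toC3 (u b), toC3 (u c)]).im := modelStar_apply _ _ _
  rw [h1, hξ, map_smul, AlternatingMap.smul_apply, h2, AlternatingMap.smul_apply,
    compLinearMap_apply_three]
  simp only [smul_eq_mul, neg_mul, mul_neg]
  rfl

/-- In a frame adapted to `ξ`, all the reduced tensors of a positive form are pulled back from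
`ℂ³` by one linear map `√r · toC3 ∘ u`, with the powers of `h = r⁻²` as stated. -/
theorem reduction_of_frame (hφ : φ = modelG2.compLinearMap u.toLinearMap)
    (hξ : u ξ = r • Pi.single 0 1) (hr : 0 < r) (e : Module.Basis (Fin 7) ℝ V)
    {q : V →ₗ[ℝ] (Fin 3 → ℂ)} (hq : q = Real.sqrt r • (toC3 ∘ₗ u.toLinearMap)) :
    metric φ e ξ ξ = r ^ 2 ∧ φ.curryLeft ξ = stdOmega.compLinearMap q ∧
      (metric φ e ξ ξ)⁻¹ ^ (-3 / 4 : ℝ) •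
        (φ - wedge (AlternatingMap.ofSubsingleton ℝ V ℝ (0 : Fin 1)
          ((metric φ e ξ ξ)⁻¹ • metric φ e ξ)) (φ.curryLeft ξ)) = rePart (stdVol.compLinearMap q) ∧
      -(metric φ e ξ ξ)⁻¹ ^ (-1 / 4 : ℝ) • (hodgeStar φ e φ).curryLeft ξ =
        imPart (stdVol.compLinearMap q) := by
  have h1 : metric φ e ξ ξ = r ^ 2 := by
    rw [metric_of_frame hφ hξ]; simp [hξ, sq]
  have hs : Real.sqrt r = r ^ (1 / 2 : ℝ) := Real.sqrt_eq_rpow r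
  have hinv : (r ^ 2)⁻¹ = r ^ (-2 : ℝ) := by
    rw [Real.rpow_neg hr.le]; norm_num
  refine ⟨h1, ?_, ?_, ?_⟩
  · rw [curryLeft_of_frame hφ hξ, hq, stdOmega_comp_smul, Real.sq_sqrt hr.le]
  · rw [sub_wedge_of_frame hφ hξ hr, hq, stdVol_comp_smul, rePart_smul, h1, hinv, hs,
      ← Real.rpow_mul hr.le, ← Real.rpow_natCast, ← Real.rpow_mul hr.le]
    norm_num
    rfl
  · rw [star_of_frame hφ hξ, hq, stdVol_comp_smul, imPart_smul, h1, hinv, hs, smul_smul,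
      ← Real.rpow_mul hr.le, ← Real.rpow_natCast, ← Real.rpow_mul hr.le, neg_mul_neg,
      ← Real.rpow_add_one hr.ne']
    norm_num
    rfl

theorem toC3_surjective : Function.Surjective toC3 := fun z ↦
  ⟨![0, (z 0).re, (z 0).im, (z 1).re, (z 1).im, (z 2).re, (z 2).im], by
    ext k; fin_cases k <;> simp [toC3]⟩

theorem eq_smul_single_of_toC3_eq_zero {x : Fin 7 → ℝ} (h : toC3 x = 0) :
    x = x 0 • Pi.single 0 1 := by
  have e0 := congrFun h 0
  have e1 := congrFun h 1
  have e2 := congrFun h 2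
  simp [toC3, Complex.ext_iff] at e0 e1 e2
  ext k
  fin_cases k <;> simp [e0, e1, e2]

/-- The pointwise reduction of a positive form along a nonzero vector. -/
theorem IsPositive.exists_reduction (hφ : IsPositive φ) (hξ : ξ ≠ 0)
    (e : Module.Basis (Fin 7) ℝ V) : ∃ q : V →ₗ[ℝ] (Fin 3 → ℂ), Function.Surjective q ∧
      (∀ v, q v = 0 ↔ v ∈ Submodule.span ℝ {ξ}) ∧ 0 < metric φ e ξ ξ ∧
      φ.curryLeft ξ = stdOmega.compLinearMap q ∧
      (metric φ e ξ ξ)⁻¹ ^ (-3 / 4 : ℝ) •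
        (φ - wedge (AlternatingMap.ofSubsingleton ℝ V ℝ (0 : Fin 1)
          ((metric φ e ξ ξ)⁻¹ • metric φ e ξ)) (φ.curryLeft ξ)) = rePart (stdVol.compLinearMap q) ∧
      -(metric φ e ξ ξ)⁻¹ ^ (-1 / 4 : ℝ) • (hodgeStar φ e φ).curryLeft ξ =
        imPart (stdVol.compLinearMap q) := by
  obtain ⟨u, r, hr, hu, hur⟩ := hφ.exists_frame hξ
  obtain ⟨h1, h2, h3, h4⟩ := reduction_of_frame hu hur hr e rfl
  have hs : Real.sqrt r ≠ 0 := (Real.sqrt_pos.2 hr).ne'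
  refine ⟨_, fun z ↦ ?_, fun v ↦ ?_, h1 ▸ by positivity, h2, h3, h4⟩
  · obtain ⟨x, hx⟩ := toC3_surjective ((Real.sqrt r)⁻¹ • z)
    refine ⟨u.symm x, ?_⟩
    simp [hx, smul_smul, hs]
  · rw [Submodule.mem_span_singleton]
    constructor
    · intro h
      have h0 : toC3 (u v) = 0 := by simpa [hs] using h
      have h5 := eq_smul_single_of_toC3_eq_zero h0
      refine ⟨u v 0 / r, u.injective ?_⟩
      rw [map_smul, hur, smul_smul, div_mul_cancel₀ _ hr.ne', ← h5]
    · rintro ⟨c, rfl⟩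
      simp [hur, toC3_single_zero]

/-- The pointwise inverse of the reduction: `α ∧ q^* ω + s ^ (3/4) q^* Re Ω` is positive, and its
reduction returns the data it is built from. -/
theorem isPositive_reconstruct {α : V [⋀^Fin 1]→ₗ[ℝ] ℝ} {q : V →ₗ[ℝ] (Fin 3 → ℂ)} {s : ℝ}
    (hs : 0 < s) (hker : ∀ v, q v = 0 → v ∈ Submodule.span ℝ {ξ})
    (hqξ : q ξ = 0) (hα : α ![ξ] = 1) (e : Module.Basis (Fin 7) ℝ V)
    (hφ : φ = wedge α (stdOmega.compLinearMap q) +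
      s ^ (3 / 4 : ℝ) • rePart (stdVol.compLinearMap q)) :
    IsPositive φ ∧ (metric φ e ξ ξ)⁻¹ = s ∧
      AlternatingMap.ofSubsingleton ℝ V ℝ (0 : Fin 1) ((metric φ e ξ ξ)⁻¹ • metric φ e ξ) = α ∧
      φ.curryLeft ξ = stdOmega.compLinearMap q ∧
      (metric φ e ξ ξ)⁻¹ ^ (-3 / 4 : ℝ) •
        (φ - wedge (AlternatingMap.ofSubsingleton ℝ V ℝ (0 : Fin 1)
          ((metric φ e ξ ξ)⁻¹ • metric φ e ξ)) (φ.curryLeft ξ)) = rePart (stdVol.compLinearMap q) ∧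
      -(metric φ e ξ ξ)⁻¹ ^ (-1 / 4 : ℝ) • (hodgeStar φ e φ).curryLeft ξ =
        imPart (stdVol.compLinearMap q) := by
  have : Module.Finite ℝ V := Module.Finite.of_basis e
  obtain ⟨a, rfl⟩ := (AlternatingMap.ofSubsingleton ℝ V ℝ (0 : Fin 1)).surjective α
  have ha : a ξ = 1 := hα
  -- the adapted frame `(s^{-1/2} α, s^{1/4} q)`
  let z0 : (Fin 3 → ℂ) →ₗ[ℝ] (Fin 7 → ℝ) :=
    { toFun := fun z ↦ ![0, (z 0).re, (z 0).im, (z 1).re, (z 1).im, (z 2).re, (z 2).im]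
      map_add' := fun z w ↦ by ext k; fin_cases k <;> simp
      map_smul' := fun c z ↦ by ext k; fin_cases k <;> simp }
  have hz0 (z) : z0 z 0 = 0 := rfl
  have hz1 (z) : toC3 (z0 z) = z := by
    ext k; fin_cases k <;> simp [toC3, z0]
  let G : V →ₗ[ℝ] (Fin 7 → ℝ) :=
    s ^ (-1 / 2 : ℝ) • a.smulRight (Pi.single 0 1) + s ^ (1 / 4 : ℝ) • (z0 ∘ₗ q)
  have hG0 (v) : G v 0 = s ^ (-1 / 2 : ℝ) * a v := by
    simp [G, hz0]
  have hGC (v) : toC3 (G v) = s ^ (1 / 4 : ℝ) • q v := by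
    simp [G, toC3_single_zero, hz1]
  have hs4 : s ^ (1 / 4 : ℝ) ≠ 0 := (Real.rpow_pos_of_pos hs _).ne'
  have hs2 : s ^ (-1 / 2 : ℝ) ≠ 0 := (Real.rpow_pos_of_pos hs _).ne'
  have hinj : Function.Injective G := by
    refine (injective_iff_map_eq_zero _).2 fun v hv ↦ ?_
    have h1 := hGC v
    have h2 := hG0 v
    rw [hv, map_zero] at h1
    rw [hv] at h2
    have h3 : q v = 0 := (smul_eq_zero.1 h1.symm).resolve_left hs4
    obtain ⟨c, rfl⟩ := Submodule.mem_span_singleton.1 (hker v h3)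
    have h4 : a (c • ξ) = 0 := by simpa [hs2] using h2.symm
    rw [map_smul, ha] at h4
    have : c = 0 := by simpa using h4
    simp [this]
  let u : V ≃ₗ[ℝ] (Fin 7 → ℝ) := LinearEquiv.ofInjectiveOfFinrankEq G hinj (by
    rw [Module.finrank_eq_card_basis e]; simp)
  have hu (v) : u v = G v := rfl
  have huC : toC3 ∘ₗ u.toLinearMap = s ^ (1 / 4 : ℝ) • q := by
    ext1 v; exact hGC v
  have hφu : φ = modelG2.compLinearMap u.toLinearMap := by
    have e1 : modelG2.compLinearMap u.toLinearMap =
        (wedge (AlternatingMap.ofSubsingleton ℝ (Fin 7 → ℝ) ℝ (0 : Fin 1)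
          (LinearMap.proj 0)) (stdOmega.compLinearMap toC3)).compLinearMap u.toLinearMap +
          ((rePart stdVol).compLinearMap toC3).compLinearMap u.toLinearMap := by
      rw [modelG2_eq]
      generalize wedge (AlternatingMap.ofSubsingleton ℝ (Fin 7 → ℝ) ℝ (0 : Fin 1)
        (LinearMap.proj 0)) (stdOmega.compLinearMap toC3) = A
      rfl
    have e2 : (AlternatingMap.ofSubsingleton ℝ (Fin 7 → ℝ) ℝ (0 : Fin 1)
        (LinearMap.proj 0)).compLinearMap u.toLinearMap =
        s ^ (-1 / 2 : ℝ) • AlternatingMap.ofSubsingleton ℝ V ℝ (0 : Fin 1) a := by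
      ext v; exact hG0 (v 0)
    have e3 : (stdOmega.compLinearMap toC3).compLinearMap u.toLinearMap =
        s ^ (1 / 2 : ℝ) • stdOmega.compLinearMap q := by
      change stdOmega.compLinearMap (toC3 ∘ₗ u.toLinearMap) = _
      rw [huC, stdOmega_comp_smul, ← Real.rpow_natCast, ← Real.rpow_mul hs.le]
      norm_num
    have e4 : ((rePart stdVol).compLinearMap toC3).compLinearMap u.toLinearMap =
        s ^ (3 / 4 : ℝ) • rePart (stdVol.compLinearMap q) := by
      change rePart (stdVol.compLinearMap (toC3 ∘ₗ u.toLinearMap)) = _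
      rw [huC, stdVol_comp_smul, rePart_smul, ← Real.rpow_natCast, ← Real.rpow_mul hs.le]
      norm_num
    rw [e1, ← wedge_compLinearMap, e2, e3, e4, map_smul, map_smul, LinearMap.smul_apply,
      smul_smul, ← Real.rpow_add hs, hφ]
    norm_num
  have huξ : u ξ = s ^ (-1 / 2 : ℝ) • Pi.single 0 1 := by
    rw [hu]; simp [G, hqξ, ha]
  have hr := Real.rpow_pos_of_pos hs (-1 / 2)
  -- `√r = s ^ (-1/4)` for `r = s ^ (-1/2)`, so that `q` is the map of `reduction_of_frame`
  have hqq : q = Real.sqrt (s ^ (-1 / 2 : ℝ)) • (toC3 ∘ₗ u.toLinearMap) := by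
    rw [huC, Real.sqrt_eq_rpow, ← Real.rpow_mul hs.le, smul_smul, ← Real.rpow_add hs]
    norm_num
  obtain ⟨h1, h2, h3, h4⟩ := reduction_of_frame hφu huξ hr e hqq
  have h5 : (metric φ e ξ ξ)⁻¹ = s := by
    rw [h1, ← Real.rpow_natCast, ← Real.rpow_mul hs.le, ← Real.rpow_neg hs.le]
    norm_num
  refine ⟨⟨u, hφu⟩, h5, ?_, h2, h3, h4⟩
  congr 1
  rw [h5, metric_of_frame hφu huξ]
  ext v
  change s * (s ^ (-1 / 2 : ℝ) * G v 0) = a v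
  rw [hG0, ← mul_assoc, ← mul_assoc, mul_assoc s, ← Real.rpow_add hs]
  norm_num
  rw [Real.rpow_neg_one, mul_inv_cancel₀ hs.ne', one_mul]

end PointwiseReduction

/-! ### Smooth families of alternating forms -/

section SmoothFamilies

variable {E : Type*} [NormedAddCommGroup E] [NormedSpace ℝ E]
  {F : Type*} [NormedAddCommGroup F] [NormedSpace ℝ F] {k : ℕ}

/-- A family of alternating forms on a fixed vector space, parametrised by an open set, is smooth if
its values on constant vectors are. -/
def SmoothFamily {V : Type*} [AddCommGroup V] [Module ℝ V] (A : E → V [⋀^Fin k]→ₗ[ℝ] F)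
    (U : Set E) : Prop :=
  ∀ v : Fin k → V, ContDiffOn ℝ ∞ (fun y ↦ A y v) U

/-- Evaluation of a smooth family along a smooth map, on smoothly varying vectors. -/
theorem SmoothFamily.apply {n : ℕ} {A : E → EuclideanSpace ℝ (Fin n) [⋀^Fin k]→ₗ[ℝ] F}
    {U : Set E} (hA : SmoothFamily A U) {E' : Type*} [NormedAddCommGroup E'] [NormedSpace ℝ E']
    {U' : Set E'} {g : E' → E} (hg : ContDiffOn ℝ ∞ g U') (hgU : Set.MapsTo g U' U)
    {w : Fin k → E' → EuclideanSpace ℝ (Fin n)} (hw : ∀ i, ContDiffOn ℝ ∞ (w i) U') :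
    ContDiffOn ℝ ∞ (fun y ↦ A (g y) fun i ↦ w i y) U' := by
  -- expand all arguments in the standard basis
  set b := EuclideanSpace.basisFun (Fin n) ℝ
  have key (y : E') : A (g y) (fun i ↦ w i y) =
      ∑ r : Fin k → Fin n, (∏ i, w i y (r i)) • A (g y) (fun i ↦ b (r i)) := by
    have h1 : (fun i ↦ w i y) = fun i ↦ ∑ j, w i y j • b j := by
      funext i
      exact (b.sum_repr (w i y)).symm
    rw [h1]
    have h2 := (A (g y)).toMultilinearMap.map_sum (fun i j ↦ w i y j • b j)
    refine h2.trans (Finset.sum_congr rfl fun r _ ↦ ?_)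
    exact (A (g y)).toMultilinearMap.map_smul_univ _ _
  simp only [key]
  refine ContDiffOn.sum fun r _ ↦ ContDiffOn.smul ?_ ((hA _).comp hg hgU)
  refine contDiffOn_prod fun i _ ↦ ?_
  exact (EuclideanSpace.proj (𝕜 := ℝ) (r i) :
    EuclideanSpace ℝ (Fin n) →L[ℝ] ℝ).contDiff.comp_contDiffOn (hw i)

variable {V : Type*} [AddCommGroup V] [Module ℝ V] {U : Set E}

theorem SmoothFamily.wedge {p q : ℕ} {A : E → V [⋀^Fin p]→ₗ[ℝ] ℝ} {B : E → V [⋀^Fin q]→ₗ[ℝ] ℝ}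
    (hA : SmoothFamily A U) (hB : SmoothFamily B U) :
    SmoothFamily (fun y ↦ wedge (A y) (B y)) U := by
  intro v
  have hf : ((p.factorial * q.factorial : ℕ) : ℝ) ≠ 0 := by positivity
  have key (y : E) : CircleG2.wedge (A y) (B y) v = ((p.factorial * q.factorial : ℕ) : ℝ)⁻¹ *
      permSum (fun w ↦ A y (fun i ↦ w (Fin.castAdd q i)) * B y (fun i ↦ w (Fin.natAdd p i))) v := by
    rw [eq_inv_mul_iff_mul_eq₀ hf, ← wedge_apply_eq_permSum]
    push_cast; rfl
  simp only [key]
  refine contDiffOn_const.mul ?_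
  unfold permSum
  refine ContDiffOn.sum fun σ _ ↦ ?_
  exact contDiffOn_const.mul ((hA _).mul (hB _))

theorem SmoothFamily.of_rePart_imPart {A : E → V [⋀^Fin k]→ₗ[ℝ] ℂ}
    (hr : SmoothFamily (fun y ↦ CircleG2.rePart (A y)) U)
    (hi : SmoothFamily (fun y ↦ CircleG2.imPart (A y)) U) : SmoothFamily A U := by
  intro v
  have h := (Complex.ofRealCLM.contDiff.comp_contDiffOn (hr v)).add
    ((Complex.ofRealCLM.contDiff.comp_contDiffOn (hi v)).mul (contDiffOn_const (c := Complex.I)))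
  refine h.congr fun y _ ↦ ?_
  exact (Complex.re_add_im (A y v)).symm

end SmoothFamilies

/-! ### Forms along plots -/

section Plots

variable {n : ℕ} {M : Type*} [TopologicalSpace M] [ChartedSpace (EuclideanSpace ℝ (Fin n)) M]
  {E : Type*} [NormedAddCommGroup E] [NormedSpace ℝ E]
  {F : Type*} [NormedAddCommGroup F] [NormedSpace ℝ F] {k : ℕ}

/-- The pullback of a form along a map from a vector space. -/
def plotForm (α : DForm n M k F) (f : E → M) (y : E) :
    E [⋀^Fin k]→ₗ[ℝ] F :=
  (α (f y)).compLinearMap (mfderiv 𝓘(ℝ, E) (𝓡 n) f y).toLinearMap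

theorem isSmoothForm_iff {α : DForm n M k F} : IsSmoothForm α ↔ ∀ x₀ : M,
    SmoothFamily (plotForm α (extChartAt (𝓡 n) x₀).symm) (extChartAt (𝓡 n) x₀).target := Iff.rfl

theorem plotForm_comp (α : DForm n M k F)
    {E₁ : Type*} [NormedAddCommGroup E₁] [NormedSpace ℝ E₁] {c : E₁ → M} {g : E → E₁} {y : E}
    (hc : MDifferentiableAt 𝓘(ℝ, E₁) (𝓡 n) c (g y)) (hg : DifferentiableAt ℝ g y) :
    plotForm α (c ∘ g) y = (plotForm α c (g y)).compLinearMap (fderiv ℝ g y).toLinearMap := by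
  rw [plotForm, mfderiv_comp y hc hg.mdifferentiableAt, mfderiv_eq_fderiv]
  rfl

/-- The pullback at a point depends on the map only through its germ there. -/
theorem plotForm_congr (α : DForm n M k F)
    {f f' : E → M} {y : E} (h : f =ᶠ[nhds y] f') : plotForm α f y = plotForm α f' y := by
  have key (α' : M → EuclideanSpace ℝ (Fin n) [⋀^Fin k]→ₗ[ℝ] F) (p p' : M)
      (L L' : E →L[ℝ] EuclideanSpace ℝ (Fin n)) (hp : p = p') (hL : L = L') :
      (α' p).compLinearMap L.toLinearMap = (α' p').compLinearMap L'.toLinearMap := by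
    subst hp hL; rfl
  exact key α _ _ _ _ h.eq_of_nhds h.mfderiv_eq

variable [IsManifold (𝓡 n) ∞ M]

/-- A smooth form, tested by definition on charts, has smooth pullbacks along all smooth plots. -/
theorem IsSmoothForm.plot {α : DForm n M k F} (hα : IsSmoothForm α) {f : E → M} {U : Set E}
    (hU : IsOpen U) (hf : ContMDiffOn 𝓘(ℝ, E) (𝓡 n) ∞ f U) : SmoothFamily (plotForm α f) U := by
  intro v y₀ hy₀
  set c := extChartAt (𝓡 n) (f y₀) with hc
  have hcs : IsOpen c.source := isOpen_extChartAt_source _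
  set U' := U ∩ f ⁻¹' c.source with hU'
  have hU'o : IsOpen U' := hf.continuousOn.isOpen_inter_preimage hU hcs
  have hy₀' : y₀ ∈ U' := ⟨hy₀, mem_extChartAt_source _⟩
  have hg : ContDiffOn ℝ ∞ (c ∘ f) U' := by
    rw [← contMDiffOn_iff_contDiffOn]
    refine (contMDiffOn_extChartAt (I := 𝓡 n) (n := ∞) (x := f y₀)).comp
      (hf.mono Set.inter_subset_left) fun y hy ↦ ?_
    have := hy.2
    rwa [hc, extChartAt_source] at this
  have hgm : Set.MapsTo (c ∘ f) U' c.target := fun y hy ↦ c.map_source hy.2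
  have hdg : ContDiffOn ℝ ∞ (fderiv ℝ (c ∘ f)) U' := hg.fderiv_of_isOpen hU'o le_rfl
  have h := SmoothFamily.apply (isSmoothForm_iff.1 hα (f y₀)) hg hgm
    (w := fun i y ↦ fderiv ℝ (c ∘ f) y (v i)) fun i ↦ hdg.clm_apply contDiffOn_const
  have heq : Set.EqOn (fun y ↦ plotForm α f y v)
      (fun y ↦ plotForm α c.symm ((c ∘ f) y) fun i ↦ fderiv ℝ (c ∘ f) y (v i)) U' := by
    intro y hy
    -- `f` factors locally through the chart `c`, with differentiable coordinate expression
    have hfy : f =ᶠ[nhds y] c.symm ∘ (c ∘ f) := by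
      filter_upwards [hU'o.mem_nhds hy] with z hz
      exact (c.left_inv hz.2).symm
    beta_reduce
    rw [plotForm_congr α hfy, plotForm_comp α
      (((contMDiffOn_extChartAt_symm (I := 𝓡 n) (n := ∞) (f y₀)).mdifferentiableOn
          (by simp)).mdifferentiableAt ((isOpen_extChartAt_target _).mem_nhds (hgm hy)))
      ((hg.differentiableOn (by simp)).differentiableAt (hU'o.mem_nhds hy))]
    rfl
  have h' : ContDiffOn ℝ ∞ (fun y ↦ plotForm α f y v) U' := h.congr heq
  exact ((h' y₀ hy₀').contDiffAt (hU'o.mem_nhds hy₀')).contDiffWithinAt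

end Plots

/-! ### Forms in charts -/

section ChartPlots

variable {n : ℕ} {M : Type*} [TopologicalSpace M] [ChartedSpace (EuclideanSpace ℝ (Fin n)) M]

variable [IsManifold (𝓡 n) ∞ M] in
/-- The differential of the inverse of a chart is a linear isomorphism. -/
theorem exists_chartEquiv {x₀ : M} {y : EuclideanSpace ℝ (Fin n)}
    (hy : y ∈ (extChartAt (𝓡 n) x₀).target) :
    ∃ L : EuclideanSpace ℝ (Fin n) ≃ₗ[ℝ] EuclideanSpace ℝ (Fin n), L.toLinearMap =
      (mfderiv 𝓘(ℝ, EuclideanSpace ℝ (Fin n)) (𝓡 n) (extChartAt (𝓡 n) x₀).symm y).toLinearMap := by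
  obtain ⟨L, hL⟩ := isInvertible_mfderivWithin_extChartAt_symm (I := 𝓡 n) hy
  rw [ModelWithCorners.range_eq_univ, mfderivWithin_univ] at hL
  exact ⟨L.toLinearEquiv, by rw [← hL]; rfl⟩

variable [IsManifold (𝓡 n) ∞ M] in
theorem mdifferentiableAt_chart_symm {x₀ : M} {y : EuclideanSpace ℝ (Fin n)}
    (hy : y ∈ (extChartAt (𝓡 n) x₀).target) : MDifferentiableAt
      𝓘(ℝ, EuclideanSpace ℝ (Fin n)) (𝓡 n) (extChartAt (𝓡 n) x₀).symm y :=
  ((contMDiffOn_extChartAt_symm (I := 𝓡 n) (n := ∞) x₀).mdifferentiableOn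
    (by simp)).mdifferentiableAt ((isOpen_extChartAt_target _).mem_nhds hy)

variable [IsManifold (𝓡 n) ∞ M] in
/-- Forms are determined by their expressions in charts. -/
theorem DForm.ext_chart {k : ℕ} {F : Type*} [NormedAddCommGroup F] [NormedSpace ℝ F]
    {α β : DForm n M k F}
    (h : ∀ (x₀ : M), ∀ y ∈ (extChartAt (𝓡 n) x₀).target,
      plotForm α (extChartAt (𝓡 n) x₀).symm y = plotForm β (extChartAt (𝓡 n) x₀).symm y) :
    α = β := by
  funext x
  have hy := mem_extChartAt_target (I := 𝓡 n) x
  have key (p : M) (hp : p = x) (hαβ : α p = β p) : α x = β x := by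
    subst hp; exact hαβ
  refine key _ (extChartAt_to_inv (I := 𝓡 n) x) ?_
  obtain ⟨L, hL⟩ := exists_chartEquiv hy
  have h1 := h x _ hy
  simp only [plotForm, ← hL] at h1
  exact AlternatingMap.compLinearMap_injective L.toLinearMap L.surjective h1

theorem pullback_comp {n₁ n₂ : ℕ} {M₁ M₂ : Type*} [TopologicalSpace M₁]
    [ChartedSpace (EuclideanSpace ℝ (Fin n₁)) M₁] [TopologicalSpace M₂]
    [ChartedSpace (EuclideanSpace ℝ (Fin n₂)) M₂] {k : ℕ} {F : Type*} [AddCommGroup F]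
    [Module ℝ F] (α : DForm n₂ M₂ k F) {g : M₁ → M₂} {f : M → M₁}
    (hg : MDifferentiable (𝓡 n₁) (𝓡 n₂) g) (hf : MDifferentiable (𝓡 n) (𝓡 n₁) f) :
    pullback (m := n) (g ∘ f) α = pullback (m := n) f (pullback (m := n₁) g α) := by
  funext x
  rw [pullback, mfderiv_comp x (hg _) (hf x)]
  rfl

theorem plotForm_pullback {n₁ : ℕ} {M₁ : Type*} [TopologicalSpace M₁]
    [ChartedSpace (EuclideanSpace ℝ (Fin n₁)) M₁] {k : ℕ} {F : Type*} [NormedAddCommGroup F]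
    [NormedSpace ℝ F] {E : Type*} [NormedAddCommGroup E] [NormedSpace ℝ E] (α : DForm n₁ M₁ k F)
    {g : M → M₁} {f : E → M} {y : E} (hg : MDifferentiableAt (𝓡 n) (𝓡 n₁) g (f y))
    (hf : MDifferentiableAt 𝓘(ℝ, E) (𝓡 n) f y) :
    plotForm (pullback (m := n) g α) f y = plotForm α (g ∘ f) y := by
  rw [plotForm, plotForm, mfderiv_comp y hg hf]
  rfl

end ChartPlots

/-! ### The flow of the circle action -/

section Flow

variable {M : Type*} [TopologicalSpace M] [ChartedSpace (EuclideanSpace ℝ (Fin 7)) M]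
  [MulAction Circle M] [ContMDiffSMul (𝓡 1) (𝓡 7) ∞ Circle M]

theorem contMDiff_smul_circle (z : Circle) : ContMDiff (𝓡 7) (𝓡 7) ∞ (fun y : M ↦ z • y) :=
  (contMDiff_smul (I := 𝓡 1) (I' := 𝓡 7) (n := ∞) (G := Circle) (M := M)).comp
    (contMDiff_const.prodMk contMDiff_id)

theorem mdifferentiable_smul_circle (z : Circle) :
    MDifferentiable (𝓡 7) (𝓡 7) (fun y : M ↦ z • y) :=
  (contMDiff_smul_circle z).mdifferentiable (by simp)

variable {E : Type*} [NormedAddCommGroup E] [NormedSpace ℝ E]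

/-- The map `(t, y) ↦ exp(it) • f(y)`. -/
def flowPlot (f : E → M) (p : ℝ × E) : M := Circle.exp p.1 • f p.2

theorem contMDiffOn_flowPlot {f : E → M} {U : Set E} (hf : ContMDiffOn 𝓘(ℝ, E) (𝓡 7) ∞ f U) :
    ContMDiffOn 𝓘(ℝ, ℝ × E) (𝓡 7) ∞ (flowPlot f) (Set.univ ×ˢ U) := by
  have h1 : ContMDiffOn 𝓘(ℝ, ℝ × E) (𝓡 1) ∞ (fun p : ℝ × E ↦ Circle.exp p.1) (Set.univ ×ˢ U) :=
    (contMDiff_circleExp.comp contDiff_fst.contMDiff).contMDiffOn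
  have h2 : ContMDiffOn 𝓘(ℝ, ℝ × E) (𝓡 7) ∞ (fun p : ℝ × E ↦ f p.2) (Set.univ ×ˢ U) :=
    hf.comp contDiff_snd.contMDiff.contMDiffOn fun p hp ↦ hp.2
  exact (contMDiff_smul (I := 𝓡 1) (I' := 𝓡 7) (n := ∞) (G := Circle) (M := M)).comp_contMDiffOn
    (h1.prodMk h2)

theorem contMDiff_orbit (x : M) : ContMDiff 𝓘(ℝ, ℝ) (𝓡 7) ∞ (fun t : ℝ ↦ Circle.exp t • x) :=
  (contMDiff_smul (I := 𝓡 1) (I' := 𝓡 7) (n := ∞) (G := Circle) (M := M)).comp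
    (contMDiff_circleExp.prodMk contMDiff_const)

/-- The generating field is invariant, since the circle is commutative. -/
theorem mfderiv_smul_fundField (z : Circle) (x : M) :
    mfderiv (𝓡 7) (𝓡 7) (fun y : M ↦ z • y) x (fundField x) = fundField (z • x) := by
  have h1 : (fun t : ℝ ↦ Circle.exp t • (z • x)) = (fun y : M ↦ z • y) ∘
      (fun t : ℝ ↦ Circle.exp t • x) := by
    funext t; exact smul_comm _ _ _
  have h2 := mfderiv_comp (I := 𝓘(ℝ, ℝ)) (I' := 𝓡 7) (I'' := 𝓡 7) (0 : ℝ)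
    (mdifferentiable_smul_circle z _) ((contMDiff_orbit x).mdifferentiable (by simp) 0)
  have key (p : M) (hp : p = x) : (mfderiv (𝓡 7) (𝓡 7) (fun y : M ↦ z • y) p :
      EuclideanSpace ℝ (Fin 7) →L[ℝ] EuclideanSpace ℝ (Fin 7)) =
      mfderiv (𝓡 7) (𝓡 7) (fun y : M ↦ z • y) x := by subst hp; rfl
  have h3 := key (Circle.exp (0 : ℝ) • x) (by simp)
  have h4 : (fundField (z • x) : EuclideanSpace ℝ (Fin 7)) =
      (mfderiv 𝓘(ℝ, ℝ) (𝓡 7) ((fun y : M ↦ z • y) ∘ (fun t : ℝ ↦ Circle.exp t • x)) 0 :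
        ℝ →L[ℝ] EuclideanSpace ℝ (Fin 7)) 1 := by
    rw [← h1]; rfl
  refine Eq.trans ?_ h4.symm
  refine Eq.trans ?_ (congrArg (fun L : ℝ →L[ℝ] EuclideanSpace ℝ (Fin 7) ↦ L 1) h2).symm
  exact congrArg (fun L : EuclideanSpace ℝ (Fin 7) →L[ℝ] EuclideanSpace ℝ (Fin 7) ↦
    L (fundField x)) h3.symm

variable [IsManifold (𝓡 7) ∞ M] in
/-- The generating field of a free action has no zeros: at a zero, the orbit map would be locally
constant. -/
theorem fundField_ne_zero (hfree : ∀ (z : Circle) (x : M), z • x = x → z = 1) (x : M) :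
    fundField x ≠ 0 := by
  intro hx
  set γ : ℝ → M := fun t ↦ Circle.exp t • x with hγ
  have hsm : ContMDiff 𝓘(ℝ, ℝ) (𝓡 7) ∞ γ := contMDiff_orbit x
  -- by the group property the orbit map has derivative zero at all times
  have hzero (s : ℝ) : (mfderiv 𝓘(ℝ, ℝ) (𝓡 7) γ s : ℝ →L[ℝ] EuclideanSpace ℝ (Fin 7)) = 0 := by
    have h1 : γ = ((fun y : M ↦ Circle.exp s • y) ∘ γ) ∘ (fun t ↦ t - s) := by
      funext t
      simp only [hγ, Function.comp_apply]
      rw [smul_smul, ← Circle.exp_add]; congr 2; ring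
    have hs : s - s = 0 := sub_self s
    have h0 : (mfderiv 𝓘(ℝ, ℝ) (𝓡 7) γ 0 : ℝ →L[ℝ] EuclideanSpace ℝ (Fin 7)) = 0 :=
      ContinuousLinearMap.ext_ring hx
    have h0' : (mfderiv 𝓘(ℝ, ℝ) (𝓡 7) γ (s - s) : ℝ →L[ℝ] EuclideanSpace ℝ (Fin 7)) = 0 := by
      rw [hs]; exact h0
    have h2 := mfderiv_comp (I := 𝓘(ℝ, ℝ)) (I' := 𝓘(ℝ, ℝ)) (I'' := 𝓡 7) s
      (g := (fun y : M ↦ Circle.exp s • y) ∘ γ) (f := fun t ↦ t - s)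
      (((mdifferentiable_smul_circle _).comp (hsm.mdifferentiable (by simp))) _)
      (by exact (differentiable_id.sub_const s).differentiableAt.mdifferentiableAt)
    rw [← h1] at h2
    have h3 := mfderiv_comp (I := 𝓘(ℝ, ℝ)) (I' := 𝓡 7) (I'' := 𝓡 7) (s - s)
      (mdifferentiable_smul_circle (Circle.exp s) _) (hsm.mdifferentiable (by simp) (s - s))
    refine h2.trans ?_
    rw [h3]
    ext
    have h5 : (mfderiv 𝓘(ℝ, ℝ) (𝓡 7) γ (s - s) : ℝ →L[ℝ] EuclideanSpace ℝ (Fin 7))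
      (mfderiv 𝓘(ℝ, ℝ) 𝓘(ℝ, ℝ) (fun t ↦ t - s) s (1 : ℝ)) = 0 := by
      rw [h0']; rfl
    have h6 := congrArg (mfderiv (𝓡 7) (𝓡 7) (fun y : M ↦ Circle.exp s • y) (γ (s - s)) :
      EuclideanSpace ℝ (Fin 7) →L[ℝ] EuclideanSpace ℝ (Fin 7)) h5
    rw [map_zero] at h6
    exact h6
  set c := extChartAt (𝓡 7) (γ 0) with hc
  have hopen : IsOpen (γ ⁻¹' c.source) := (isOpen_extChartAt_source _).preimage hsm.continuous
  obtain ⟨ε, hε, hball⟩ := Metric.isOpen_iff.1 hopen 0 (mem_extChartAt_source _)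
  have hd (t : ℝ) (ht : t ∈ Metric.ball (0 : ℝ) ε) : HasFDerivAt (c ∘ γ) (0 : ℝ →L[ℝ] _) t := by
    have hsrc : γ t ∈ (chartAt (EuclideanSpace ℝ (Fin 7)) (γ 0)).source := by
      have := hball ht
      rwa [Set.mem_preimage, hc, extChartAt_source] at this
    have h1 : HasMFDerivAt 𝓘(ℝ, ℝ) 𝓘(ℝ, EuclideanSpace ℝ (Fin 7)) (c ∘ γ) t _ :=
      (mdifferentiableAt_extChartAt (I := 𝓡 7) hsrc).hasMFDerivAt.comp t
        (hsm.mdifferentiable (by simp) t).hasMFDerivAt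
    have h2 := h1.hasFDerivAt
    refine h2.congr_fderiv ?_
    ext
    have h5 : (mfderiv 𝓘(ℝ, ℝ) (𝓡 7) γ t : ℝ →L[ℝ] EuclideanSpace ℝ (Fin 7)) 1 = 0 := by
      rw [hzero]; rfl
    have h6 := congrArg (mfderiv (𝓡 7) 𝓘(ℝ, EuclideanSpace ℝ (Fin 7)) c (γ t) :
        EuclideanSpace ℝ (Fin 7) →L[ℝ] EuclideanSpace ℝ (Fin 7)) h5
    rw [map_zero] at h6
    exact h6
  set t := min (ε / 2) 1 with ht
  have ht0 : 0 < t := lt_min (by positivity) one_pos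
  have ht1 : t ≤ 1 := min_le_right _ _
  have htε : t < ε := (min_le_left _ _).trans_lt (by linarith)
  have hmem : t ∈ Metric.ball (0 : ℝ) ε := by
    rw [Metric.mem_ball, dist_zero_right, Real.norm_eq_abs, abs_of_pos ht0]; exact htε
  have hmem0 : (0 : ℝ) ∈ Metric.ball (0 : ℝ) ε := Metric.mem_ball_self hε
  have hconst : (c ∘ γ) t = (c ∘ γ) 0 :=
    Metric.isOpen_ball.is_const_of_fderiv_eq_zero (𝕜 := ℝ)
      (convex_ball (0 : ℝ) ε).isPreconnected
      (fun s hs ↦ (hd s hs).differentiableAt.differentiableWithinAt)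
      (fun s hs ↦ (hd s hs).fderiv) hmem hmem0
  -- so the orbit map is constant near `0`, and a group element other than `1` fixes `x`
  have hγt : γ t = γ 0 := c.injOn (hball hmem) (hball hmem0) hconst
  have hfix : Circle.exp t • x = x := by
    simpa [hγ] using hγt
  have h1 := hfree _ _ hfix
  have h2 : Circle.exp t = Circle.exp 0 := by rw [h1, Circle.exp_zero]
  have hpi := Real.pi_gt_three
  have := Circle.exp_injOn_Icc (a := 0) (b := 1) (by linarith) ⟨ht0.le, ht1⟩
    ⟨le_rfl, zero_le_one⟩ h2
  exact ht0.ne' this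

end Flow

/-! ### Invariant forms -/

section Invariance

variable {M : Type*} [TopologicalSpace M] [ChartedSpace (EuclideanSpace ℝ (Fin 7)) M]
  [MulAction Circle M] {k : ℕ}

theorem lieDeriv_eq_zero_of_invariant {α : DForm 7 M k ℝ}
    (h : ∀ z : Circle, pullback (m := 7) (fun y : M ↦ z • y) α = α) (x : M)
    (v : Fin k → TangentSpace (𝓡 7) x) : lieDeriv α x v = 0 := by
  simp [lieDeriv, h]

variable [ContMDiffSMul (𝓡 1) (𝓡 7) ∞ Circle M]

theorem pullback_smul_mul (α : DForm 7 M k ℝ) (z z' : Circle) :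
    pullback (m := 7) (fun y : M ↦ (z * z') • y) α =
      pullback (m := 7) (fun y : M ↦ z' • y) (pullback (m := 7) (fun y : M ↦ z • y) α) := by
  rw [← pullback_comp α (mdifferentiable_smul_circle z) (mdifferentiable_smul_circle z')]
  congr 1
  funext y
  exact mul_smul _ _ _

/-- A group element acts on tangent spaces by linear isomorphisms. -/
theorem exists_smulEquiv (z : Circle) (x : M) :
    ∃ L : EuclideanSpace ℝ (Fin 7) ≃ₗ[ℝ] EuclideanSpace ℝ (Fin 7), L.toLinearMap =
      (mfderiv (𝓡 7) (𝓡 7) (fun y : M ↦ z • y) x).toLinearMap := by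
  have h1 := mfderiv_comp (I := 𝓡 7) (I' := 𝓡 7) (I'' := 𝓡 7) x
    (mdifferentiable_smul_circle z⁻¹ _) (mdifferentiable_smul_circle z x)
  have h2 : (fun y : M ↦ z⁻¹ • y) ∘ (fun y : M ↦ z • y) = id := by funext y; simp
  rw [h2, mfderiv_id] at h1
  have hinj : Function.Injective (mfderiv (𝓡 7) (𝓡 7) (fun y : M ↦ z • y) x :
      EuclideanSpace ℝ (Fin 7) →L[ℝ] EuclideanSpace ℝ (Fin 7)).toLinearMap := by
    refine Function.LeftInverse.injective (g := (mfderiv (𝓡 7) (𝓡 7) (fun y : M ↦ z⁻¹ • y) (z • x) :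
      EuclideanSpace ℝ (Fin 7) →L[ℝ] EuclideanSpace ℝ (Fin 7))) fun v ↦ ?_
    exact (congrArg (fun L : EuclideanSpace ℝ (Fin 7) →L[ℝ] EuclideanSpace ℝ (Fin 7) ↦ L v)
      h1).symm
  exact ⟨LinearEquiv.ofInjectiveEndo _ hinj, rfl⟩

variable [IsManifold (𝓡 7) ∞ M]

/-- A form with vanishing Lie derivative is invariant: `t ↦ exp(it)^* α` has zero derivative at
every time, by the group property of the flow. -/
theorem invariant_of_lieDeriv_eq_zero {α : DForm 7 M k ℝ} (hα : IsSmoothForm α)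
    (h : ∀ x v, lieDeriv α x v = 0) (z : Circle) : pullback (m := 7) (fun y : M ↦ z • y) α = α := by
  refine DForm.ext_chart fun x₀ y hy ↦ ?_
  obtain ⟨t, rfl⟩ := Circle.exp_surjective z
  ext w
  set f := (extChartAt (𝓡 7) x₀).symm with hf
  set S := (extChartAt (𝓡 7) x₀).target with hS
  have hSo : IsOpen S := isOpen_extChartAt_target _
  have hfd : MDifferentiableAt 𝓘(ℝ, EuclideanSpace ℝ (Fin 7)) (𝓡 7) f y :=
    mdifferentiableAt_chart_symm hy
  set G : ℝ → ℝ := fun t ↦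
    plotForm (pullback (m := 7) (fun y : M ↦ Circle.exp t • y) α) f y w with hG
  have hFs := contMDiffOn_flowPlot (contMDiffOn_extChartAt_symm (I := 𝓡 7) (n := ∞) x₀)
  have hsm := hα.plot (isOpen_univ.prod hSo) hFs
  have hGeq (t : ℝ) : G t = plotForm α (flowPlot f) (t, y) (fun i ↦ (0, w i)) := by
    rw [hG]
    beta_reduce
    rw [plotForm_pullback α (mdifferentiable_smul_circle _ _) hfd]
    have h1 : (fun y : M ↦ Circle.exp t • y) ∘ f = flowPlot f ∘ fun z ↦ (t, z) := rfl
    have hd : HasFDerivAt (fun z : EuclideanSpace ℝ (Fin 7) ↦ (t, z))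
        (ContinuousLinearMap.inr ℝ ℝ (EuclideanSpace ℝ (Fin 7))) y := hasFDerivAt_prodMk_right t y
    rw [h1, plotForm_comp α ((hFs.mdifferentiableOn (by simp)).mdifferentiableAt
      ((isOpen_univ.prod hSo).mem_nhds ⟨Set.mem_univ _, hy⟩)) hd.differentiableAt, hd.fderiv]
    rfl
  have hGd : Differentiable ℝ G := by
    have h2 : ContDiff ℝ ∞ G := by
      rw [← contDiffOn_univ]
      refine ((hsm fun i ↦ (0, w i)).comp (f := fun t : ℝ ↦ (t, y)) (s := Set.univ)
        (by fun_prop) fun t _ ↦ ⟨Set.mem_univ _, hy⟩).congr fun t _ ↦ hGeq t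
    exact h2.differentiable (by simp)
  -- the derivative at time `s` is the Lie derivative at time `0`, transported by `exp(is)`
  have hG0 (s : ℝ) : deriv G s = 0 := by
    have h3 := deriv_comp_const_add G s 0
    rw [add_zero] at h3
    rw [← h3]
    have h4 : (fun t ↦ G (s + t)) = fun t ↦ pullback (m := 7) (fun y : M ↦ Circle.exp t • y) α
        (Circle.exp s • f y) fun i ↦ mfderiv (𝓡 7) (𝓡 7) (fun y : M ↦ Circle.exp s • y) (f y)
          (mfderiv 𝓘(ℝ, EuclideanSpace ℝ (Fin 7)) (𝓡 7) f y (w i)) := by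
      funext t
      simp only [hG]
      rw [add_comm, Circle.exp_add, pullback_smul_mul]
      rfl
    rw [h4]
    exact h _ _
  have hc := is_const_of_deriv_eq_zero hGd hG0 t 0
  have h5 : G 0 = plotForm α f y w := by
    have h6 : pullback (m := 7) (fun y : M ↦ Circle.exp 0 • y) α = α := by
      have h7 : (fun y : M ↦ Circle.exp 0 • y) = id := by funext y; simp
      rw [h7]
      funext x
      rw [pullback, mfderiv_id]
      ext v; rfl
    simp only [hG, h6]
  rw [← h5]
  exact hc

/-- The generating vector field has smooth coordinates in charts. -/
theorem exists_coordField (x₀ : M) :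
    ∃ X : EuclideanSpace ℝ (Fin 7) → EuclideanSpace ℝ (Fin 7),
      ContDiffOn ℝ ∞ X (extChartAt (𝓡 7) x₀).target ∧
      ∀ y ∈ (extChartAt (𝓡 7) x₀).target,
        mfderiv 𝓘(ℝ, EuclideanSpace ℝ (Fin 7)) (𝓡 7) (extChartAt (𝓡 7) x₀).symm y (X y) =
          fundField ((extChartAt (𝓡 7) x₀).symm y) := by
  set c := extChartAt (𝓡 7) x₀ with hc
  have hSo : IsOpen c.target := isOpen_extChartAt_target _
  have hFs := contMDiffOn_flowPlot (contMDiffOn_extChartAt_symm (I := 𝓡 7) (n := ∞) x₀)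
  have hpo : IsOpen ((Set.univ : Set ℝ) ×ˢ c.target) := isOpen_univ.prod hSo
  set O := ((Set.univ : Set ℝ) ×ˢ c.target) ∩ flowPlot c.symm ⁻¹' c.source with hO
  have hOo : IsOpen O := hFs.continuousOn.isOpen_inter_preimage hpo (isOpen_extChartAt_source _)
  set H : ℝ × EuclideanSpace ℝ (Fin 7) → EuclideanSpace ℝ (Fin 7) := c ∘ flowPlot c.symm with hH
  have hHs : ContDiffOn ℝ ∞ H O := by
    rw [← contMDiffOn_iff_contDiffOn]
    refine (contMDiffOn_extChartAt (I := 𝓡 7) (n := ∞) (x := x₀)).comp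
      (hFs.mono Set.inter_subset_left) fun p hp ↦ ?_
    have := hp.2
    rwa [hc, extChartAt_source] at this
  have hmem (y) (hy : y ∈ c.target) : ((0 : ℝ), y) ∈ O := by
    refine ⟨⟨Set.mem_univ _, hy⟩, ?_⟩
    change Circle.exp 0 • c.symm y ∈ c.source
    rw [Circle.exp_zero, one_smul]
    exact c.map_target hy
  -- the coordinates of the field are the time derivative of the flow in the chart
  refine ⟨fun y ↦ fderiv ℝ H (0, y) (1, 0), ?_, fun y hy ↦ ?_⟩
  · have h1 : ContDiffOn ℝ ∞ (fderiv ℝ H) O := hHs.fderiv_of_isOpen hOo le_rfl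
    have h2 : ContDiffOn ℝ ∞ (fun y ↦ fderiv ℝ H ((0 : ℝ), y)) c.target :=
      h1.comp (f := fun y : EuclideanSpace ℝ (Fin 7) ↦ ((0 : ℝ), y)) (by fun_prop) hmem
    exact h2.clm_apply contDiffOn_const
  · have hd : HasFDerivAt (fun t : ℝ ↦ (t, y))
        (ContinuousLinearMap.inl ℝ ℝ (EuclideanSpace ℝ (Fin 7))) 0 := hasFDerivAt_prodMk_left 0 y
    have hHd : DifferentiableAt ℝ H (0, y) :=
      (hHs.differentiableOn (by simp)).differentiableAt (hOo.mem_nhds (hmem y hy))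
    have hHy : H (0, y) = y := by
      change c (Circle.exp 0 • c.symm y) = y
      rw [Circle.exp_zero, one_smul, c.right_inv hy]
    have hK : HasFDerivAt (H ∘ fun t : ℝ ↦ (t, y)) _ 0 := hHd.hasFDerivAt.comp (0 : ℝ) hd
    have hev : (fun t : ℝ ↦ Circle.exp t • c.symm y) =ᶠ[nhds 0]
        c.symm ∘ (H ∘ fun t : ℝ ↦ (t, y)) := by
      have : (fun t : ℝ ↦ (t, y)) ⁻¹' O ∈ nhds (0 : ℝ) :=
        (hOo.preimage (by fun_prop)).mem_nhds (hmem y hy)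
      filter_upwards [this] with t ht
      exact (c.left_inv ht.2).symm
    have hcd : MDifferentiableAt 𝓘(ℝ, EuclideanSpace ℝ (Fin 7)) (𝓡 7) c.symm
        ((H ∘ fun t : ℝ ↦ (t, y)) 0) := by
      have : (H ∘ fun t : ℝ ↦ (t, y)) 0 = y := hHy
      rw [this]
      exact mdifferentiableAt_chart_symm hy
    have h3 := mfderiv_comp (0 : ℝ) hcd hK.differentiableAt.mdifferentiableAt
    have key (p : EuclideanSpace ℝ (Fin 7)) (hp : p = y) (v : EuclideanSpace ℝ (Fin 7)) :
        (mfderiv 𝓘(ℝ, EuclideanSpace ℝ (Fin 7)) (𝓡 7) c.symm p :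
          EuclideanSpace ℝ (Fin 7) →L[ℝ] EuclideanSpace ℝ (Fin 7)) v =
        (mfderiv 𝓘(ℝ, EuclideanSpace ℝ (Fin 7)) (𝓡 7) c.symm y :
          EuclideanSpace ℝ (Fin 7) →L[ℝ] EuclideanSpace ℝ (Fin 7)) v := by subst hp; rfl
    have h4 : (fundField (c.symm y) : EuclideanSpace ℝ (Fin 7)) =
        (mfderiv 𝓘(ℝ, ℝ) (𝓡 7) (c.symm ∘ (H ∘ fun t : ℝ ↦ (t, y))) 0 :
          ℝ →L[ℝ] EuclideanSpace ℝ (Fin 7)) 1 :=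
      congrArg (fun L : ℝ →L[ℝ] EuclideanSpace ℝ (Fin 7) ↦ L 1) hev.mfderiv_eq
    refine Eq.trans ?_ h4.symm
    refine Eq.trans ?_ (congrArg (fun L : ℝ →L[ℝ] EuclideanSpace ℝ (Fin 7) ↦ L 1) h3).symm
    refine Eq.trans (key _ hHy _).symm ?_
    have h5 : mfderiv 𝓘(ℝ, ℝ) 𝓘(ℝ, EuclideanSpace ℝ (Fin 7)) (H ∘ fun t : ℝ ↦ (t, y)) 0 =
      (fderiv ℝ H (0, y)).comp (ContinuousLinearMap.inl ℝ ℝ (EuclideanSpace ℝ (Fin 7))) := by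
      rw [mfderiv_eq_fderiv]; exact hK.fderiv
    rw [h5]
    rfl

/-- The contraction `ξ ⌟ α`. -/
def contractField {F : Type*} [AddCommGroup F] [Module ℝ F] {k : ℕ} (α : DForm 7 M (k + 1) F) :
    DForm 7 M k F :=
  fun x ↦ (α x).curryLeft (fundField x)

theorem IsSmoothForm.contractField {α : DForm 7 M (k + 1) ℝ} (hα : IsSmoothForm α) :
    IsSmoothForm (contractField α) := by
  intro x₀ v
  obtain ⟨X, hX, hXf⟩ := exists_coordField x₀
  have h := SmoothFamily.apply (isSmoothForm_iff.1 hα x₀) contDiffOn_id (Set.mapsTo_id _)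
    (w := Fin.cons X fun i _ ↦ v i) (fun i ↦ by
      refine Fin.cases ?_ (fun j ↦ ?_) i
      · exact hX
      · exact contDiffOn_const)
  refine h.congr fun y hy ↦ ?_
  change α _ _ = α _ _
  congr 1
  funext i
  refine Fin.cases ?_ (fun j ↦ ?_) i
  · exact (hXf y hy).symm
  · rfl

end Invariance

/-! ### Naturality of the Hodge star -/

section Naturality

variable {V W : Type*} [AddCommGroup V] [Module ℝ V] [AddCommGroup W] [Module ℝ W]

theorem IsPositive.comp_equiv {φ : V [⋀^Fin 3]→ₗ[ℝ] ℝ} (hφ : IsPositive φ) (L : W ≃ₗ[ℝ] V) :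
    IsPositive (φ.compLinearMap L.toLinearMap) := by
  obtain ⟨u, rfl⟩ := hφ
  exact ⟨L.trans u, rfl⟩

/-- The Hodge dual `*_φ φ` commutes with linear isomorphisms and does not depend on the basis
chosen. -/
theorem IsPositive.hodgeStar_comp_equiv {φ : V [⋀^Fin 3]→ₗ[ℝ] ℝ} (hφ : IsPositive φ)
    (L : W ≃ₗ[ℝ] V) (e : Module.Basis (Fin 7) ℝ V) (e' : Module.Basis (Fin 7) ℝ W) :
    hodgeStar (φ.compLinearMap L.toLinearMap) e' (φ.compLinearMap L.toLinearMap) =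
      (hodgeStar φ e φ).compLinearMap L.toLinearMap := by
  obtain ⟨u, rfl⟩ := hφ
  rw [hodgeStar_self_model_comp]
  exact hodgeStar_self_model_comp (L.trans u) e'

end Naturality

/-! ### Smooth dependence of the metric and the Hodge star on the form -/

section SmoothMetric

variable {E : Type*} [NormedAddCommGroup E] [NormedSpace ℝ E] {U : Set E}
  {V : Type*} [AddCommGroup V] [Module ℝ V] {φ : E → V [⋀^Fin 3]→ₗ[ℝ] ℝ}

theorem SmoothFamily.curryLeft {F : Type*} [NormedAddCommGroup F] [NormedSpace ℝ F] {k : ℕ}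
    {A : E → V [⋀^Fin (k + 1)]→ₗ[ℝ] F} (hA : SmoothFamily A U) (v : V) :
    SmoothFamily (fun y ↦ (A y).curryLeft v) U := fun w ↦ hA (Matrix.vecCons v w)

theorem SmoothFamily.wedgeFun {p q n : ℕ} {A : E → V [⋀^Fin p]→ₗ[ℝ] ℝ}
    {B : E → V [⋀^Fin q]→ₗ[ℝ] ℝ} (hA : SmoothFamily A U) (hB : SmoothFamily B U) (h : p + q = n)
    (v : Fin n → V) : ContDiffOn ℝ ∞ (fun y ↦ wedgeFun (A y) (B y) h v) U :=
  hA.wedge hB _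

theorem SmoothFamily.bilinB (hφ : SmoothFamily φ U) (e : Module.Basis (Fin 7) ℝ V) (v w : V) :
    ContDiffOn ℝ ∞ (fun y ↦ bilinB (φ y) e v w) U := by
  simp only [bilinB_eq_wedgeFun]
  exact contDiffOn_const.mul
    (SmoothFamily.wedgeFun (p := 4) ((hφ.curryLeft v).wedge (hφ.curryLeft w)) hφ rfl e)

theorem contDiffOn_matrix_det {n : ℕ} {A : E → Matrix (Fin n) (Fin n) ℝ}
    (hA : ∀ i j, ContDiffOn ℝ ∞ (fun y ↦ A y i j) U) : ContDiffOn ℝ ∞ (fun y ↦ (A y).det) U := by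
  simp only [Matrix.det_apply]
  exact ContDiffOn.sum fun σ _ ↦ (contDiffOn_prod fun i _ ↦ hA _ _).const_smul _

theorem contDiffOn_matrix_inv {n : ℕ} {A : E → Matrix (Fin n) (Fin n) ℝ}
    (hA : ∀ i j, ContDiffOn ℝ ∞ (fun y ↦ A y i j) U) (hdet : ∀ y ∈ U, (A y).det ≠ 0)
    (i j : Fin n) : ContDiffOn ℝ ∞ (fun y ↦ (A y)⁻¹ i j) U := by
  simp only [Matrix.inv_def, Matrix.smul_apply, Ring.inverse_eq_inv', smul_eq_mul,
    Matrix.adjugate_apply]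
  refine ((contDiffOn_matrix_det hA).inv hdet).mul (contDiffOn_matrix_det fun k l ↦ ?_)
  by_cases h : k = j
  · subst h
    simp only [Matrix.updateRow_self]
    exact contDiffOn_const
  · simp only [Matrix.updateRow_ne h]
    exact hA k l

/-- The signed power `sign d |d| ^ p` is smooth away from zero; for `p = 1/9` it is the ninth root
in the volume form. -/
theorem contDiffAt_sign_mul_rpow {d : ℝ} (hd : d ≠ 0) (p : ℝ) :
    ContDiffAt ℝ ∞ (fun d : ℝ ↦ (SignType.sign d : ℝ) * |d| ^ p) d := by
  rcases lt_or_gt_of_ne hd with h | h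
  · have h1 : ContDiffAt ℝ ∞ (fun d : ℝ ↦ -(-d) ^ p) d :=
      (contDiffAt_id.neg.rpow_const_of_ne (by simpa using hd)).neg
    refine h1.congr_of_eventuallyEq ?_
    filter_upwards [gt_mem_nhds h] with x hx
    simp [abs_of_neg hx, sign_neg hx]
  · have h1 : ContDiffAt ℝ ∞ (fun d : ℝ ↦ d ^ p) d := contDiffAt_id.rpow_const_of_ne hd
    refine h1.congr_of_eventuallyEq ?_
    filter_upwards [lt_mem_nhds h] with x hx
    simp [abs_of_pos hx, sign_pos hx]

theorem SmoothFamily.volCoeff (hφ : SmoothFamily φ U) (hpos : ∀ y ∈ U, IsPositive (φ y))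
    (e : Module.Basis (Fin 7) ℝ V) : ContDiffOn ℝ ∞ (fun y ↦ volCoeff (φ y) e) U := by
  have h1 : ContDiffOn ℝ ∞
      (fun y ↦ (Matrix.of fun i j ↦ CircleG2.bilinB (φ y) e (e i) (e j)).det) U :=
    contDiffOn_matrix_det fun i j ↦ hφ.bilinB e (e i) (e j)
  intro y hy
  refine ContDiffAt.comp_contDiffWithinAt y (contDiffAt_sign_mul_rpow ?_ (1 / 9)) (h1 y hy)
  obtain ⟨u, hu⟩ := hpos y hy
  rw [hu, det_bilinB_model_comp]
  exact pow_ne_zero _ (frameDet_ne_zero u e)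

theorem IsPositive.volCoeff_ne_zero {φ : V [⋀^Fin 3]→ₗ[ℝ] ℝ} (hφ : IsPositive φ)
    (e : Module.Basis (Fin 7) ℝ V) : volCoeff φ e ≠ 0 := by
  obtain ⟨u, rfl⟩ := hφ
  rw [volCoeff_model_comp]
  exact frameDet_ne_zero u e

theorem SmoothFamily.metric (hφ : SmoothFamily φ U) (hpos : ∀ y ∈ U, IsPositive (φ y))
    (e : Module.Basis (Fin 7) ℝ V) (v w : V) :
    ContDiffOn ℝ ∞ (fun y ↦ metric (φ y) e v w) U :=
  ((hφ.volCoeff hpos e).inv fun y hy ↦ (hpos y hy).volCoeff_ne_zero e).mul (hφ.bilinB e v w)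

theorem IsPositive.det_metric_ne_zero {φ : V [⋀^Fin 3]→ₗ[ℝ] ℝ} (hφ : IsPositive φ)
    (e : Module.Basis (Fin 7) ℝ V) :
    (Matrix.of fun i j ↦ CircleG2.metric φ e (e i) (e j)).det ≠ 0 := by
  have h : (Matrix.of fun i j ↦ CircleG2.metric φ e (e i) (e j)) =
      (CircleG2.volCoeff φ e)⁻¹ • Matrix.of fun i j ↦ CircleG2.bilinB φ e (e i) (e j) := by
    ext i j; rfl
  rw [h, Matrix.det_smul]
  refine mul_ne_zero (pow_ne_zero _ (inv_ne_zero (hφ.volCoeff_ne_zero e))) ?_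
  obtain ⟨u, rfl⟩ := hφ
  rw [det_bilinB_model_comp]
  exact pow_ne_zero _ (frameDet_ne_zero u e)

theorem SmoothFamily.hodgeStar (hφ : SmoothFamily φ U) (hpos : ∀ y ∈ U, IsPositive (φ y))
    (e : Module.Basis (Fin 7) ℝ V) : SmoothFamily (fun y ↦ hodgeStar (φ y) e (φ y)) U := by
  have hG (i j : Fin 7) : ContDiffOn ℝ ∞
      (fun y ↦ (Matrix.of fun i j ↦ CircleG2.metric (φ y) e (e i) (e j))⁻¹ i j) U :=
    contDiffOn_matrix_inv (fun i j ↦ hφ.metric hpos e (e i) (e j))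
      (fun y hy ↦ (hpos y hy).det_metric_ne_zero e) i j
  intro v
  simp only [CircleG2.hodgeStar, AlternatingMap.smul_apply, AlternatingMap.sum_apply']
  refine ContDiffOn.const_smul _ ?_
  refine ContDiffOn.sum fun i _ ↦ ContDiffOn.sum fun j _ ↦ ContDiffOn.sum fun k _ ↦
    ContDiffOn.sum fun a _ ↦ ContDiffOn.sum fun b _ ↦ ContDiffOn.sum fun c _ ↦ ?_
  refine ContDiffOn.smul ((((hG i a).mul (hG j b)).mul (hG k c)).mul (hφ _)) ?_
  exact (hφ.volCoeff hpos e).mul contDiffOn_const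

end SmoothMetric

/-! ### The metric of a `G₂`-structure on a manifold -/

section ManifoldMetric

variable {M : Type*} [TopologicalSpace M] [ChartedSpace (EuclideanSpace ℝ (Fin 7)) M]

/-- The standard basis of `ℝ⁷`. -/
def stdBasis : Module.Basis (Fin 7) ℝ (EuclideanSpace ℝ (Fin 7)) :=
  (EuclideanSpace.basisFun (Fin 7) ℝ).toBasis

theorem IsG2Structure.plotForm_starPhi [IsManifold (𝓡 7) ∞ M] {φ : DForm 7 M 3 ℝ}
    (hφ : IsG2Structure φ) {x₀ : M} {y : EuclideanSpace ℝ (Fin 7)}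
    (hy : y ∈ (extChartAt (𝓡 7) x₀).target) : plotForm (starPhi φ) (extChartAt (𝓡 7) x₀).symm y =
      hodgeStar (plotForm φ (extChartAt (𝓡 7) x₀).symm y) stdBasis
        (plotForm φ (extChartAt (𝓡 7) x₀).symm y) := by
  obtain ⟨L, hL⟩ := exists_chartEquiv hy
  simp only [plotForm, ← hL]
  exact ((hφ.positive _).hodgeStar_comp_equiv L _ _).symm

theorem IsG2Structure.positive_plotForm [IsManifold (𝓡 7) ∞ M] {φ : DForm 7 M 3 ℝ}
    (hφ : IsG2Structure φ) {x₀ : M} {y : EuclideanSpace ℝ (Fin 7)}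
    (hy : y ∈ (extChartAt (𝓡 7) x₀).target) :
    IsPositive (plotForm φ (extChartAt (𝓡 7) x₀).symm y) := by
  obtain ⟨L, hL⟩ := exists_chartEquiv hy
  simp only [plotForm, ← hL]
  exact (hφ.positive _).comp_equiv L

/-- The metric of a positive form on the model space `ℝ⁷`. -/
def chartMetric (ψ : EuclideanSpace ℝ (Fin 7) [⋀^Fin 3]→ₗ[ℝ] ℝ) :
    EuclideanSpace ℝ (Fin 7) →ₗ[ℝ] EuclideanSpace ℝ (Fin 7) →ₗ[ℝ] ℝ :=
  metric ψ stdBasis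

theorem SmoothFamily.chartMetric {E : Type*} [NormedAddCommGroup E] [NormedSpace ℝ E] {U : Set E}
    {ψ : E → EuclideanSpace ℝ (Fin 7) [⋀^Fin 3]→ₗ[ℝ] ℝ} (hψ : SmoothFamily ψ U)
    (hpos : ∀ y ∈ U, IsPositive (ψ y)) (v w : EuclideanSpace ℝ (Fin 7)) :
    ContDiffOn ℝ ∞ (fun y ↦ chartMetric (ψ y) v w) U :=
  hψ.metric hpos stdBasis v w

theorem IsPositive.gMetric_eq_chartMetric {φ : DForm 7 M 3 ℝ} {x : M} (hφ : IsPositive (φ x))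
    (L : EuclideanSpace ℝ (Fin 7) ≃ₗ[ℝ] TangentSpace (𝓡 7) x)
    {ψ : EuclideanSpace ℝ (Fin 7) [⋀^Fin 3]→ₗ[ℝ] ℝ} (hψ : ψ = (φ x).compLinearMap L.toLinearMap)
    {v w : EuclideanSpace ℝ (Fin 7)} {v' w' : TangentSpace (𝓡 7) x} (hv : L v = v')
    (hw : L w = w') : chartMetric ψ v w = gMetric φ x v' w' := by
  subst hψ hv hw
  obtain ⟨u, hu⟩ := hφ
  have h1 : gMetric φ x (L v) (L w) = u (L v) ⬝ᵥ u (L w) := by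
    rw [gMetric, hu, metric_model_comp]
  have h : (φ x).compLinearMap L.toLinearMap =
    modelG2.compLinearMap (L.trans u).toLinearMap := by rw [hu]; rfl
  have h2 : chartMetric ((φ x).compLinearMap L.toLinearMap) v w =
      L.trans u v ⬝ᵥ L.trans u w := by
    rw [chartMetric, h, metric_model_comp]
  rw [h1, h2]
  rfl

theorem IsG2Structure.gMetric_chart [IsManifold (𝓡 7) ∞ M] {φ : DForm 7 M 3 ℝ}
    (hφ : IsG2Structure φ) {x₀ : M} {y : EuclideanSpace ℝ (Fin 7)}
    (hy : y ∈ (extChartAt (𝓡 7) x₀).target) (v w : EuclideanSpace ℝ (Fin 7)) :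
    chartMetric (plotForm φ (extChartAt (𝓡 7) x₀).symm y) v w =
      gMetric φ ((extChartAt (𝓡 7) x₀).symm y)
        (mfderiv 𝓘(ℝ, EuclideanSpace ℝ (Fin 7)) (𝓡 7) (extChartAt (𝓡 7) x₀).symm y v)
        (mfderiv 𝓘(ℝ, EuclideanSpace ℝ (Fin 7)) (𝓡 7) (extChartAt (𝓡 7) x₀).symm y w) := by
  obtain ⟨L, hL⟩ := exists_chartEquiv hy
  have hLv (v) : L v = mfderiv 𝓘(ℝ, EuclideanSpace ℝ (Fin 7)) (𝓡 7)
      (extChartAt (𝓡 7) x₀).symm y v := congrArg (fun f ↦ f v) hL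
  refine (hφ.positive ((extChartAt (𝓡 7) x₀).symm y)).gMetric_eq_chartMetric L ?_ (hLv v) (hLv w)
  rw [plotForm, ← hL]

theorem IsG2Structure.smooth_starPhi [IsManifold (𝓡 7) ∞ M] {φ : DForm 7 M 3 ℝ}
    (hφ : IsG2Structure φ) : IsSmoothForm (starPhi φ) := by
  refine isSmoothForm_iff.2 fun x₀ ↦ ?_
  have h := (isSmoothForm_iff.1 hφ.smooth x₀).hodgeStar
    (fun y hy ↦ hφ.positive_plotForm hy) stdBasis
  intro v
  exact (h v).congr fun y hy ↦ by rw [hφ.plotForm_starPhi hy]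

theorem contMDiff_of_chart {n : ℕ} {M : Type*} [TopologicalSpace M]
    [ChartedSpace (EuclideanSpace ℝ (Fin n)) M] [IsManifold (𝓡 n) ∞ M] {g : M → ℝ}
    (h : ∀ x₀ : M, ContDiffOn ℝ ∞ (g ∘ (extChartAt (𝓡 n) x₀).symm) (extChartAt (𝓡 n) x₀).target) :
    ContMDiff (𝓡 n) 𝓘(ℝ, ℝ) ∞ g := by
  intro x₀
  have h1 : ContMDiffOn (𝓡 n) 𝓘(ℝ, ℝ) ∞ ((g ∘ (extChartAt (𝓡 n) x₀).symm) ∘ extChartAt (𝓡 n) x₀)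
      (chartAt (EuclideanSpace ℝ (Fin n)) x₀).source := by
    refine (h x₀).contMDiffOn.comp contMDiffOn_extChartAt fun x hx ↦ ?_
    rw [← extChartAt_source (𝓡 n)] at hx
    exact (extChartAt (𝓡 n) x₀).map_source hx
  have h2 := h1.contMDiffAt ((chartAt (EuclideanSpace ℝ (Fin n)) x₀).open_source.mem_nhds
    (mem_chart_source _ x₀))
  refine h2.congr_of_eventuallyEq ?_
  filter_upwards [extChartAt_source_mem_nhds (I := 𝓡 n) x₀] with x hx
  simp only [Function.comp_apply, (extChartAt (𝓡 n) x₀).left_inv hx]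

/-- The metric of a `G₂`-structure applied to smooth coordinate fields is smooth. -/
theorem IsG2Structure.contDiffOn_metric [IsManifold (𝓡 7) ∞ M] {φ : DForm 7 M 3 ℝ}
    (hφ : IsG2Structure φ) (x₀ : M) {X Y : EuclideanSpace ℝ (Fin 7) → EuclideanSpace ℝ (Fin 7)}
    (hX : ContDiffOn ℝ ∞ X (extChartAt (𝓡 7) x₀).target)
    (hY : ContDiffOn ℝ ∞ Y (extChartAt (𝓡 7) x₀).target) :
    ContDiffOn ℝ ∞ (fun y ↦ chartMetric (plotForm φ (extChartAt (𝓡 7) x₀).symm y) (X y) (Y y))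
      (extChartAt (𝓡 7) x₀).target := by
  set b := EuclideanSpace.basisFun (Fin 7) ℝ
  have hx (v : EuclideanSpace ℝ (Fin 7)) : v = ∑ j, v j • b j := (b.sum_repr v).symm
  have key (g : EuclideanSpace ℝ (Fin 7) →ₗ[ℝ] EuclideanSpace ℝ (Fin 7) →ₗ[ℝ] ℝ) (v w) :
      g v w = ∑ i, ∑ j, v i * (w j * g (b i) (b j)) := by
    conv_lhs => rw [hx v, hx w]
    simp only [map_sum, map_smul, LinearMap.sum_apply, LinearMap.smul_apply, smul_eq_mul,
      Finset.mul_sum]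
    rw [Finset.sum_comm]
    exact Finset.sum_congr rfl fun _ _ ↦ Finset.sum_congr rfl fun _ _ ↦ by ring
  simp only [fun y ↦ key (chartMetric (plotForm φ (extChartAt (𝓡 7) x₀).symm y)) (X y) (Y y)]
  have hp (i : Fin 7) {Z : EuclideanSpace ℝ (Fin 7) → EuclideanSpace ℝ (Fin 7)}
      (hZ : ContDiffOn ℝ ∞ Z (extChartAt (𝓡 7) x₀).target) :
      ContDiffOn ℝ ∞ (fun y ↦ Z y i) (extChartAt (𝓡 7) x₀).target :=
    (EuclideanSpace.proj (𝕜 := ℝ) i : EuclideanSpace ℝ (Fin 7) →L[ℝ] ℝ).contDiff.comp_contDiffOn hZ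
  have hm (v w : EuclideanSpace ℝ (Fin 7)) : ContDiffOn ℝ ∞
      (fun y ↦ chartMetric (plotForm φ (extChartAt (𝓡 7) x₀).symm y) v w)
      (extChartAt (𝓡 7) x₀).target := by
    have h := isSmoothForm_iff.1 hφ.smooth x₀
    exact h.chartMetric (fun y hy ↦ hφ.positive_plotForm hy) v w
  exact ContDiffOn.sum fun i _ ↦ ContDiffOn.sum fun j _ ↦ (hp i hX).mul ((hp j hY).mul
    (hm (b i) (b j)))

end ManifoldMetric

/-! ### The connection form of an invariant `G₂`-structure -/

section InvariantStructures

attribute [local irreducible] metric hodgeStar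

variable {M : Type*} [TopologicalSpace M] [ChartedSpace (EuclideanSpace ℝ (Fin 7)) M]
  [MulAction Circle M] {φ : DForm 7 M 3 ℝ}

theorem etaForm_apply (x : M) (v : Fin 1 → TangentSpace (𝓡 7) x) :
    etaForm φ x v = hFun φ x * gMetric φ x (fundField x) (v 0) := rfl

variable [ContMDiffSMul (𝓡 1) (𝓡 7) ∞ Circle M]

/-- A function which is constant on an orbit has derivative zero along it. -/
theorem mfderiv_field_of_invariant {g : M → ℝ} (hd : MDifferentiable (𝓡 7) 𝓘(ℝ, ℝ) g) {x : M}
    (hg : ∀ z : Circle, g (z • x) = g x) :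
    mfderiv (𝓡 7) 𝓘(ℝ, ℝ) g x (fundField x) = (0 : ℝ) := by
  have h1 : g ∘ (fun t : ℝ ↦ Circle.exp t • x) = fun _ ↦ g x := by
    funext t; exact hg _
  have h2 := mfderiv_comp (I := 𝓘(ℝ, ℝ)) (I' := 𝓡 7) (I'' := 𝓘(ℝ, ℝ)) (0 : ℝ) (hd _)
    ((contMDiff_orbit x).mdifferentiable (by simp) 0)
  rw [h1, mfderiv_const] at h2
  have key (p : M) (hp : p = x) (v : EuclideanSpace ℝ (Fin 7)) :
      (mfderiv (𝓡 7) 𝓘(ℝ, ℝ) g p : EuclideanSpace ℝ (Fin 7) →L[ℝ] ℝ) v =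
        (mfderiv (𝓡 7) 𝓘(ℝ, ℝ) g x : EuclideanSpace ℝ (Fin 7) →L[ℝ] ℝ) v := by
    subst hp; rfl
  refine (key (Circle.exp (0 : ℝ) • x) (by simp) (fundField x)).symm.trans ?_
  exact (congrArg (fun L : ℝ →L[ℝ] ℝ ↦ L 1) h2).symm

variable [IsManifold (𝓡 7) ∞ M]

theorem IsInvariantG2.pullback_smul (hφ : IsInvariantG2 φ) (z : Circle) :
    pullback (m := 7) (fun y : M ↦ z • y) φ = φ :=
  invariant_of_lieDeriv_eq_zero hφ.isG2.smooth hφ.lieDeriv_eq_zero z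

/-- The circle acts by isometries of the metric of an invariant `G₂`-structure. -/
theorem IsInvariantG2.gMetric_smul (hφ : IsInvariantG2 φ) (z : Circle) (x : M)
    (v w : TangentSpace (𝓡 7) x) :
    gMetric φ (z • x) (mfderiv (𝓡 7) (𝓡 7) (fun y : M ↦ z • y) x v)
      (mfderiv (𝓡 7) (𝓡 7) (fun y : M ↦ z • y) x w) = gMetric φ x v w := by
  obtain ⟨u, hu⟩ := hφ.isG2.positive (z • x)
  obtain ⟨L, hL⟩ := exists_smulEquiv z x
  let L' : TangentSpace (𝓡 7) x ≃ₗ[ℝ] TangentSpace (𝓡 7) (z • x) := L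
  have hLv (v) : L' v = mfderiv (𝓡 7) (𝓡 7) (fun y : M ↦ z • y) x v := congrArg (fun f ↦ f v) hL
  have h1 : φ x = modelG2.compLinearMap (L'.trans u).toLinearMap := by
    have h2 := congrFun (hφ.pullback_smul z) x
    rw [← h2, pullback]
    have h3 : (mfderiv (𝓡 7) (𝓡 7) (fun y : M ↦ z • y) x).toLinearMap = L'.toLinearMap := hL.symm
    rw [h3]
    have h4 : φ ((fun y : M ↦ z • y) x) = modelG2.compLinearMap u.toLinearMap := hu
    rw [h4]
    rfl
  rw [gMetric, gMetric, hu, h1, metric_model_comp, metric_model_comp, ← hLv, ← hLv]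
  rfl

theorem IsG2Structure.gMetric_field_pos (hφ : IsG2Structure φ)
    (hfree : ∀ (z : Circle) (x : M), z • x = x → z = 1) (x : M) :
    0 < gMetric φ x (fundField x) (fundField x) := by
  obtain ⟨q, -, -, h, -⟩ := (hφ.positive x).exists_reduction (fundField_ne_zero hfree x)
    (tangentBasis x)
  exact h

theorem IsG2Structure.hFun_pos (hφ : IsG2Structure φ)
    (hfree : ∀ (z : Circle) (x : M), z • x = x → z = 1) (x : M) : 0 < hFun φ x :=
  inv_pos.2 (hφ.gMetric_field_pos hfree x)

theorem IsG2Structure.contDiffOn_hFun_chart (hφ : IsG2Structure φ)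
    (hfree : ∀ (z : Circle) (x : M), z • x = x → z = 1) (x₀ : M) :
    ContDiffOn ℝ ∞ (hFun φ ∘ (extChartAt (𝓡 7) x₀).symm) (extChartAt (𝓡 7) x₀).target := by
  obtain ⟨X, hX, hXf⟩ := exists_coordField x₀
  have h := hφ.contDiffOn_metric x₀ hX hX
  have heq : ∀ y ∈ (extChartAt (𝓡 7) x₀).target,
      chartMetric (plotForm φ (extChartAt (𝓡 7) x₀).symm y) (X y) (X y) =
        gMetric φ _ (fundField ((extChartAt (𝓡 7) x₀).symm y)) (fundField _) := fun y hy ↦ by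
    rw [hφ.gMetric_chart hy, hXf y hy]
  have h2 := h.inv fun y hy ↦ by
    rw [heq y hy]; exact (hφ.gMetric_field_pos hfree _).ne'
  refine h2.congr fun y hy ↦ ?_
  rw [Pi.inv_apply, heq y hy, Function.comp_apply, hFun]

theorem IsG2Structure.contMDiff_hFun (hφ : IsG2Structure φ)
    (hfree : ∀ (z : Circle) (x : M), z • x = x → z = 1) :
    ContMDiff (𝓡 7) 𝓘(ℝ, ℝ) ∞ (hFun φ) :=
  contMDiff_of_chart (hφ.contDiffOn_hFun_chart hfree)

theorem IsInvariantG2.hFun_smul (hφ : IsInvariantG2 φ) (z : Circle) (x : M) :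
    hFun φ (z • x) = hFun φ x := by
  rw [hFun, hFun, ← mfderiv_smul_fundField, hφ.gMetric_smul]

theorem IsInvariantG2.mfderiv_hFun_field (hφ : IsInvariantG2 φ)
    (hfree : ∀ (z : Circle) (x : M), z • x = x → z = 1) (x : M) :
    mfderiv (𝓡 7) 𝓘(ℝ, ℝ) (hFun φ) x (fundField x) = (0 : ℝ) :=
  mfderiv_field_of_invariant ((hφ.isG2.contMDiff_hFun hfree).mdifferentiable (by simp))
    (fun z ↦ hφ.hFun_smul z x)

theorem IsInvariantG2.isConnectionForm_etaForm (hφ : IsInvariantG2 φ)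
    (hfree : ∀ (z : Circle) (x : M), z • x = x → z = 1) : IsConnectionForm (etaForm φ) where
  smooth x₀ v := by
    obtain ⟨X, hX, hXf⟩ := exists_coordField x₀
    have h := (hφ.isG2.contDiffOn_hFun_chart hfree x₀).mul
      (hφ.isG2.contDiffOn_metric x₀ hX (contDiffOn_const (c := v 0)))
    refine h.congr fun y hy ↦ ?_
    rw [etaForm_apply, hφ.isG2.gMetric_chart hy, hXf y hy]
    rfl
  invariant z := by
    funext x
    ext v
    rw [pullback, AlternatingMap.compLinearMap_apply, etaForm_apply, etaForm_apply, hφ.hFun_smul,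
      ← mfderiv_smul_fundField]
    congr 1
    exact hφ.gMetric_smul z x (fundField x) (v 0)
  apply_field x := by
    rw [etaForm_apply]
    exact inv_mul_cancel₀ (hφ.isG2.gMetric_field_pos hfree x).ne'

end InvariantStructures

/-! ### Forms and submersions -/

section SmoothPullback

variable {n m : ℕ} {M N : Type*} [TopologicalSpace M] [ChartedSpace (EuclideanSpace ℝ (Fin n)) M]
  [TopologicalSpace N] [ChartedSpace (EuclideanSpace ℝ (Fin m)) N]
  {F : Type*} [NormedAddCommGroup F] [NormedSpace ℝ F] {k : ℕ}

variable [IsManifold (𝓡 n) ∞ M] [IsManifold (𝓡 m) ∞ N] in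
theorem IsSmoothForm.pullback {γ : DForm m N k F} (hγ : IsSmoothForm γ) {g : M → N}
    (hg : ContMDiff (𝓡 n) (𝓡 m) ∞ g) : IsSmoothForm (pullback (m := n) g γ) := by
  refine isSmoothForm_iff.2 fun x₀ ↦ ?_
  have h := hγ.plot (isOpen_extChartAt_target x₀)
    (hg.comp_contMDiffOn (contMDiffOn_extChartAt_symm (I := 𝓡 n) (n := ∞) x₀))
  intro v
  exact (h v).congr fun y hy ↦ by
    rw [plotForm_pullback γ (hg.mdifferentiable (by simp) _) (mdifferentiableAt_chart_symm hy)]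

/-- A submersion has smooth local sections through every point of its domain. -/
theorem exists_local_section {g : M → N} (hg : Manifold.IsSubmersion (𝓡 n) (𝓡 m) ∞ g) (x : M) :
    ∃ (U : Set N) (σ : N → M), IsOpen U ∧ g x ∈ U ∧ ContMDiffOn (𝓡 m) (𝓡 n) ∞ σ U ∧
      σ (g x) = x ∧ ∀ y ∈ U, g (σ y) = y := by
  have hx := hg.isSubmersionAt x
  set d := hx.domChart with hd
  set c := hx.codChart with hc
  set e := hx.equiv with he
  have hw : Set.EqOn ((c.extend (𝓡 m)) ∘ g ∘ (d.extend (𝓡 n)).symm) (Prod.fst ∘ e)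
    (d.extend (𝓡 n)).target := hx.writtenInCharts
  have hsub : d.source ⊆ g ⁻¹' c.source := hx.source_subset_preimage_source
  have hxd : x ∈ d.source := hx.mem_domChart_source
  have hw' (a) (ha : a ∈ d.target) : c (g (d.symm a)) = (e a).1 := by
    have := hw (x := a) (by simpa using ha)
    simpa using this
  have hdm : d ∈ IsManifold.maximalAtlas (𝓡 n) ∞ M := hx.domChart_mem_maximalAtlas
  have hcm : c ∈ IsManifold.maximalAtlas (𝓡 m) ∞ N := hx.codChart_mem_maximalAtlas
  set τ : N → EuclideanSpace ℝ (Fin n) := fun y ↦ e.symm (c y, (e (d x)).2) with hτ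
  have hτs : ContMDiffOn (𝓡 m) (𝓡 n) ∞ τ c.source := by
    have h1 : ContDiff ℝ ∞ (fun a : EuclideanSpace ℝ (Fin m) ↦ e.symm (a, (e (d x)).2)) :=
      e.symm.contDiff.comp (contDiff_id.prodMk contDiff_const)
    exact h1.contMDiff.comp_contMDiffOn (contMDiffOn_of_mem_maximalAtlas hcm)
  have hcx : c (g x) = (e (d x)).1 := by
    have := hw' (d x) (d.map_source hxd)
    rwa [d.left_inv hxd] at this
  have hτx : τ (g x) = d x := by
    rw [hτ]
    beta_reduce
    rw [hcx]
    exact e.symm_apply_apply _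
  refine ⟨c.source ∩ τ ⁻¹' d.target, d.symm ∘ τ,
    hτs.continuousOn.isOpen_inter_preimage c.open_source d.open_target,
    ⟨hsub hxd, ?_⟩, ?_, ?_, fun y hy ↦ ?_⟩
  · rw [Set.mem_preimage, hτx]; exact d.map_source hxd
  · exact (contMDiffOn_symm_of_mem_maximalAtlas hdm).comp (hτs.mono Set.inter_subset_left)
      fun y hy ↦ hy.2
  · rw [Function.comp_apply, hτx, d.left_inv hxd]
  · have h1 : c (g (d.symm (τ y))) = c y := by
      rw [hw' _ hy.2, hτ]
      simp
    exact c.injOn (hsub (d.map_target hy.2)) hy.1 h1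

/-- The differential of a submersion has the differential of a local section as right inverse. -/
theorem surjective_mfderiv_of_isSubmersion {g : M → N}
    (hg : Manifold.IsSubmersion (𝓡 n) (𝓡 m) ∞ g) (hgs : ContMDiff (𝓡 n) (𝓡 m) ∞ g) (x : M) :
    Function.Surjective (mfderiv (𝓡 n) (𝓡 m) g x) := by
  obtain ⟨U, σ, hU, hxU, hσ, hσx, hgσ⟩ := exists_local_section hg x
  have hσd : MDifferentiableAt (𝓡 m) (𝓡 n) σ (g x) :=
    (hσ.mdifferentiableOn (by simp)).mdifferentiableAt (hU.mem_nhds hxU)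
  have h1 := mfderiv_comp (g x) (hgs.mdifferentiable (by simp) _) hσd
  have h2 : g ∘ σ =ᶠ[nhds (g x)] id := by
    filter_upwards [hU.mem_nhds hxU] with y hy using hgσ y hy
  have h3 : (mfderiv (𝓡 m) (𝓡 m) (g ∘ σ) (g x) :
      EuclideanSpace ℝ (Fin m) →L[ℝ] EuclideanSpace ℝ (Fin m)) = .id ℝ _ := by
    have h4 := h2.mfderiv_eq (I := 𝓡 m) (I' := 𝓡 m)
    rw [mfderiv_id] at h4
    exact h4
  have key (p : M) (hp : p = x) : (mfderiv (𝓡 n) (𝓡 m) g p :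
      EuclideanSpace ℝ (Fin n) →L[ℝ] EuclideanSpace ℝ (Fin m)) = mfderiv (𝓡 n) (𝓡 m) g x := by
    subst hp; rfl
  intro v
  refine ⟨(mfderiv (𝓡 m) (𝓡 n) σ (g x) :
    EuclideanSpace ℝ (Fin m) →L[ℝ] EuclideanSpace ℝ (Fin n)) v, ?_⟩
  have h5 := congrArg (fun L : EuclideanSpace ℝ (Fin m) →L[ℝ] EuclideanSpace ℝ (Fin m) ↦ L v)
    (h1.symm.trans h3)
  refine Eq.trans ?_ h5
  exact (congrArg (fun L : EuclideanSpace ℝ (Fin n) →L[ℝ] EuclideanSpace ℝ (Fin m) ↦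
    L ((mfderiv (𝓡 m) (𝓡 n) σ (g x) :
      EuclideanSpace ℝ (Fin m) →L[ℝ] EuclideanSpace ℝ (Fin n)) v)) (key _ hσx)).symm

variable [IsManifold (𝓡 n) ∞ M] [IsManifold (𝓡 m) ∞ N] in
/-- A form on the base of a submersion is smooth as soon as its pullback is. -/
theorem isSmoothForm_of_pullback {g : M → N} (hg : Manifold.IsSubmersion (𝓡 n) (𝓡 m) ∞ g)
    (hgs : ContMDiff (𝓡 n) (𝓡 m) ∞ g) (hsurj : Function.Surjective g) {γ : DForm m N k F}
    (hγ : IsSmoothForm (pullback (m := n) g γ)) : IsSmoothForm γ := by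
  refine isSmoothForm_iff.2 fun y₀ v a ha ↦ ?_
  set f := (extChartAt (𝓡 m) y₀).symm with hf
  set S := (extChartAt (𝓡 m) y₀).target with hS
  have hSo : IsOpen S := isOpen_extChartAt_target _
  have hfs : ContMDiffOn 𝓘(ℝ, EuclideanSpace ℝ (Fin m)) (𝓡 m) ∞ f S :=
    contMDiffOn_extChartAt_symm (I := 𝓡 m) (n := ∞) y₀
  obtain ⟨x, hx⟩ := hsurj (f a)
  obtain ⟨U, σ, hU, hxU, hσ, hσx, hgσ⟩ := exists_local_section hg x
  rw [hx] at hxU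
  have hOo : IsOpen (S ∩ f ⁻¹' U) := hfs.continuousOn.isOpen_inter_preimage hSo hU
  have hσf : ContMDiffOn 𝓘(ℝ, EuclideanSpace ℝ (Fin m)) (𝓡 n) ∞ (σ ∘ f) (S ∩ f ⁻¹' U) :=
    hσ.comp (hfs.mono Set.inter_subset_left) fun y hy ↦ hy.2
  have h := hγ.plot hOo hσf
  have h' : ContDiffOn ℝ ∞ (fun y ↦ plotForm γ f y v) (S ∩ f ⁻¹' U) := by
    refine (h v).congr fun y hy ↦ ?_
    have hev : f =ᶠ[nhds y] g ∘ (σ ∘ f) := by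
      filter_upwards [hOo.mem_nhds hy] with z hz
      exact (hgσ _ hz.2).symm
    rw [plotForm_congr γ hev, plotForm_pullback γ (hgs.mdifferentiable (by simp) _)
      ((hσf.mdifferentiableOn (by simp)).mdifferentiableAt (hOo.mem_nhds hy))]
  exact ((h' a ⟨ha, hxU⟩).contDiffAt (hOo.mem_nhds ⟨ha, hxU⟩)).contDiffWithinAt

theorem contMDiff_of_comp_isSubmersion {g : M → N} (hg : Manifold.IsSubmersion (𝓡 n) (𝓡 m) ∞ g)
    (hsurj : Function.Surjective g) {h : N → ℝ} (hh : ContMDiff (𝓡 n) 𝓘(ℝ, ℝ) ∞ (h ∘ g)) :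
    ContMDiff (𝓡 m) 𝓘(ℝ, ℝ) ∞ h := by
  intro y
  obtain ⟨x, rfl⟩ := hsurj y
  obtain ⟨U, σ, hU, hxU, hσ, hσx, hgσ⟩ := exists_local_section hg x
  have h1 : ContMDiffOn (𝓡 m) 𝓘(ℝ, ℝ) ∞ h U :=
    (hh.comp_contMDiffOn hσ).congr fun y hy ↦ by simp [hgσ y hy]
  exact h1.contMDiffAt (hU.mem_nhds hxU)

theorem pullback_injective {g : M → N} (hg : Manifold.IsSubmersion (𝓡 n) (𝓡 m) ∞ g)
    (hgs : ContMDiff (𝓡 n) (𝓡 m) ∞ g) (hsurj : Function.Surjective g) {γ γ' : DForm m N k F}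
    (h : ∀ x, pullback (m := n) g γ x = pullback (m := n) g γ' x) : γ = γ' := by
  funext y
  obtain ⟨x, rfl⟩ := hsurj y
  exact AlternatingMap.compLinearMap_injective _ (surjective_mfderiv_of_isSubmersion hg hgs x) (h x)

end SmoothPullback

/-! ### Orbits -/

section OrbitSpace

variable {M : Type*} [MulAction Circle M]

theorem proj_surjective : Function.Surjective (proj : M → OrbitSpace M) :=
  Quotient.mk''_surjective

theorem proj_smul (z : Circle) (x : M) : proj (z • x) = proj x :=
  Quotient.sound' ⟨z, rfl⟩

theorem exists_smul_of_proj_eq {x y : M} (h : proj x = proj y) : ∃ z : Circle, z • x = y := by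
  obtain ⟨z, hz⟩ := Quotient.exact' h.symm
  exact ⟨z, hz⟩

end OrbitSpace

/-! ### Operations on smooth forms -/

section FormOperations

variable {n : ℕ} {M : Type*} [TopologicalSpace M] [ChartedSpace (EuclideanSpace ℝ (Fin n)) M]

theorem IsSmoothForm.wedge {p q : ℕ} {α : DForm n M p ℝ} {β : DForm n M q ℝ}
    (hα : IsSmoothForm α) (hβ : IsSmoothForm β) :
    IsSmoothForm (fun x ↦ wedge (α x) (β x) : DForm n M (p + q) ℝ) := by
  refine isSmoothForm_iff.2 fun x₀ v ↦ ?_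
  refine ((isSmoothForm_iff.1 hα x₀).wedge (isSmoothForm_iff.1 hβ x₀) v).congr fun y _ ↦ ?_
  have key (a : EuclideanSpace ℝ (Fin n) [⋀^Fin p]→ₗ[ℝ] ℝ)
      (b : EuclideanSpace ℝ (Fin n) [⋀^Fin q]→ₗ[ℝ] ℝ)
      (L : EuclideanSpace ℝ (Fin n) →ₗ[ℝ] EuclideanSpace ℝ (Fin n)) :
      (CircleG2.wedge a b).compLinearMap L v =
        CircleG2.wedge (a.compLinearMap L) (b.compLinearMap L) v := by
    rw [wedge_compLinearMap]
  exact key (α ((extChartAt (𝓡 n) x₀).symm y)) (β ((extChartAt (𝓡 n) x₀).symm y)) _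

theorem IsSmoothForm.add {F : Type*} [NormedAddCommGroup F] [NormedSpace ℝ F] {k : ℕ}
    {α β : DForm n M k F} (hα : IsSmoothForm α) (hβ : IsSmoothForm β) :
    IsSmoothForm (fun x ↦ α x + β x : DForm n M k F) :=
  fun x₀ v ↦ (hα x₀ v).add (hβ x₀ v)

theorem IsSmoothForm.sub {F : Type*} [NormedAddCommGroup F] [NormedSpace ℝ F] {k : ℕ}
    {α β : DForm n M k F} (hα : IsSmoothForm α) (hβ : IsSmoothForm β) :
    IsSmoothForm (fun x ↦ α x - β x : DForm n M k F) :=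
  fun x₀ v ↦ (hα x₀ v).sub (hβ x₀ v)

theorem IsSmoothForm.rePart {k : ℕ} {α : DForm n M k ℂ} (hα : IsSmoothForm α) :
    IsSmoothForm (fun x ↦ rePart (α x) : DForm n M k ℝ) :=
  fun x₀ v ↦ Complex.reCLM.contDiff.comp_contDiffOn (hα x₀ v)

theorem isSmoothForm_of_rePart_imPart {k : ℕ} {α : DForm n M k ℂ}
    (hr : IsSmoothForm (fun x ↦ rePart (α x) : DForm n M k ℝ))
    (hi : IsSmoothForm (fun x ↦ imPart (α x) : DForm n M k ℝ)) : IsSmoothForm α :=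
  isSmoothForm_iff.2 fun x₀ ↦ SmoothFamily.of_rePart_imPart (hr x₀) (hi x₀)

theorem IsSmoothForm.smul [IsManifold (𝓡 n) ∞ M] {F : Type*} [NormedAddCommGroup F]
    [NormedSpace ℝ F] {k : ℕ} {α : DForm n M k F} (hα : IsSmoothForm α) {c : M → ℝ}
    (hc : ContMDiff (𝓡 n) 𝓘(ℝ, ℝ) ∞ c) : IsSmoothForm (fun x ↦ c x • α x : DForm n M k F) := by
  intro x₀ v
  have h : ContDiffOn ℝ ∞ (c ∘ (extChartAt (𝓡 n) x₀).symm) (extChartAt (𝓡 n) x₀).target :=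
    (hc.comp_contMDiffOn (contMDiffOn_extChartAt_symm (I := 𝓡 n) (n := ∞) x₀)).contDiffOn
  exact h.smul (hα x₀ v)

theorem contMDiff_rpow [IsManifold (𝓡 n) ∞ M] {c : M → ℝ} (hc : ContMDiff (𝓡 n) 𝓘(ℝ, ℝ) ∞ c)
    (hpos : ∀ x, 0 < c x) (p : ℝ) : ContMDiff (𝓡 n) 𝓘(ℝ, ℝ) ∞ (fun x ↦ c x ^ p) := by
  refine contMDiff_of_chart fun x₀ ↦ ?_
  have h : ContDiffOn ℝ ∞ (c ∘ (extChartAt (𝓡 n) x₀).symm) (extChartAt (𝓡 n) x₀).target :=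
    (hc.comp_contMDiffOn (contMDiffOn_extChartAt_symm (I := 𝓡 n) (n := ∞) x₀)).contDiffOn
  exact h.rpow_const_of_ne fun y _ ↦ (hpos _).ne'

theorem eq_of_rePart_imPart {V : Type*} [AddCommGroup V] [Module ℝ V] {k : ℕ}
    {α β : V [⋀^Fin k]→ₗ[ℝ] ℂ} (hr : rePart α = rePart β) (hi : imPart α = imPart β) : α = β := by
  ext1 v
  exact Complex.ext (DFunLike.congr_fun hr v) (DFunLike.congr_fun hi v)

theorem pullback_wedge {m : ℕ} {N : Type*} [TopologicalSpace N]
    [ChartedSpace (EuclideanSpace ℝ (Fin m)) N] {p q : ℕ} (g : M → N) (α : DForm m N p ℝ)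
    (β : DForm m N q ℝ) (x : M) :
    pullback (m := n) g (fun y ↦ wedge (α y) (β y)) x =
      wedge (pullback (m := n) g α x) (pullback (m := n) g β x) :=
  (wedge_compLinearMap _ _ _).symm

end FormOperations

/-! ### Linear maps with the same kernel -/

section LinearFactorization

/-- Two surjections with the same kernel differ by an isomorphism of their targets. -/
theorem exists_equiv_of_ker_eq {V W Z : Type*} [AddCommGroup V] [Module ℝ V] [AddCommGroup W]
    [Module ℝ W] [AddCommGroup Z] [Module ℝ Z] {p : V →ₗ[ℝ] W} {q : V →ₗ[ℝ] Z}
    (hp : Function.Surjective p) (hq : Function.Surjective q) (h : ∀ v, q v = 0 ↔ p v = 0) :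
    ∃ e : W ≃ₗ[ℝ] Z, q = e.toLinearMap ∘ₗ p := by
  have hker : LinearMap.ker p = LinearMap.ker q := by ext v; simp [h]
  refine ⟨((p.quotKerEquivOfSurjective hp).symm.trans (Submodule.quotEquivOfEq _ _ hker)).trans
    (q.quotKerEquivOfSurjective hq), ?_⟩
  ext v
  have h1 : (p.quotKerEquivOfSurjective hp).symm (p v) = Submodule.Quotient.mk v := by
    rw [LinearEquiv.symm_apply_eq]; rfl
  simp [h1]

/-- A surjection onto a space of dimension one less has a one-dimensional kernel, spanned by any
nonzero vector in it. -/
theorem mem_span_of_apply_eq_zero {n : ℕ} {V W : Type*} [AddCommGroup V] [Module ℝ V]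
    [AddCommGroup W] [Module ℝ W] [Module.Finite ℝ V] {p : V →ₗ[ℝ] W}
    (hp : Function.Surjective p) (hV : Module.finrank ℝ V = n + 1) (hW : Module.finrank ℝ W = n)
    {ξ : V} (hξ : ξ ≠ 0) (hpξ : p ξ = 0) (v : V) : p v = 0 ↔ v ∈ Submodule.span ℝ {ξ} := by
  have h1 := p.finrank_range_add_finrank_ker
  rw [LinearMap.range_eq_top.2 hp, finrank_top, hV, hW] at h1
  have hle : Submodule.span ℝ {ξ} ≤ LinearMap.ker p := by
    rw [Submodule.span_singleton_le_iff_mem]; exact hpξ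
  have h2 := Submodule.eq_of_le_of_finrank_eq hle (by rw [finrank_span_singleton hξ]; omega)
  rw [h2, LinearMap.mem_ker]

end LinearFactorization

/-! ### Descent of forms to the orbit space -/

section Descent

variable {M : Type*} [TopologicalSpace M] [ChartedSpace (EuclideanSpace ℝ (Fin 7)) M]
  [MulAction Circle M] [ContMDiffSMul (𝓡 1) (𝓡 7) ∞ Circle M]
  [ChartedSpace (EuclideanSpace ℝ (Fin 6)) (OrbitSpace M)]
  {F : Type*} [NormedAddCommGroup F] [NormedSpace ℝ F] {k : ℕ}

/-- The projection is constant along orbits. -/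
theorem mfderiv_proj_fundField (hs : ContMDiff (𝓡 7) (𝓡 6) ∞ (proj : M → OrbitSpace M)) (x : M) :
    mfderiv (𝓡 7) (𝓡 6) proj x (fundField x) = 0 := by
  have h1 : (proj : M → OrbitSpace M) ∘ (fun t : ℝ ↦ Circle.exp t • x) = fun _ ↦ proj x := by
    funext t; exact proj_smul _ _
  have h2 := mfderiv_comp (I := 𝓘(ℝ, ℝ)) (I' := 𝓡 7) (I'' := 𝓡 6) (0 : ℝ)
    (hs.mdifferentiable (by simp) _) ((contMDiff_orbit x).mdifferentiable (by simp) 0)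
  have h3 : (mfderiv 𝓘(ℝ, ℝ) (𝓡 6) ((proj : M → OrbitSpace M) ∘
      (fun t : ℝ ↦ Circle.exp t • x)) 0 : ℝ →L[ℝ] EuclideanSpace ℝ (Fin 6)) = 0 := by
    rw [h1, mfderiv_const]
  have key (p : M) (hp : p = x) (v : EuclideanSpace ℝ (Fin 7)) :
      (mfderiv (𝓡 7) (𝓡 6) (proj : M → OrbitSpace M) p :
        EuclideanSpace ℝ (Fin 7) →L[ℝ] EuclideanSpace ℝ (Fin 6)) v =
      (mfderiv (𝓡 7) (𝓡 6) (proj : M → OrbitSpace M) x :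
        EuclideanSpace ℝ (Fin 7) →L[ℝ] EuclideanSpace ℝ (Fin 6)) v := by
    subst hp; rfl
  refine (key (Circle.exp (0 : ℝ) • x) (by simp) (fundField x)).symm.trans ?_
  exact (congrArg (fun L : ℝ →L[ℝ] EuclideanSpace ℝ (Fin 6) ↦ L 1) (h2.symm.trans h3))

theorem pullback_proj_smul (hs : ContMDiff (𝓡 7) (𝓡 6) ∞ (proj : M → OrbitSpace M))
    (γ : DForm 6 (OrbitSpace M) k F) (z : Circle) :
    pullback (m := 7) (fun y : M ↦ z • y) (pullback (m := 7) proj γ) =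
      pullback (m := 7) proj γ := by
  rw [← pullback_comp γ (hs.mdifferentiable (by simp)) (mdifferentiable_smul_circle z)]
  congr 1
  funext y
  exact proj_smul z y

/-- The vertical vectors are the multiples of the generating field. -/
theorem mfderiv_proj_eq_zero_iff (hfree : ∀ (z : Circle) (x : M), z • x = x → z = 1)
    [IsManifold (𝓡 7) ∞ M]
    (hπ : Manifold.IsSubmersion (𝓡 7) (𝓡 6) ∞ (proj : M → OrbitSpace M)) (x : M)
    (v : TangentSpace (𝓡 7) x) :
    mfderiv (𝓡 7) (𝓡 6) (proj : M → OrbitSpace M) x v = 0 ↔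
      v ∈ Submodule.span ℝ {fundField x} :=
  have key (p : EuclideanSpace ℝ (Fin 7) →L[ℝ] EuclideanSpace ℝ (Fin 6))
      (hp : Function.Surjective p) (ξ : EuclideanSpace ℝ (Fin 7)) (hξ : ξ ≠ 0) (hpξ : p ξ = 0)
      (v : EuclideanSpace ℝ (Fin 7)) : p v = 0 ↔ v ∈ Submodule.span ℝ {ξ} :=
    mem_span_of_apply_eq_zero (p := p.toLinearMap) hp finrank_euclideanSpace_fin
      finrank_euclideanSpace_fin hξ hpξ v
  key _ (surjective_mfderiv_of_isSubmersion hπ hπ.contMDiff x) _ (fundField_ne_zero hfree x)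
    (mfderiv_proj_fundField hπ.contMDiff x) v

/-- An invariant form which at every point factors through the differential of the projection is
the pullback of a form on the orbit space. -/
theorem exists_descent (hπ : Manifold.IsSubmersion (𝓡 7) (𝓡 6) ∞ (proj : M → OrbitSpace M))
    {β : DForm 7 M k F} (hinv : ∀ z : Circle, pullback (m := 7) (fun y : M ↦ z • y) β = β)
    (hloc : ∀ x, ∃ γ : (TangentSpace (𝓡 6) (proj x)) [⋀^Fin k]→ₗ[ℝ] F, β x =
      γ.compLinearMap (mfderiv (𝓡 7) (𝓡 6) (proj : M → OrbitSpace M) x).toLinearMap) :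
    ∃ γ : DForm 6 (OrbitSpace M) k F, ∀ x, pullback (m := 7) proj γ x = β x := by
  have hs := hπ.contMDiff
  choose g hg using hloc
  let g' : M → EuclideanSpace ℝ (Fin 6) [⋀^Fin k]→ₗ[ℝ] F := g
  -- the form on `T_{π(x)} N` does not depend on the point of the orbit
  have hgz (z : Circle) (x : M) : g' (z • x) = g' x := by
    refine AlternatingMap.compLinearMap_injective
      (mfderiv (𝓡 7) (𝓡 6) (proj : M → OrbitSpace M) x : EuclideanSpace ℝ (Fin 7) →L[ℝ]
        EuclideanSpace ℝ (Fin 6)).toLinearMap (surjective_mfderiv_of_isSubmersion hπ hs x) ?_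
    have h1 : (proj : M → OrbitSpace M) ∘ (fun y : M ↦ z • y) = proj := funext (proj_smul z)
    have h2 := mfderiv_comp (I := 𝓡 7) (I' := 𝓡 7) (I'' := 𝓡 6) x
      (hs.mdifferentiable (by simp) _) (mdifferentiable_smul_circle z x)
    rw [h1] at h2
    have h3 := congrFun (hinv z) x
    rw [hg x] at h3
    refine Eq.trans ?_ h3
    have h4 : β (z • x) = (g' (z • x)).compLinearMap (mfderiv (𝓡 7) (𝓡 6)
      (proj : M → OrbitSpace M) (z • x) : EuclideanSpace ℝ (Fin 7) →L[ℝ]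
        EuclideanSpace ℝ (Fin 6)).toLinearMap := hg (z • x)
    ext v
    have h5 (w : EuclideanSpace ℝ (Fin 7)) :
        (mfderiv (𝓡 7) (𝓡 6) (proj : M → OrbitSpace M) x : EuclideanSpace ℝ (Fin 7) →L[ℝ]
          EuclideanSpace ℝ (Fin 6)) w = (mfderiv (𝓡 7) (𝓡 6)
          (proj : M → OrbitSpace M) (z • x) : EuclideanSpace ℝ (Fin 7) →L[ℝ]
          EuclideanSpace ℝ (Fin 6)) ((mfderiv (𝓡 7) (𝓡 7) (fun y : M ↦ z • y) x :
          EuclideanSpace ℝ (Fin 7) →L[ℝ] EuclideanSpace ℝ (Fin 7)) w) :=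
      congrArg (fun L : EuclideanSpace ℝ (Fin 7) →L[ℝ] EuclideanSpace ℝ (Fin 6) ↦ L w) h2
    have h6 := congrArg (fun γ ↦ γ (fun i ↦ (mfderiv (𝓡 7) (𝓡 7) (fun y : M ↦ z • y) x :
          EuclideanSpace ℝ (Fin 7) →L[ℝ] EuclideanSpace ℝ (Fin 7)) (v i))) h4
    refine Eq.trans ?_ h6.symm
    exact congrArg (g' (z • x)) (funext fun i ↦ h5 (v i))
  obtain ⟨s, hsec⟩ := (proj_surjective (M := M)).hasRightInverse
  refine ⟨fun y ↦ g' (s y), fun x ↦ ?_⟩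
  obtain ⟨z, hz⟩ := exists_smul_of_proj_eq (hsec (proj x)).symm
  have h1 : g' (s (proj x)) = g' x := by rw [← hz, hgz]
  refine Eq.trans ?_ (hg x).symm
  change (g' (s (proj x))).compLinearMap _ = (g' x).compLinearMap _
  rw [h1]

end Descent

/-! ### Invariance of the reduced tensors -/

section InvariantForms

attribute [local irreducible] metric hodgeStar

variable {M : Type*} [TopologicalSpace M] [ChartedSpace (EuclideanSpace ℝ (Fin 7)) M]
  [MulAction Circle M] [ContMDiffSMul (𝓡 1) (𝓡 7) ∞ Circle M]

theorem pullback_smul_contractField {F : Type*} [AddCommGroup F] [Module ℝ F] {k : ℕ}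
    {α : DForm 7 M (k + 1) F} {z : Circle} (h : pullback (m := 7) (fun y : M ↦ z • y) α = α) :
    pullback (m := 7) (fun y : M ↦ z • y) (contractField α) = contractField α := by
  funext x
  ext v
  have h1 := DFunLike.congr_fun (congrFun h x) (Fin.cons (fundField x) v)
  refine Eq.trans ?_ h1
  change α _ _ = α _ _
  congr 1
  funext i
  refine Fin.cases ?_ (fun j ↦ ?_) i
  · exact (mfderiv_smul_fundField z x).symm
  · rfl

theorem IsG2Structure.pullback_smul_starPhi {φ : DForm 7 M 3 ℝ} (hφ : IsG2Structure φ) {z : Circle}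
    (h : pullback (m := 7) (fun y : M ↦ z • y) φ = φ) :
    pullback (m := 7) (fun y : M ↦ z • y) (starPhi φ) = starPhi φ := by
  funext x
  obtain ⟨L, hL⟩ := exists_smulEquiv z x
  let L' : TangentSpace (𝓡 7) x ≃ₗ[ℝ] TangentSpace (𝓡 7) (z • x) := L
  have h1 := (hφ.positive (z • x)).hodgeStar_comp_equiv L' (tangentBasis _) (tangentBasis x)
  have h2 : (φ (z • x)).compLinearMap L'.toLinearMap = φ x := by
    rw [← congrFun h x, pullback]
    have h3 : (mfderiv (𝓡 7) (𝓡 7) (fun y : M ↦ z • y) x).toLinearMap = L'.toLinearMap := hL.symm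
    rw [h3]
  rw [h2] at h1
  rw [starPhi, h1, pullback]
  have h3 : (mfderiv (𝓡 7) (𝓡 7) (fun y : M ↦ z • y) x).toLinearMap = L'.toLinearMap := hL.symm
  rw [h3]
  rfl

end InvariantForms

/-! ### Uniqueness of the reduction -/

section ReducedData

variable {M : Type*} [TopologicalSpace M] [ChartedSpace (EuclideanSpace ℝ (Fin 7)) M]
  [MulAction Circle M] [ChartedSpace (EuclideanSpace ℝ (Fin 6)) (OrbitSpace M)]
  {φ : DForm 7 M 3 ℝ}

theorem IsReductionOf.unique (hπ : Manifold.IsSubmersion (𝓡 7) (𝓡 6) ∞ (proj : M → OrbitSpace M))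
    {D D' : ReducedData M} (h : IsReductionOf D φ) (h' : IsReductionOf D' φ) : D = D' := by
  have h1 : D.h = D'.h := by
    funext y
    obtain ⟨x, rfl⟩ := proj_surjective y
    rw [h.h_eq, h'.h_eq]
  have h2 : D.η = D'.η := h.η_eq.trans h'.η_eq.symm
  have h3 : D.ωN = D'.ωN := pullback_injective hπ hπ.contMDiff proj_surjective fun x ↦
    (h.ω_eq x).trans (h'.ω_eq x).symm
  have h4 : D.ΩN = D'.ΩN := pullback_injective hπ hπ.contMDiff proj_surjective fun x ↦
    eq_of_rePart_imPart ((h.re_eq x).trans (h'.re_eq x).symm) ((h.im_eq x).trans (h'.im_eq x).symm)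
  obtain ⟨a, b, c, d, _, _, _, _⟩ := D
  obtain ⟨a', b', c', d', _, _, _, _⟩ := D'
  dsimp only at h1 h2 h3 h4
  subst h1 h2 h3 h4
  rfl

/-- An invariant `G₂`-structure is recovered from its reduction. -/
theorem IsReductionOf.reconstruct_eq {D : ReducedData M} (h : IsReductionOf D φ) :
    reconstruct D = φ := by
  funext x
  have hpos : 0 < hFun φ x := h.h_eq x ▸ D.h_pos _
  rw [reconstruct, h.ω_eq, h.η_eq, h.re_eq, h.h_eq, smul_smul, ← Real.rpow_add hpos]
  norm_num

end ReducedData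

/-! ### The reduction bijection -/

section Reduction

attribute [local irreducible] metric hodgeStar

variable {M : Type*} [TopologicalSpace M] [ChartedSpace (EuclideanSpace ℝ (Fin 7)) M]
  [MulAction Circle M]

/-- The `3`-form `h ^ (-3/4) (φ - η ∧ (ξ ⌟ φ))`, which descends to `Re Ω`. -/
def horizontalRe (φ : DForm 7 M 3 ℝ) : DForm 7 M 3 ℝ :=
  fun x ↦ (hFun φ x ^ (-3 / 4 : ℝ)) •
    (φ x - wedge (etaForm φ x) ((φ x).curryLeft (fundField x)))

/-- The `3`-form `-h ^ (-1/4) (ξ ⌟ *φ)`, which descends to `Im Ω`. -/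
def horizontalIm (φ : DForm 7 M 3 ℝ) : DForm 7 M 3 ℝ :=
  fun x ↦ -(hFun φ x ^ (-1 / 4 : ℝ)) • (starPhi φ x).curryLeft (fundField x)

variable {φ : DForm 7 M 3 ℝ} [ContMDiffSMul (𝓡 1) (𝓡 7) ∞ Circle M] [IsManifold (𝓡 7) ∞ M]

theorem IsInvariantG2.isSmoothForm_horizontalRe (hφ : IsInvariantG2 φ)
    (hfree : ∀ (z : Circle) (x : M), z • x = x → z = 1) : IsSmoothForm (horizontalRe φ) :=
  (hφ.isG2.smooth.sub ((hφ.isConnectionForm_etaForm hfree).smooth.wedge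
    hφ.isG2.smooth.contractField)).smul
    (contMDiff_rpow (hφ.isG2.contMDiff_hFun hfree) (hφ.isG2.hFun_pos hfree) _)

theorem IsInvariantG2.isSmoothForm_horizontalIm (hφ : IsInvariantG2 φ)
    (hfree : ∀ (z : Circle) (x : M), z • x = x → z = 1) : IsSmoothForm (horizontalIm φ) :=
  hφ.isG2.smooth_starPhi.contractField.smul
    (contMDiff_rpow (hφ.isG2.contMDiff_hFun hfree) (hφ.isG2.hFun_pos hfree) _).neg

theorem IsInvariantG2.pullback_smul_horizontalRe (hφ : IsInvariantG2 φ)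
    (hfree : ∀ (z : Circle) (x : M), z • x = x → z = 1) (z : Circle) :
    pullback (m := 7) (fun y : M ↦ z • y) (horizontalRe φ) = horizontalRe φ := by
  funext x
  have h1 := congrFun (hφ.pullback_smul z) x
  have h2 := congrFun ((hφ.isConnectionForm_etaForm hfree).invariant z) x
  have h3 := congrFun (pullback_smul_contractField (hφ.pullback_smul z)) x
  have h4 := pullback_wedge (n := 7) (fun y : M ↦ z • y) (etaForm φ) (contractField φ) x
  rw [h2, h3] at h4
  have h5 : pullback (m := 7) (fun y : M ↦ z • y) (horizontalRe φ) x =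
      (hFun φ (z • x) ^ (-3 / 4 : ℝ)) • (pullback (m := 7) (fun y : M ↦ z • y) φ x -
        pullback (m := 7) (fun y : M ↦ z • y)
          (fun y ↦ wedge (etaForm φ y) (contractField φ y) : DForm 7 M 3 ℝ) x) := rfl
  rw [h5, h1, hφ.hFun_smul]
  exact congrArg (fun w ↦ (hFun φ x ^ (-3 / 4 : ℝ)) • (φ x - w)) h4

theorem IsInvariantG2.pullback_smul_horizontalIm (hφ : IsInvariantG2 φ) (z : Circle) :
    pullback (m := 7) (fun y : M ↦ z • y) (horizontalIm φ) = horizontalIm φ := by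
  funext x
  have h3 := congrFun (pullback_smul_contractField
    (hφ.isG2.pullback_smul_starPhi (hφ.pullback_smul z))) x
  have h5 : pullback (m := 7) (fun y : M ↦ z • y) (horizontalIm φ) x =
      -(hFun φ (z • x) ^ (-1 / 4 : ℝ)) •
        pullback (m := 7) (fun y : M ↦ z • y) (contractField (starPhi φ)) x := rfl
  rw [h5, h3, hφ.hFun_smul]
  rfl

variable [ChartedSpace (EuclideanSpace ℝ (Fin 6)) (OrbitSpace M)]

/-- At every point the reduced tensors are pulled back, by the differential of the projection, from
a structure on the tangent space of the orbit space which is isomorphic to the standard one of `ℂ³`.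
-/
theorem IsG2Structure.exists_horizontal_frame (hφ : IsG2Structure φ)
    (hfree : ∀ (z : Circle) (x : M), z • x = x → z = 1)
    (hπ : Manifold.IsSubmersion (𝓡 7) (𝓡 6) ∞ (proj : M → OrbitSpace M)) (x : M) :
    ∃ u : TangentSpace (𝓡 6) (proj x) ≃ₗ[ℝ] (Fin 3 → ℂ),
      contractField φ x = (stdOmega.compLinearMap u.toLinearMap).compLinearMap
        (mfderiv (𝓡 7) (𝓡 6) (proj : M → OrbitSpace M) x).toLinearMap ∧
      horizontalRe φ x = rePart ((stdVol.compLinearMap u.toLinearMap).compLinearMap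
        (mfderiv (𝓡 7) (𝓡 6) (proj : M → OrbitSpace M) x).toLinearMap) ∧
      horizontalIm φ x = imPart ((stdVol.compLinearMap u.toLinearMap).compLinearMap
        (mfderiv (𝓡 7) (𝓡 6) (proj : M → OrbitSpace M) x).toLinearMap) := by
  obtain ⟨q, hq, hker, -, h1, h2, h3⟩ := (hφ.positive x).exists_reduction
    (fundField_ne_zero hfree x) (tangentBasis x)
  obtain ⟨u, hu⟩ := exists_equiv_of_ker_eq
    (p := (mfderiv (𝓡 7) (𝓡 6) (proj : M → OrbitSpace M) x).toLinearMap)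
    (surjective_mfderiv_of_isSubmersion hπ hπ.contMDiff x) hq
    (fun v ↦ (hker v).trans (mfderiv_proj_eq_zero_iff hfree hπ x v).symm)
  subst hu
  exact ⟨u, h1, h2, h3⟩

/-- The reduction of an invariant `G₂`-structure exists. -/
theorem IsInvariantG2.exists_isReductionOf [IsManifold (𝓡 6) ∞ (OrbitSpace M)]
    (hφ : IsInvariantG2 φ) (hfree : ∀ (z : Circle) (x : M), z • x = x → z = 1)
    (hπ : Manifold.IsSubmersion (𝓡 7) (𝓡 6) ∞ (proj : M → OrbitSpace M)) :
    ∃ D : ReducedData M, IsReductionOf D φ := by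
  have hs := hπ.contMDiff
  choose u hω hre him using hφ.isG2.exists_horizontal_frame hfree hπ
  obtain ⟨ωN, hωN⟩ := exists_descent hπ
    (fun z ↦ pullback_smul_contractField (hφ.pullback_smul z)) fun x ↦ ⟨_, hω x⟩
  let β : DForm 7 M 3 ℂ := fun x ↦ (stdVol.compLinearMap (u x).toLinearMap).compLinearMap
    (mfderiv (𝓡 7) (𝓡 6) (proj : M → OrbitSpace M) x).toLinearMap
  have hβr (x) : rePart (β x) = horizontalRe φ x := (hre x).symm
  have hβi (x) : imPart (β x) = horizontalIm φ x := (him x).symm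
  have hβinv (z : Circle) : pullback (m := 7) (fun y : M ↦ z • y) β = β := by
    funext x
    refine eq_of_rePart_imPart ?_ ?_
    · rw [hβr, ← congrFun (hφ.pullback_smul_horizontalRe hfree z) x]
      exact congrArg (fun γ : EuclideanSpace ℝ (Fin 7) [⋀^Fin 3]→ₗ[ℝ] ℝ ↦ γ.compLinearMap
        (mfderiv (𝓡 7) (𝓡 7) (fun y : M ↦ z • y) x : EuclideanSpace ℝ (Fin 7) →L[ℝ]
          EuclideanSpace ℝ (Fin 7)).toLinearMap) (hβr (z • x))
    · rw [hβi, ← congrFun (hφ.pullback_smul_horizontalIm z) x]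
      exact congrArg (fun γ : EuclideanSpace ℝ (Fin 7) [⋀^Fin 3]→ₗ[ℝ] ℝ ↦ γ.compLinearMap
        (mfderiv (𝓡 7) (𝓡 7) (fun y : M ↦ z • y) x : EuclideanSpace ℝ (Fin 7) →L[ℝ]
          EuclideanSpace ℝ (Fin 7)).toLinearMap) (hβi (z • x))
  obtain ⟨ΩN, hΩN⟩ := exists_descent hπ hβinv fun x ↦ ⟨_, rfl⟩
  have hβs : IsSmoothForm β := isSmoothForm_of_rePart_imPart
    (by simpa only [hβr] using hφ.isSmoothForm_horizontalRe hfree)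
    (by simpa only [hβi] using hφ.isSmoothForm_horizontalIm hfree)
  have hΩs : IsSmoothForm ΩN := isSmoothForm_of_pullback hπ hs proj_surjective
    (by rwa [show pullback (m := 7) proj ΩN = β from funext hΩN])
  have hωs : IsSmoothForm ωN := isSmoothForm_of_pullback hπ hs proj_surjective
    (by rw [show pullback (m := 7) proj ωN = contractField φ from funext hωN]
        exact hφ.isG2.smooth.contractField)
  obtain ⟨h, hh⟩ : ∃ h : OrbitSpace M → ℝ, ∀ x, h (proj x) = hFun φ x :=
    ⟨Quotient.lift (hFun φ) fun a b hab ↦ by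
      obtain ⟨z, rfl⟩ := hab
      exact hφ.hFun_smul z b, fun x ↦ rfl⟩
  refine ⟨⟨h, etaForm φ, ωN, ΩN, contMDiff_of_comp_isSubmersion hπ proj_surjective ?_, fun y ↦ ?_,
    hφ.isConnectionForm_etaForm hfree, hωs, hΩs, fun y ↦ ?_⟩, hh, rfl, hωN, fun x ↦ ?_, fun x ↦ ?_⟩
  · rw [show h ∘ proj = hFun φ from funext hh]
    exact hφ.isG2.contMDiff_hFun hfree
  · obtain ⟨x, rfl⟩ := proj_surjective y
    rw [hh]
    exact hφ.isG2.hFun_pos hfree x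
  · obtain ⟨x, rfl⟩ := proj_surjective y
    have hinj := AlternatingMap.compLinearMap_injective (N := ℝ) (ι := Fin 2)
      (mfderiv (𝓡 7) (𝓡 6) (proj : M → OrbitSpace M) x : EuclideanSpace ℝ (Fin 7) →L[ℝ]
        EuclideanSpace ℝ (Fin 6)).toLinearMap (surjective_mfderiv_of_isSubmersion hπ hs x)
    have h1 : ωN (proj x) = stdOmega.compLinearMap (u x).toLinearMap :=
      hinj ((hωN x).trans (hω x))
    have h2 : ΩN (proj x) = stdVol.compLinearMap (u x).toLinearMap := by
      have hinj := AlternatingMap.compLinearMap_injective (N := ℂ) (ι := Fin 3)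
        (mfderiv (𝓡 7) (𝓡 6) (proj : M → OrbitSpace M) x : EuclideanSpace ℝ (Fin 7) →L[ℝ]
          EuclideanSpace ℝ (Fin 6)).toLinearMap (surjective_mfderiv_of_isSubmersion hπ hs x)
      exact hinj (hΩN x)
    rw [h1, h2]
    exact isSU3_std_comp _
  · exact (congrArg (rePart (V := EuclideanSpace ℝ (Fin 7))) (hΩN x)).trans (hβr x)
  · exact (congrArg (imPart (V := EuclideanSpace ℝ (Fin 7))) (hΩN x)).trans (hβi x)

/-- The `3`-form built from reduced data is an invariant `G₂`-structure, whose reduction is the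
given data. -/
theorem isInvariantG2_reconstruct [IsManifold (𝓡 6) ∞ (OrbitSpace M)]
    (hfree : ∀ (z : Circle) (x : M), z • x = x → z = 1)
    (hπ : Manifold.IsSubmersion (𝓡 7) (𝓡 6) ∞ (proj : M → OrbitSpace M)) (D : ReducedData M) :
    IsInvariantG2 (reconstruct D) ∧ IsReductionOf D (reconstruct D) := by
  have hs := hπ.contMDiff
  have key (x : M) : ∃ q : TangentSpace (𝓡 7) x →ₗ[ℝ] (Fin 3 → ℂ),
      (∀ v, q v = 0 ↔ v ∈ Submodule.span ℝ {fundField x}) ∧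
      pullback (m := 7) proj D.ωN x = stdOmega.compLinearMap q ∧
      pullback (m := 7) proj D.ΩN x = stdVol.compLinearMap q := by
    obtain ⟨u, h1, h2⟩ := (D.isSU3.isSU3 (proj x)).exists_std_frame
    refine ⟨u.toLinearMap ∘ₗ (mfderiv (𝓡 7) (𝓡 6) (proj : M → OrbitSpace M) x).toLinearMap,
      fun v ↦ ?_, ?_, ?_⟩
    · rw [← mfderiv_proj_eq_zero_iff hfree hπ x v]
      exact u.map_eq_zero_iff
    · rw [pullback, h1]; rfl
    · rw [pullback, h2]; rfl
  choose q hker hω hΩ using key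
  have hφx (x : M) : reconstruct D x = wedge (D.η x) (stdOmega.compLinearMap (q x)) +
      D.h (proj x) ^ (3 / 4 : ℝ) • rePart (stdVol.compLinearMap (q x)) := by
    rw [reconstruct, hω, hΩ]
  have main (x : M) := isPositive_reconstruct (D.h_pos (proj x)) (fun v ↦ (hker x v).1)
    ((hker x _).2 (Submodule.mem_span_singleton_self _)) (D.η_connection.apply_field x)
    (tangentBasis x) (hφx x)
  have hη : D.η = etaForm (reconstruct D) := funext fun x ↦ (main x).2.2.1.symm
  refine ⟨⟨⟨?_, fun x ↦ (main x).1⟩, lieDeriv_eq_zero_of_invariant fun z ↦ ?_⟩,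
    fun x ↦ (main x).2.1.symm, hη, fun x ↦ ?_, fun x ↦ ?_, fun x ↦ ?_⟩
  · exact (D.η_connection.smooth.wedge (D.isSU3.smooth_omega.pullback hs)).add
      ((D.isSU3.smooth_Omega.pullback hs).rePart.smul
        (contMDiff_rpow (D.h_smooth.comp hs) (fun x ↦ D.h_pos _) _))
  · funext x
    have h1 := congrFun (D.η_connection.invariant z) x
    have h2 := congrFun (pullback_proj_smul hs D.ωN z) x
    have h3 := congrFun (pullback_proj_smul hs D.ΩN z) x
    have h4 := pullback_wedge (n := 7) (fun y : M ↦ z • y) D.η (pullback (m := 7) proj D.ωN) x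
    rw [h1, h2] at h4
    have h5 : pullback (m := 7) (fun y : M ↦ z • y) (reconstruct D) x =
        pullback (m := 7) (fun y : M ↦ z • y)
          (fun y ↦ wedge (D.η y) (pullback (m := 7) proj D.ωN y) : DForm 7 M 3 ℝ) x +
        (D.h (proj (z • x)) ^ (3 / 4 : ℝ)) • rePart (pullback (m := 7) (fun y : M ↦ z • y)
          (pullback (m := 7) proj D.ΩN) x) := rfl
    rw [h5, h3, proj_smul, reconstruct]
    exact congrArg (· + _) h4
  · rw [hω]; exact (main x).2.2.2.1.symm
  · rw [hΩ]; exact (main x).2.2.2.2.1.symm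
  · rw [hΩ]; exact (main x).2.2.2.2.2.symm

/-- Reduction as a bijection between invariant `G₂`-structures and reduced data. -/
theorem exists_reductionEquiv [IsManifold (𝓡 6) ∞ (OrbitSpace M)]
    (hfree : ∀ (z : Circle) (x : M), z • x = x → z = 1)
    (hπ : Manifold.IsSubmersion (𝓡 7) (𝓡 6) ∞ (proj : M → OrbitSpace M)) :
    ∃ e : {φ : DForm 7 M 3 ℝ // IsInvariantG2 φ} ≃ ReducedData M,
      (∀ φ D, e φ = D ↔ IsReductionOf D φ.1) ∧ ∀ D, (e.symm D).1 = reconstruct D := by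
  choose red hred using fun φ : {φ : DForm 7 M 3 ℝ // IsInvariantG2 φ} ↦
    φ.2.exists_isReductionOf hfree hπ
  refine ⟨⟨red, fun D ↦ ⟨reconstruct D, (isInvariantG2_reconstruct hfree hπ D).1⟩,
    fun φ ↦ Subtype.ext (hred φ).reconstruct_eq,
    fun D ↦ (hred _).unique hπ (isInvariantG2_reconstruct hfree hπ D).2⟩, fun φ D ↦ ⟨?_, ?_⟩,
    fun D ↦ rfl⟩
  · rintro rfl
    exact hred φ
  · exact (hred φ).unique hπ

end Reduction

/-! ### The inverse function theorem -/

section InverseFunction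

variable {E F : Type*} [NormedAddCommGroup E] [NormedSpace ℝ E] [CompleteSpace E]
  [NormedAddCommGroup F] [NormedSpace ℝ F]

/-- The inverse function theorem, with an inverse that is smooth on an open set and not only at
one point. -/
theorem exists_smooth_localInverse {G : E → F} {U : Set E} (hU : IsOpen U)
    (hG : ContDiffOn ℝ ∞ G U) {a : E} (ha : a ∈ U) (L : E ≃L[ℝ] F)
    (hL : HasFDerivAt G (L : E →L[ℝ] F) a) :
    ∃ Φ : OpenPartialHomeomorph E F, a ∈ Φ.source ∧ Φ.source ⊆ U ∧ (∀ x, Φ x = G x) ∧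
      ContDiffOn ℝ ∞ Φ.symm Φ.target := by
  have hGa : ContDiffAt ℝ ∞ G a := (hG a ha).contDiffAt (hU.mem_nhds ha)
  set Θ := hGa.toOpenPartialHomeomorph G hL (by simp) with hΘ
  have hΘG (x : E) : Θ x = G x := rfl
  -- restrict to the open set where the derivative is invertible
  set V := U ∩ fderiv ℝ G ⁻¹' Set.range ((↑) : (E ≃L[ℝ] F) → E →L[ℝ] F) with hV
  have hVo : IsOpen V := (hG.continuousOn_fderiv_of_isOpen hU (by simp)).isOpen_inter_preimage hU
    (ContinuousLinearEquiv.isOpen)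
  refine ⟨Θ.restrOpen V hVo, ⟨hGa.mem_toOpenPartialHomeomorph_source hL (by simp), ha, L, ?_⟩,
    fun x hx ↦ hx.2.1, hΘG, fun b hb ↦ ?_⟩
  · exact hL.fderiv.symm
  · set Ψ := Θ.restrOpen V hVo with hΨ
    have hx := Ψ.map_target hb
    obtain ⟨hxU, L', hL'⟩ := hx.2
    have hGx : ContDiffAt ℝ ∞ G (Ψ.symm b) := (hG _ hxU).contDiffAt (hU.mem_nhds hxU)
    refine (Ψ.contDiffAt_symm hb (f₀' := L') ?_ hGx).contDiffWithinAt
    rw [hL']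
    exact (hGx.differentiableAt (by simp)).hasFDerivAt

/-- A nonzero vector and a complement of its span split `ℝⁿ⁺¹` as `ℝ × ℝⁿ`. -/
theorem exists_equiv_prod_span {n : ℕ} {v : EuclideanSpace ℝ (Fin (n + 1))} (hv : v ≠ 0) :
    ∃ L : (ℝ × EuclideanSpace ℝ (Fin n)) ≃L[ℝ] EuclideanSpace ℝ (Fin (n + 1)), L (1, 0) = v := by
  obtain ⟨W, hW⟩ := Submodule.exists_isCompl (Submodule.span ℝ {v})
  have h1 := Submodule.finrank_add_eq_of_isCompl hW
  rw [finrank_span_singleton hv, finrank_euclideanSpace_fin] at h1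
  let e2 : EuclideanSpace ℝ (Fin n) ≃ₗ[ℝ] W := LinearEquiv.ofFinrankEq _ _ (by
    rw [finrank_euclideanSpace_fin]; omega)
  let e := ((LinearEquiv.toSpanNonzeroSingleton ℝ _ v hv).prodCongr e2).trans
    (Submodule.prodEquivOfIsCompl _ _ hW)
  refine ⟨e.toContinuousLinearEquiv, ?_⟩
  simp [e]

end InverseFunction

/-! ### Local slices -/

section FlowBox

variable {M : Type*} [TopologicalSpace M] [ChartedSpace (EuclideanSpace ℝ (Fin 7)) M]
  [MulAction Circle M] [ContMDiffSMul (𝓡 1) (𝓡 7) ∞ Circle M] [IsManifold (𝓡 7) ∞ M]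

/-- The orbit of a free action, seen in a chart, has nonzero velocity. -/
theorem exists_orbit_velocity (hfree : ∀ (z : Circle) (x : M), z • x = x → z = 1) (x₀ : M) :
    ∃ v : EuclideanSpace ℝ (Fin 7), v ≠ 0 ∧
      HasDerivAt (fun t : ℝ ↦ extChartAt (𝓡 7) x₀ (Circle.exp t • x₀)) v 0 := by
  set c := extChartAt (𝓡 7) x₀ with hc
  set γ : ℝ → M := fun t ↦ Circle.exp t • x₀ with hγ
  have hγ0 : γ 0 = x₀ := by simp [hγ]
  have hγs : ContMDiff 𝓘(ℝ, ℝ) (𝓡 7) ∞ γ := contMDiff_orbit x₀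
  have hcγ : MDifferentiableAt 𝓘(ℝ, ℝ) 𝓘(ℝ, EuclideanSpace ℝ (Fin 7)) (c ∘ γ) 0 := by
    refine MDifferentiableAt.comp (I' := 𝓡 7) (0 : ℝ) ?_ (hγs.mdifferentiable (by simp) 0)
    rw [hγ0]
    exact mdifferentiableAt_extChartAt (mem_chart_source _ x₀)
  have hd : DifferentiableAt ℝ (c ∘ γ) 0 := hcγ.differentiableAt
  refine ⟨deriv (c ∘ γ) 0, fun h0 ↦ ?_, hd.hasDerivAt⟩
  have hf : fderiv ℝ (c ∘ γ) 0 = 0 := by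
    rw [hd.hasDerivAt.hasFDerivAt.fderiv, h0, ContinuousLinearMap.toSpanSingleton_zero]
  have hev : γ =ᶠ[nhds 0] c.symm ∘ (c ∘ γ) := by
    have : γ ⁻¹' c.source ∈ nhds (0 : ℝ) := hγs.continuous.continuousAt.preimage_mem_nhds
      (by rw [hγ0]; exact extChartAt_source_mem_nhds x₀)
    filter_upwards [this] with t ht
    exact (c.left_inv ht).symm
  have hcd : MDifferentiableAt 𝓘(ℝ, EuclideanSpace ℝ (Fin 7)) (𝓡 7) c.symm ((c ∘ γ) 0) := by
    refine mdifferentiableAt_chart_symm ?_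
    rw [Function.comp_apply, hγ0]
    exact mem_extChartAt_target x₀
  have h3 := mfderiv_comp (0 : ℝ) hcd hcγ
  rw [mfderiv_eq_fderiv, hf] at h3
  refine fundField_ne_zero hfree x₀ ?_
  have h4 : (fundField x₀ : EuclideanSpace ℝ (Fin 7)) =
      (mfderiv 𝓘(ℝ, ℝ) (𝓡 7) (c.symm ∘ (c ∘ γ)) 0 : ℝ →L[ℝ] EuclideanSpace ℝ (Fin 7)) 1 :=
    congrArg (fun L : ℝ →L[ℝ] EuclideanSpace ℝ (Fin 7) ↦ L 1) hev.mfderiv_eq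
  refine Eq.trans h4 ((congrArg (fun L : ℝ →L[ℝ] EuclideanSpace ℝ (Fin 7) ↦ L 1) h3).trans ?_)
  exact map_zero (mfderiv 𝓘(ℝ, EuclideanSpace ℝ (Fin 7)) (𝓡 7) c.symm ((c ∘ γ) 0) :
    EuclideanSpace ℝ (Fin 7) →L[ℝ] EuclideanSpace ℝ (Fin 7))

/-- Near every point a free action is the translation flow `(t, w) ↦ exp(it) • s w` along a local
slice `s`. -/
theorem exists_local_slice (hfree : ∀ (z : Circle) (x : M), z • x = x → z = 1) (x₀ : M) :
    ∃ (s : EuclideanSpace ℝ (Fin 6) → M) (S : Set (EuclideanSpace ℝ (Fin 6)))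
      (Φ : OpenPartialHomeomorph (ℝ × EuclideanSpace ℝ (Fin 6)) M),
      s 0 = x₀ ∧ IsOpen S ∧ ContMDiffOn (𝓡 6) (𝓡 7) ∞ s S ∧ (0, 0) ∈ Φ.source ∧
      (∀ p ∈ Φ.source, p.2 ∈ S) ∧ (∀ p ∈ Φ.source, Φ p = Circle.exp p.1 • s p.2) ∧
      ContMDiffOn (𝓡 7) 𝓘(ℝ, ℝ × EuclideanSpace ℝ (Fin 6)) ∞ Φ.symm Φ.target := by
  obtain ⟨v, hv, hvd⟩ := exists_orbit_velocity hfree x₀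
  obtain ⟨L, hLv⟩ := exists_equiv_prod_span hv
  set c := extChartAt (𝓡 7) x₀ with hc
  let A : EuclideanSpace ℝ (Fin 6) →L[ℝ] EuclideanSpace ℝ (Fin 7) :=
    (L : (ℝ × EuclideanSpace ℝ (Fin 6)) →L[ℝ] EuclideanSpace ℝ (Fin 7)).comp
      (ContinuousLinearMap.inr ℝ ℝ _)
  -- the slice is, in a chart, an affine complement of the velocity of the orbit
  let a : EuclideanSpace ℝ (Fin 6) → EuclideanSpace ℝ (Fin 7) := fun w ↦ c x₀ + A w
  have has : ContDiff ℝ ∞ a := contDiff_const.add A.contDiff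
  let s : EuclideanSpace ℝ (Fin 6) → M := fun w ↦ c.symm (a w)
  set S := a ⁻¹' c.target with hS
  have hSo : IsOpen S := (isOpen_extChartAt_target x₀).preimage has.continuous
  have ha0 : a 0 = c x₀ := by simp [a]
  have h0S : (0 : EuclideanSpace ℝ (Fin 6)) ∈ S := by
    rw [hS, Set.mem_preimage, ha0]; exact mem_extChartAt_target x₀
  have hs0 : s 0 = x₀ := by
    simp only [s, ha0]; exact extChartAt_to_inv x₀
  have hss : ContMDiffOn 𝓘(ℝ, EuclideanSpace ℝ (Fin 6)) (𝓡 7) ∞ s S :=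
    (contMDiffOn_extChartAt_symm (I := 𝓡 7) (n := ∞) x₀).comp has.contMDiff.contMDiffOn
      (fun w hw ↦ hw)
  have hFs := contMDiffOn_flowPlot hss
  have hpo : IsOpen ((Set.univ : Set ℝ) ×ˢ S) := isOpen_univ.prod hSo
  set O := ((Set.univ : Set ℝ) ×ˢ S) ∩ flowPlot s ⁻¹' c.source with hO
  have hOo : IsOpen O := hFs.continuousOn.isOpen_inter_preimage hpo (isOpen_extChartAt_source _)
  set G : ℝ × EuclideanSpace ℝ (Fin 6) → EuclideanSpace ℝ (Fin 7) := c ∘ flowPlot s with hG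
  have hGs : ContDiffOn ℝ ∞ G O := by
    rw [← contMDiffOn_iff_contDiffOn]
    refine (contMDiffOn_extChartAt (I := 𝓡 7) (n := ∞) (x := x₀)).comp
      (hFs.mono Set.inter_subset_left) fun p hp ↦ ?_
    have := hp.2
    rwa [hc, extChartAt_source] at this
  have hmem : ((0 : ℝ), (0 : EuclideanSpace ℝ (Fin 6))) ∈ O := by
    refine ⟨⟨Set.mem_univ _, h0S⟩, ?_⟩
    change Circle.exp 0 • s 0 ∈ c.source
    rw [Circle.exp_zero, one_smul, hs0]
    exact mem_extChartAt_source x₀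
  have hGd : DifferentiableAt ℝ G (0, 0) :=
    (hGs.differentiableOn (by simp)).differentiableAt (hOo.mem_nhds hmem)
  -- the derivative at the centre is `L`, computed along the orbit and along the slice
  have hD1 : fderiv ℝ G (0, 0) (1, 0) = v := by
    have h1 : HasFDerivAt (fun t : ℝ ↦ (t, (0 : EuclideanSpace ℝ (Fin 6))))
        (ContinuousLinearMap.inl ℝ ℝ (EuclideanSpace ℝ (Fin 6))) 0 := hasFDerivAt_prodMk_left 0 0
    have h2 : HasFDerivAt (G ∘ fun t : ℝ ↦ (t, (0 : EuclideanSpace ℝ (Fin 6)))) _ 0 :=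
      hGd.hasFDerivAt.comp (0 : ℝ) h1
    have h3 : (G ∘ fun t : ℝ ↦ (t, (0 : EuclideanSpace ℝ (Fin 6)))) =
        fun t ↦ c (Circle.exp t • x₀) := by
      funext t; simp [hG, flowPlot, hs0]
    rw [h3] at h2
    have h4 := h2.hasDerivAt.unique hvd
    simpa using h4
  have hD2 (w : EuclideanSpace ℝ (Fin 6)) : fderiv ℝ G (0, 0) (0, w) = A w := by
    have h1 : HasFDerivAt (fun w : EuclideanSpace ℝ (Fin 6) ↦ ((0 : ℝ), w))
        (ContinuousLinearMap.inr ℝ ℝ (EuclideanSpace ℝ (Fin 6))) 0 := hasFDerivAt_prodMk_right 0 0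
    have h2 : HasFDerivAt (G ∘ fun w : EuclideanSpace ℝ (Fin 6) ↦ ((0 : ℝ), w)) _ 0 :=
      hGd.hasFDerivAt.comp (0 : EuclideanSpace ℝ (Fin 6)) h1
    have h3 : (G ∘ fun w : EuclideanSpace ℝ (Fin 6) ↦ ((0 : ℝ), w)) =ᶠ[nhds 0] a := by
      filter_upwards [hSo.mem_nhds h0S] with w hw
      simp only [hG, flowPlot, Function.comp_apply, Circle.exp_zero, one_smul]
      exact c.right_inv hw
    have h4 : HasFDerivAt a A 0 := A.hasFDerivAt.const_add (c x₀)
    have h5 := (h2.congr_of_eventuallyEq h3.symm).unique h4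
    exact congrArg (fun T : EuclideanSpace ℝ (Fin 6) →L[ℝ] EuclideanSpace ℝ (Fin 7) ↦ T w) h5
  have hD : fderiv ℝ G (0, 0) =
      (L : (ℝ × EuclideanSpace ℝ (Fin 6)) →L[ℝ] EuclideanSpace ℝ (Fin 7)) := by
    refine ContinuousLinearMap.ext fun p ↦ ?_
    have hp : p = p.1 • ((1 : ℝ), (0 : EuclideanSpace ℝ (Fin 6))) + (0, p.2) := by
      ext <;> simp
    rw [hp, map_add, map_smul, map_add, map_smul, hD1, hD2]
    exact congrArg₂ (· + ·) (congrArg (p.1 • ·) hLv.symm) rfl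
  obtain ⟨Θ, h0Θ, hΘO, hΘG, hΘs⟩ := exists_smooth_localInverse hOo hGs hmem L
    (hD ▸ hGd.hasFDerivAt)
  set Φ := Θ.trans (chartAt (EuclideanSpace ℝ (Fin 7)) x₀).symm with hΦ
  have hcs (y) : (chartAt (EuclideanSpace ℝ (Fin 7)) x₀).symm y = c.symm y := by simp [hc]
  refine ⟨s, S, Φ, hs0, hSo, hss, ?_, fun p hp ↦ ?_, fun p hp ↦ ?_, ?_⟩
  · refine ⟨h0Θ, ?_⟩
    change Θ (0, 0) ∈ (chartAt (EuclideanSpace ℝ (Fin 7)) x₀).target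
    rw [hΘG]
    have : G (0, 0) = c x₀ := by simp [hG, flowPlot, hs0]
    rw [this]
    simp [hc]
  · exact (hΘO hp.1).1.2
  · have h1 := (hΘO hp.1).2
    change (chartAt (EuclideanSpace ℝ (Fin 7)) x₀).symm (Θ p) = _
    rw [hΘG, hcs]
    exact c.left_inv h1
  · have h1 : ContMDiffOn (𝓡 7) (𝓡 7) ∞ (chartAt (EuclideanSpace ℝ (Fin 7)) x₀)
        (chartAt (EuclideanSpace ℝ (Fin 7)) x₀).source := contMDiffOn_chart
    refine hΘs.contMDiffOn.comp (h1.mono fun y hy ↦ hy.1) fun y hy ↦ hy.2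

end FlowBox

/-! ### The topology of the orbit space -/

theorem continuous_proj {M : Type*} [TopologicalSpace M] [MulAction Circle M] :
    Continuous (proj : M → OrbitSpace M) :=
  continuous_quotient_mk'

variable {M : Type*} [TopologicalSpace M] [ChartedSpace (EuclideanSpace ℝ (Fin 7)) M]
  [MulAction Circle M]

section Topology

variable [ContMDiffSMul (𝓡 1) (𝓡 7) ∞ Circle M]

variable (M) in
theorem continuousSMul_circle : ContinuousSMul Circle M :=
  ContMDiffSMul.continuousSMul (I := 𝓡 1) (I' := 𝓡 7) ∞

theorem isOpenMap_proj : IsOpenMap (proj : M → OrbitSpace M) :=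
  have := continuousSMul_circle M
  isOpenMap_quotient_mk'_mul

/-- The orbit space is Hausdorff, since the orbit relation is the projection along the compact
circle of a closed set. -/
theorem t2Space_orbitSpace [T2Space M] : T2Space (OrbitSpace M) := by
  have := continuousSMul_circle M
  have hq : IsOpenQuotientMap (proj : M → OrbitSpace M) :=
    ⟨proj_surjective, continuous_proj, isOpenMap_proj⟩
  rw [t2Space_iff_of_isOpenQuotientMap hq]
  have h1 : IsClosed {p : Circle × (M × M) | p.1 • p.2.1 = p.2.2} :=
    isClosed_eq (by fun_prop) (by fun_prop)
  convert isClosedMap_snd_of_compactSpace _ h1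
  ext ⟨x, y⟩
  constructor
  · intro h
    obtain ⟨z, hz⟩ := exists_smul_of_proj_eq h
    exact ⟨(z, x, y), hz, rfl⟩
  · rintro ⟨⟨z, x', y'⟩, hz, h⟩
    obtain ⟨rfl, rfl⟩ := Prod.mk.inj h
    exact (proj_smul z x').symm.trans (congrArg proj hz)

theorem secondCountableTopology_orbitSpace [SecondCountableTopology M] :
    SecondCountableTopology (OrbitSpace M) :=
  have := continuousSMul_circle M
  ContinuousConstSMul.secondCountableTopology

end Topology

/-! ### Flow boxes -/

variable (M) in
/-- A slice `sec` for the circle action, defined on the open set `dom`, that meets each orbit at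
most once, together with the diffeomorphism `(t, w) ↦ exp(it) • sec w` from a box
`(-ε, ε) × dom` onto an open subset of `M`. -/
structure FlowBox where
  sec : EuclideanSpace ℝ (Fin 6) → M
  dom : Set (EuclideanSpace ℝ (Fin 6))
  box : OpenPartialHomeomorph (ℝ × EuclideanSpace ℝ (Fin 6)) M
  ε : ℝ
  ε_pos : 0 < ε
  isOpen_dom : IsOpen dom
  contMDiffOn_sec : ContMDiffOn (𝓡 6) (𝓡 7) ∞ sec dom
  source_eq : box.source = Set.Ioo (-ε) ε ×ˢ dom
  box_apply : ∀ t ∈ Set.Ioo (-ε) ε, ∀ w ∈ dom, box (t, w) = Circle.exp t • sec w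
  contMDiffOn_symm : ContMDiffOn (𝓡 7) 𝓘(ℝ, ℝ × EuclideanSpace ℝ (Fin 6)) ∞ box.symm box.target
  eq_of_smul_eq : ∀ w ∈ dom, ∀ w' ∈ dom, ∀ z : Circle, z • sec w = sec w' → w = w'

/-- Slices exist: the compactness of the circle allows a local slice to be shrunk until it meets
each orbit at most once. -/
theorem exists_flowBox [T2Space M] [ContMDiffSMul (𝓡 1) (𝓡 7) ∞ Circle M] [IsManifold (𝓡 7) ∞ M]
    (hfree : ∀ (z : Circle) (x : M), z • x = x → z = 1) (x₀ : M) :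
    ∃ b : FlowBox M, 0 ∈ b.dom ∧ b.sec 0 = x₀ := by
  have := continuousSMul_circle M
  obtain ⟨s, S, Φ, hs0, hSo, hss, h0Φ, hΦS, hΦs, hΦsymm⟩ := exists_local_slice hfree x₀
  obtain ⟨u, hu, v, hv, huv⟩ := mem_nhds_prod_iff.1 (Φ.open_source.mem_nhds h0Φ)
  obtain ⟨ε, hε, hεu⟩ := Metric.mem_nhds_iff.1 hu
  rw [Real.ball_eq_Ioo, zero_sub, zero_add] at hεu
  have h0ε : (0 : ℝ) ∈ Set.Ioo (-ε) ε := ⟨by linarith, hε⟩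
  -- group elements away from `1` move the slice off itself near its centre
  set K : Set Circle := (Circle.exp '' Set.Ioo (-ε) ε)ᶜ with hK
  have hKc : IsCompact K :=
    (isLocalHomeomorph_circleExp.isOpenMap _ isOpen_Ioo).isClosed_compl.isCompact
  have hcont : ContinuousOn (fun p : Circle × (EuclideanSpace ℝ (Fin 6) ×
      EuclideanSpace ℝ (Fin 6)) ↦ (p.1 • s p.2.1, s p.2.2)) (Set.univ ×ˢ (S ×ˢ S)) := by
    have h1 : ContinuousOn (fun p : Circle × (EuclideanSpace ℝ (Fin 6) ×
        EuclideanSpace ℝ (Fin 6)) ↦ s p.2.1) (Set.univ ×ˢ (S ×ˢ S)) :=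
      hss.continuousOn.comp (by fun_prop) fun p hp ↦ hp.2.1
    have h2 : ContinuousOn (fun p : Circle × (EuclideanSpace ℝ (Fin 6) ×
        EuclideanSpace ℝ (Fin 6)) ↦ s p.2.2) (Set.univ ×ˢ (S ×ˢ S)) :=
      hss.continuousOn.comp (by fun_prop) fun p hp ↦ hp.2.2
    exact (continuousOn_fst.smul h1).prodMk h2
  have hno := hcont.isOpen_inter_preimage (isOpen_univ.prod (hSo.prod hSo))
    (isClosed_diagonal (X := M)).isOpen_compl
  obtain ⟨a, c, ha, hc, hKa, h0c, hac⟩ := generalized_tube_lemma hKc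
    (isCompact_singleton (x := ((0 : EuclideanSpace ℝ (Fin 6)), (0 : EuclideanSpace ℝ (Fin 6)))))
    hno (by
      rintro ⟨z, w⟩ ⟨hz, rfl⟩
      refine ⟨⟨Set.mem_univ _, hΦS _ h0Φ, hΦS _ h0Φ⟩, fun h ↦ hz ⟨0, h0ε, ?_⟩⟩
      have h' : z • s 0 = s 0 := h
      rw [Circle.exp_zero, hfree z _ h'])
  have hcn := hc.mem_nhds (h0c rfl)
  rw [nhds_prod_eq, Filter.mem_prod_same_iff] at hcn
  obtain ⟨d, hd, hdc⟩ := hcn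
  set B := interior v ∩ interior d with hB
  have hBo : IsOpen B := isOpen_interior.inter isOpen_interior
  have hsub : Set.Ioo (-ε) ε ×ˢ B ⊆ Φ.source := fun p hp ↦
    huv ⟨hεu hp.1, interior_subset hp.2.1⟩
  have hBS : B ⊆ S := fun w hw ↦ hΦS (0, w) (hsub ⟨h0ε, hw⟩)
  refine ⟨⟨s, B, Φ.restrOpen (Set.Ioo (-ε) ε ×ˢ B) (isOpen_Ioo.prod hBo), ε, hε, hBo,
    hss.mono hBS, ?_,
    fun t ht w hw ↦ hΦs _ (hsub ⟨ht, hw⟩), hΦsymm.mono fun y hy ↦ hy.1, fun w hw w' hw' z hz ↦ ?_⟩,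
    ⟨mem_interior_iff_mem_nhds.2 hv, mem_interior_iff_mem_nhds.2 hd⟩, hs0⟩
  · exact Set.inter_eq_right.2 hsub
  · by_cases hzK : z ∈ K
    · have h1 := hac (a := (z, w, w'))
        ⟨hKa hzK, hdc ⟨interior_subset hw.2, interior_subset hw'.2⟩⟩
      exact absurd hz h1.2
    -- group elements near `1` are times in the box, where the flow is injective
    · obtain ⟨t, ht, rfl⟩ := not_not.1 hzK
      have h1 : Φ (t, w) = Φ (0, w') := by
        rw [hΦs _ (hsub ⟨ht, hw⟩), hΦs _ (hsub ⟨h0ε, hw'⟩), Circle.exp_zero, one_smul, hz]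
      exact congrArg Prod.snd (Φ.injOn (hsub ⟨ht, hw⟩) (hsub ⟨h0ε, hw'⟩) h1)

namespace FlowBox

variable (b : FlowBox M)

theorem mem_source {t : ℝ} (ht : t ∈ Set.Ioo (-b.ε) b.ε) {w : EuclideanSpace ℝ (Fin 6)}
    (hw : w ∈ b.dom) : (t, w) ∈ b.box.source := by
  rw [b.source_eq]; exact ⟨ht, hw⟩

theorem zero_mem : (0 : ℝ) ∈ Set.Ioo (-b.ε) b.ε := ⟨neg_neg_of_pos b.ε_pos, b.ε_pos⟩

theorem box_zero {w : EuclideanSpace ℝ (Fin 6)} (hw : w ∈ b.dom) : b.box (0, w) = b.sec w := by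
  rw [b.box_apply 0 b.zero_mem w hw, Circle.exp_zero, one_smul]

theorem proj_box {p : ℝ × EuclideanSpace ℝ (Fin 6)} (hp : p ∈ b.box.source) :
    proj (b.box p) = proj (b.sec p.2) := by
  rw [b.source_eq] at hp
  rw [show b.box p = _ from b.box_apply p.1 hp.1 p.2 hp.2, proj_smul]

theorem injOn_proj_sec : Set.InjOn (fun w ↦ proj (b.sec w)) b.dom := fun w hw w' hw' h ↦ by
  obtain ⟨z, hz⟩ := exists_smul_of_proj_eq h
  exact b.eq_of_smul_eq w hw w' hw' z hz

variable [ContMDiffSMul (𝓡 1) (𝓡 7) ∞ Circle M]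

theorem contMDiffOn_box :
    ContMDiffOn 𝓘(ℝ, ℝ × EuclideanSpace ℝ (Fin 6)) (𝓡 7) ∞ b.box b.box.source := by
  have h := contMDiffOn_flowPlot b.contMDiffOn_sec
  rw [b.source_eq]
  exact (h.mono (Set.prod_mono_left (Set.subset_univ _))).congr fun p hp ↦
    b.box_apply p.1 hp.1 p.2 hp.2

/-- Up to the projection, a subset of a slice may be thickened along the orbits to an open set. -/
theorem isOpen_image_proj_sec {V : Set (EuclideanSpace ℝ (Fin 6))} (hV : IsOpen V)
    (hVd : V ⊆ b.dom) : IsOpen ((fun w ↦ proj (b.sec w)) '' V) := by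
  have hsub : Set.Ioo (-b.ε) b.ε ×ˢ V ⊆ b.box.source := fun p hp ↦ b.mem_source hp.1 (hVd hp.2)
  have h1 : (fun w ↦ proj (b.sec w)) '' V = proj '' (b.box '' (Set.Ioo (-b.ε) b.ε ×ˢ V)) := by
    ext y
    constructor
    · rintro ⟨w, hw, rfl⟩
      exact ⟨_, ⟨(0, w), ⟨b.zero_mem, hw⟩, rfl⟩, b.proj_box (hsub ⟨b.zero_mem, hw⟩)⟩
    · rintro ⟨_, ⟨p, hp, rfl⟩, rfl⟩
      exact ⟨p.2, hp.2, (b.proj_box (hsub hp)).symm⟩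
  rw [h1]
  exact isOpenMap_proj _ (b.box.isOpen_image_of_subset_source (isOpen_Ioo.prod hV) hsub)

/-- The chart of the orbit space inverse to `w ↦ π (sec w)`. -/
def chart : OpenPartialHomeomorph (OrbitSpace M) (EuclideanSpace ℝ (Fin 6)) :=
  (OpenPartialHomeomorph.ofContinuousOpenRestrict
    (b.injOn_proj_sec.bijOn_image.toPartialEquiv _ _ _)
    (continuous_proj.comp_continuousOn b.contMDiffOn_sec.continuousOn)
    (fun U hU ↦ by
      obtain ⟨V, hV, rfl⟩ := isOpen_induced_iff.1 hU
      have h := b.isOpen_image_proj_sec (hV.inter b.isOpen_dom) Set.inter_subset_right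
      convert h using 1
      ext y
      constructor
      · rintro ⟨⟨w, hw⟩, hwV, rfl⟩
        exact ⟨w, ⟨hwV, hw⟩, rfl⟩
      · rintro ⟨w, ⟨hwV, hw⟩, rfl⟩
        exact ⟨⟨w, hw⟩, hwV, rfl⟩)
    b.isOpen_dom).symm

theorem proj_sec_mem_chart_source {w : EuclideanSpace ℝ (Fin 6)} (hw : w ∈ b.dom) :
    proj (b.sec w) ∈ b.chart.source :=
  b.chart.map_target hw

theorem chart_proj_sec {w : EuclideanSpace ℝ (Fin 6)} (hw : w ∈ b.dom) :
    b.chart (proj (b.sec w)) = w :=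
  b.chart.right_inv hw

/-- The charts of the orbit space are smooth on `M`: up to the action of a fixed group element,
the chart is the second component of the inverse of the flow box. -/
theorem contMDiffOn_chart_proj :
    ContMDiffOn (𝓡 7) (𝓡 6) ∞ (fun x : M ↦ b.chart (proj x)) (proj ⁻¹' b.chart.source) := by
  intro y hy
  set w := b.chart (proj y) with hw
  have hwd : w ∈ b.dom := b.chart.map_source hy
  have h1 : proj (b.sec w) = proj y := b.chart.left_inv hy
  obtain ⟨z, hz⟩ := exists_smul_of_proj_eq h1.symm
  have hzs := contMDiff_smul_circle (M := M) z
  have hzt : z • y ∈ b.box.target := by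
    rw [hz, ← b.box_zero hwd]
    exact b.box.map_source (b.mem_source b.zero_mem hwd)
  have h2 : ContMDiffAt (𝓡 7) 𝓘(ℝ, ℝ × EuclideanSpace ℝ (Fin 6)) ∞ (fun x ↦ b.box.symm (z • x)) y :=
    (b.contMDiffOn_symm.contMDiffAt (b.box.open_target.mem_nhds hzt)).comp y hzs.contMDiffAt
  have h3 : ContMDiffAt (𝓡 7) (𝓡 6) ∞ (fun x ↦ (b.box.symm (z • x)).2) y :=
    contDiff_snd.contMDiff.contMDiffAt.comp y h2
  refine (h3.congr_of_eventuallyEq ?_).contMDiffWithinAt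
  filter_upwards [hzs.continuous.continuousAt.preimage_mem_nhds (b.box.open_target.mem_nhds hzt)]
    with x hx
  have hp := b.box.map_target hx
  have h4 := b.proj_box hp
  rw [b.box.right_inv hx, proj_smul] at h4
  rw [b.source_eq] at hp
  rw [h4, b.chart_proj_sec hp.2]

end FlowBox

/-! ### The orbit space as a manifold -/

section Manifold

variable [T2Space M] [ContMDiffSMul (𝓡 1) (𝓡 7) ∞ Circle M] [IsManifold (𝓡 7) ∞ M]

/-- The smooth structure of the orbit space of a free action, given by all slices. -/
@[reducible]
def orbitChartedSpace (hfree : ∀ (z : Circle) (x : M), z • x = x → z = 1) :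
    ChartedSpace (EuclideanSpace ℝ (Fin 6)) (OrbitSpace M) where
  atlas := {e | ∃ b : FlowBox M, b.chart = e}
  chartAt y := (exists_flowBox hfree (Quotient.out y)).choose.chart
  mem_chart_source y := by
    obtain ⟨h0, hs⟩ := (exists_flowBox hfree (Quotient.out y)).choose_spec
    have h := FlowBox.proj_sec_mem_chart_source _ h0
    rw [hs] at h
    convert h
    exact (Quotient.out_eq' y).symm
  chart_mem_atlas y := ⟨_, rfl⟩

/-- A change of charts is a slice followed by another chart composed with the projection. -/
theorem isManifold_orbitSpace (hfree : ∀ (z : Circle) (x : M), z • x = x → z = 1) :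
    letI := orbitChartedSpace hfree
    IsManifold (𝓡 6) ∞ (OrbitSpace M) := by
  let _ := orbitChartedSpace hfree
  refine isManifold_of_contDiffOn _ _ _ ?_
  rintro _ _ ⟨b, rfl⟩ ⟨b', rfl⟩
  rw [← contMDiffOn_iff_contDiffOn]
  refine (b'.contMDiffOn_chart_proj.comp (b.contMDiffOn_sec.mono fun w hw ↦ ?_) fun w hw ↦ ?_)
  · exact hw.1.1
  · exact hw.1.2

/-- In a flow box the projection forgets the time. -/
theorem isSubmersion_proj (hfree : ∀ (z : Circle) (x : M), z • x = x → z = 1) :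
    letI := orbitChartedSpace hfree
    Manifold.IsSubmersion (𝓡 7) (𝓡 6) ∞ (proj : M → OrbitSpace M) := by
  let _ := orbitChartedSpace hfree
  have := isManifold_orbitSpace hfree
  obtain ⟨L⟩ : Nonempty ((ℝ × EuclideanSpace ℝ (Fin 6)) ≃L[ℝ] EuclideanSpace ℝ (Fin 7)) := by
    refine FiniteDimensional.nonempty_continuousLinearEquiv_of_finrank_eq ?_
    simp
  refine Manifold.IsSubmersionOfComplement.isSubmersion (F := ℝ) fun x ↦ ?_
  obtain ⟨b, h0, rfl⟩ := exists_flowBox hfree x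
  have h0s := b.mem_source b.zero_mem h0
  -- the chart of `M` is the flow box, with the time coordinate moved to the second place
  refine .mk_of_continuousAt continuous_proj.continuousAt
    (L.symm.trans (ContinuousLinearEquiv.prodComm ℝ _ _))
    (b.box.symm.trans L.toHomeomorph.toOpenPartialHomeomorph) b.chart ?_
    (b.proj_sec_mem_chart_source h0) ?_ ?_ ?_
  · refine ⟨?_, Set.mem_univ _⟩
    rw [← b.box_zero h0]
    exact b.box.map_source h0s
  · refine OpenPartialHomeomorph.mem_maximalAtlas_of_contMDiffOn _ ?_ ?_
    · exact L.contDiff.contMDiff.comp_contMDiffOn (b.contMDiffOn_symm.mono fun y hy ↦ hy.1)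
    · exact b.contMDiffOn_box.comp L.symm.contDiff.contMDiff.contMDiffOn fun a ha ↦ ha.2
  · exact IsManifold.subset_maximalAtlas ⟨b, rfl⟩
  · intro a ha
    have ha' : L.symm a ∈ b.box.source := by
      simpa using ha
    have h1 := b.proj_box ha'
    rw [b.source_eq] at ha'
    have h2 := b.chart_proj_sec ha'.2
    rw [← h1] at h2
    simpa using h2

end Manifold

end CircleG2

end

theorem mainTheorem9 {M : Type*} [TopologicalSpace M] [T2Space M] [SecondCountableTopology M]
    [ChartedSpace (EuclideanSpace ℝ (Fin 7)) M] [IsManifold (𝓡 7) ∞ M]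
    [MulAction Circle M] [ContMDiffSMul (𝓡 1) (𝓡 7) ∞ Circle M]
    (hfree : ∀ (z : Circle) (x : M), z • x = x → z = 1) :
    -- the quotient `N = M / S¹` is a smooth `6`-manifold and `π` is a submersion
    (T2Space (CircleG2.OrbitSpace M) ∧ SecondCountableTopology (CircleG2.OrbitSpace M) ∧
      ∃ _ : ChartedSpace (EuclideanSpace ℝ (Fin 6)) (CircleG2.OrbitSpace M),
        IsManifold (𝓡 6) ∞ (CircleG2.OrbitSpace M) ∧
          Manifold.IsSubmersion (𝓡 7) (𝓡 6) ∞ (CircleG2.proj : M → CircleG2.OrbitSpace M)) ∧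
    -- `h` is positive and basic, `η` is an invariant connection form, `η(ξ) = 1`
    (∀ φ : CircleG2.DForm 7 M 3 ℝ, CircleG2.IsInvariantG2 φ →
      (∀ x, 0 < CircleG2.hFun φ x) ∧
      ContMDiff (𝓡 7) 𝓘(ℝ, ℝ) ∞ (CircleG2.hFun φ) ∧
      (∀ x, mfderiv (𝓡 7) 𝓘(ℝ, ℝ) (CircleG2.hFun φ) x (CircleG2.fundField x) = (0 : ℝ)) ∧
      (∀ (z : Circle) (x : M), CircleG2.hFun φ (z • x) = CircleG2.hFun φ x) ∧
      CircleG2.IsConnectionForm (CircleG2.etaForm φ)) ∧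
    -- for the quotient smooth structure, `φ ↦ (h, η, ω, Ω)` is a bijection between invariant
    -- `G₂`-structures on `M` and reduced data, with inverse `η ∧ π^* ω + h ^ (3/4) π^* Re Ω`
    (∀ [ChartedSpace (EuclideanSpace ℝ (Fin 6)) (CircleG2.OrbitSpace M)]
      [IsManifold (𝓡 6) ∞ (CircleG2.OrbitSpace M)],
      Manifold.IsSubmersion (𝓡 7) (𝓡 6) ∞ (CircleG2.proj : M → CircleG2.OrbitSpace M) →
      ∃ e : {φ : CircleG2.DForm 7 M 3 ℝ // CircleG2.IsInvariantG2 φ} ≃ CircleG2.ReducedData M,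
        (∀ φ D, e φ = D ↔ CircleG2.IsReductionOf D φ.1) ∧
        (∀ D, (e.symm D).1 = CircleG2.reconstruct D)) := by
  refine ⟨⟨CircleG2.t2Space_orbitSpace, CircleG2.secondCountableTopology_orbitSpace,
    CircleG2.orbitChartedSpace hfree, CircleG2.isManifold_orbitSpace hfree,
    CircleG2.isSubmersion_proj hfree⟩, fun φ hφ ↦ ⟨hφ.isG2.hFun_pos hfree,
    hφ.isG2.contMDiff_hFun hfree, hφ.mfderiv_hFun_field hfree, hφ.hFun_smul,
    hφ.isConnectionForm_etaForm hfree⟩, ?_⟩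
  intro _ _ hπ
  exact CircleG2.exists_reductionEquiv hfree hπ
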